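/- **Rough path extension.** Let $\mathcal H=\bigoplus_{k\ge 0}\mathcal H_{(k)}$ be a locally finite graded connected real Hopf algebra with counit $\varepsilon$: $\mathcal H_{(0)}=\mathbb R\mathbf 1$, every $\mathcal H_{(k)}$ is finite-dimensional, and product and coproduct $\Delta$ respect the grading. For $n\ge 0$ put $\mathcal H_n=\bigoplus_{k\le n}\mathcal H_{(k)}$, a subcoalgebra, and let $(\mathcal H_n^*,\star,\varepsilon)$ be its dual algebra, with the convolution product $\langle f\star g,x\rangle=\langle f\otimes g,\Delta x\rangle$. Let $\mathfrak g^n\subset\mathcal H_n^*$ be the space of restrictions to $\mathcal H_n$ of infinitesimal characters of $\mathcal H$, that is, of linear maps $\alpha:\mathcal H\to\mathbb R$ with $\alpha(xy)=\alpha(x)\varepsilon(y)+\varepsilon(x)\alpha(y)$. Put $\exp_n(\alpha)=\sum_{k=0}^n\alpha^{\star k}/k!$ and $\log_n(X)=\sum_{k=1}^n(-1)^{k+1}(X-\varepsilon)^{\star k}/k$, and let $G^n=\exp_n(\mathfrak g^n)$ be the truncated character group. For a basis $B$ of $\mathcal H_n$ write $\Delta v=\sum_{v_1,v_2\in B}c(v_1,v_2;v)\,v_1\otimes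 v_2$ for $v\in B$. Put $D=\max_{v\in B}\sum_{v_1,v_2}|c(v_1,v_2;v)|$ and $\|f\|=D\max_{v\in B}|\langle f,v\rangle|$ for $f\in\mathcal H_n^*$. Denote by $X_k$ the homogeneous component of degree $k$ of $X\in\mathcal H_n^*$ (equal to $X$ on $\mathcal H_{(k)}$ and to $0$ on the other components), and put, for $X,Y\in G^n$, $$|X|=\max_{1\le k\le n}\bigl(k!\,\|X_k\|\bigr)^{1/k}+\max_{1\le k\le n}\bigl(k!\,\|(X^{-1})_k\|\bigr)^{1/k},\qquad \rho_n(X,Y)=|Y^{-1}\star X|.$$ An $(\mathcal H_n,\gamma)$-Hölder path is a map $\mathbf X:[0,1]\to G^n$ with $\mathbf X_0=\varepsilon$ for which there is a constant $C$ with $\rho_n(\mathbf X_s,\mathbf X_t)\le C|t-s|^\gamma$ for all $s,t\in[0,1]$. Let $\gamma\in(0,1)$ with $\gamma^{-1}\notin\mathbb N$, let $N=\lfloor\gamma^{-1}\rfloor$ and $1\le n\le N-1$. Fix bases of $\mathcal H_n$ and $\mathcal H_{n+1}$ (defining $\rho_n$ and $\rho_{n+1}$), and let $\mathbf X$ be an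 $(\mathcal H_n,\gamma)$-Hölder path. Then there is an $(\mathcal H_{n+1},\gamma)$-Hölder path $\tilde{\mathbf X}:[0,1]\to(G^{n+1},\rho_{n+1})$ extending $\mathbf X$, i.e. $\tilde{\mathbf X}_t|_{\mathcal H_n}=\mathbf X_t$ for all $t\in[0,1]$. Moreover, there is exactly one such $\tilde{\mathbf X}$ that is given on the dyadic points $t^m_k=k2^{-m}$ by the following explicit recursion: $$\tilde{\mathbf X}_{t^m_k}^{-1}\star\tilde{\mathbf X}_{t^m_{k+1}}=\exp_{n+1}\bigl(L^m_k+Z^m_k\bigr)\qquad(m\ge 0,\ 0\le k<2^m).$$ Here $L^m_k=\log_n\bigl(\mathbf X_{t^m_k}^{-1}\star\mathbf X_{t^m_{k+1}}\bigr)$, extended by $0$ to $\mathcal H_{(n+1)}$; and $Z^0_0=0$, $$Z^{m+1}_{2k}=Z^{m+1}_{2k+1}=\tfrac12Z^m_k-\tfrac12\,\mathrm{BCH}_{(n+1)}\bigl(L^{m+1}_{2k},L^{m+1}_{2k+1}\bigr),$$ where $\mathrm{BCH}_{(n+1)}(\alpha,\beta)$ is the homogeneous component of degree $n+1$ of $$\sum_{k=1}^{n+1}\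 \sum_{i+j=k}\frac1{i!\,j!}\,\varphi_k(\alpha^{\otimes i}\otimes\beta^{\otimes j}),\qquad \varphi_k(\alpha_1\otimes\dots\otimes\alpha_k)=\sum_{\sigma\in S_k}\frac{(-1)^{d(\sigma)}}{k}\binom{k-1}{d(\sigma)}^{-1}\alpha_{\sigma(1)}\star\dots\star\alpha_{\sigma(k)},$$ the products being taken in $\mathcal H_{n+1}^*$, and $d(\sigma)$ is the number of $i$ with $\sigma(i)>\sigma(i+1)$. -/

import Mathlib

open scoped TensorProduct Nat

noncomputable section

namespace RoughExt

/-! ### Locally finite graded connected Hopf algebras and their truncations -/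

/-- The graded algebra structure `H = ⨁ n, 𝒜 n` makes the real Hopf algebra `H` a locally finite
graded connected Hopf algebra. (That the product respects the grading is part of
`GradedAlgebra 𝒜`.) -/
class LocallyFiniteGradedConnected {H : Type*} [Ring H] [HopfAlgebra ℝ H]
    (𝒜 : ℕ → Submodule ℝ H) [GradedAlgebra 𝒜] : Prop where
  connected : 𝒜 0 = Submodule.span ℝ {(1 : H)}
  finite (n : ℕ) : Module.Finite ℝ (𝒜 n)
  comul_mem (n : ℕ) (x : H) (hx : x ∈ 𝒜 n) :
    Coalgebra.comul (R := ℝ) x ∈ ⨆ p ∈ Finset.HasAntidiagonal.antidiagonal n,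
      LinearMap.range (TensorProduct.map (𝒜 p.1).subtype (𝒜 p.2).subtype)

/-- The truncation `H_N = ⨁_{k ≤ N} H_(k)`. -/
def trunc {H : Type*} [Ring H] [HopfAlgebra ℝ H] (𝒜 : ℕ → Submodule ℝ H) (N : ℕ) :
    Submodule ℝ H :=
  ⨆ (k : ℕ) (_ : k ≤ N), 𝒜 k

section Trunc

variable {H : Type*} [Ring H] [HopfAlgebra ℝ H] (𝒜 : ℕ → Submodule ℝ H)

theorem le_trunc {k N : ℕ} (h : k ≤ N) : 𝒜 k ≤ trunc 𝒜 N :=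
  le_iSup₂_of_le k h le_rfl

theorem trunc_mono {m n : ℕ} (h : m ≤ n) : trunc 𝒜 m ≤ trunc 𝒜 n :=
  iSup₂_le fun _ hk => le_trunc 𝒜 (hk.trans h)

variable [GradedAlgebra 𝒜]

theorem sum_proj_mem (N : ℕ) (x : H) :
    (∑ k ∈ Finset.range (N + 1), GradedAlgebra.proj 𝒜 k) x ∈ trunc 𝒜 N := by
  rw [LinearMap.sum_apply]
  refine Submodule.sum_mem _ fun k hk => ?_
  refine le_trunc 𝒜 (Nat.lt_succ_iff.mp (Finset.mem_range.mp hk)) ?_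
  rw [GradedAlgebra.proj_apply]
  exact SetLike.coe_mem _

/-- The canonical projection `π_N : H → H_N`. -/
def truncProj (N : ℕ) : H →ₗ[ℝ] trunc 𝒜 N :=
  (∑ k ∈ Finset.range (N + 1), GradedAlgebra.proj 𝒜 k).codRestrict (trunc 𝒜 N)
    (sum_proj_mem 𝒜 N)

theorem truncProj_coe_of_mem {k N : ℕ} (h : k ≤ N) {x : H} (hx : x ∈ 𝒜 k) :
    (truncProj 𝒜 N x : H) = x := by
  simp only [truncProj, LinearMap.codRestrict_apply, LinearMap.sum_apply,
    GradedAlgebra.proj_apply]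
  rw [Finset.sum_eq_single k]
  · exact DirectSum.decompose_of_mem_same 𝒜 hx
  · intro j _ hj
    exact DirectSum.decompose_of_mem_ne 𝒜 hx hj.symm
  · intro hk
    exact absurd (Finset.mem_range.mpr (Nat.lt_succ_of_le h)) hk

theorem truncProj_coe (N : ℕ) (x : trunc 𝒜 N) : truncProj 𝒜 N (x : H) = x := by
  have h : trunc 𝒜 N ≤ LinearMap.eqLocus ((trunc 𝒜 N).subtype ∘ₗ truncProj 𝒜 N) LinearMap.id :=
    iSup₂_le fun k hk y hy => truncProj_coe_of_mem 𝒜 hk hy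
  exact Subtype.ext (h x.2)

theorem truncProj_comp_subtype (N : ℕ) :
    truncProj 𝒜 N ∘ₗ (trunc 𝒜 N).subtype = LinearMap.id :=
  LinearMap.ext (truncProj_coe 𝒜 N)

/-- The coproduct of `H_N`, with values in `H_N ⊗ H_N`. -/
def truncComul (N : ℕ) : trunc 𝒜 N →ₗ[ℝ] trunc 𝒜 N ⊗[ℝ] trunc 𝒜 N :=
  TensorProduct.map (truncProj 𝒜 N) (truncProj 𝒜 N) ∘ₗ Coalgebra.comul ∘ₗ (trunc 𝒜 N).subtype

/-- The coproduct of `H_N` is the restriction of the coproduct of `H`. -/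
theorem map_subtype_truncComul [LocallyFiniteGradedConnected 𝒜] (N : ℕ) :
    TensorProduct.map (trunc 𝒜 N).subtype (trunc 𝒜 N).subtype ∘ₗ truncComul 𝒜 N =
      Coalgebra.comul ∘ₗ (trunc 𝒜 N).subtype := by
  have key : trunc 𝒜 N ≤ LinearMap.eqLocus
      (TensorProduct.map ((trunc 𝒜 N).subtype ∘ₗ truncProj 𝒜 N)
        ((trunc 𝒜 N).subtype ∘ₗ truncProj 𝒜 N) ∘ₗ Coalgebra.comul (R := ℝ))
      (Coalgebra.comul (R := ℝ)) := by
    refine iSup₂_le fun k hk y hy => ?_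
    have h2 : (⨆ p ∈ Finset.HasAntidiagonal.antidiagonal k,
        LinearMap.range (TensorProduct.map (𝒜 p.1).subtype (𝒜 p.2).subtype)) ≤
        LinearMap.eqLocus (TensorProduct.map ((trunc 𝒜 N).subtype ∘ₗ truncProj 𝒜 N)
          ((trunc 𝒜 N).subtype ∘ₗ truncProj 𝒜 N)) LinearMap.id := by
      refine iSup₂_le fun p hp => ?_
      rw [Finset.HasAntidiagonal.mem_antidiagonal] at hp
      rintro _ ⟨z, rfl⟩
      rw [LinearMap.mem_eqLocus, ← LinearMap.comp_apply, ← TensorProduct.map_comp]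
      have e : ∀ j, j ≤ N → ((trunc 𝒜 N).subtype ∘ₗ truncProj 𝒜 N) ∘ₗ (𝒜 j).subtype =
          (𝒜 j).subtype := fun j hj =>
        LinearMap.ext fun u => truncProj_coe_of_mem 𝒜 hj u.2
      rw [e _ (by omega), e _ (by omega), LinearMap.id_apply]
    exact h2 (LocallyFiniteGradedConnected.comul_mem k y hy)
  refine LinearMap.ext fun x => ?_
  have := key x.2
  rw [LinearMap.mem_eqLocus, TensorProduct.map_comp] at this
  exact this

/-- `H_N` is a counital subcoalgebra of `H`. -/
instance truncCoalgebra [LocallyFiniteGradedConnected 𝒜] (N : ℕ) :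
    Coalgebra ℝ (trunc 𝒜 N) where
  comul := truncComul 𝒜 N
  counit := Coalgebra.counit ∘ₗ (trunc 𝒜 N).subtype
  coassoc := by
    set i := (trunc 𝒜 N).subtype with hi
    have hδ := map_subtype_truncComul 𝒜 N
    have hp := truncProj_comp_subtype 𝒜 N
    rw [← hi] at hδ hp
    have inj : Function.Injective (TensorProduct.map i (TensorProduct.map i i)) := by
      refine Function.LeftInverse.injective
        (g := TensorProduct.map (truncProj 𝒜 N)
          (TensorProduct.map (truncProj 𝒜 N) (truncProj 𝒜 N))) fun z => ?_
      rw [← LinearMap.comp_apply, ← TensorProduct.map_comp, ← TensorProduct.map_comp, hp]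
      simp
    refine LinearMap.ext fun x => inj ?_
    have hx : TensorProduct.map i i (truncComul 𝒜 N x) = Coalgebra.comul (R := ℝ) (i x) :=
      LinearMap.congr_fun hδ x
    have h1 : TensorProduct.map i (TensorProduct.map i i) ∘ₗ
        (TensorProduct.assoc ℝ (trunc 𝒜 N) (trunc 𝒜 N) (trunc 𝒜 N)).toLinearMap ∘ₗ
          (truncComul 𝒜 N).rTensor (trunc 𝒜 N) =
        (TensorProduct.assoc ℝ H H H).toLinearMap ∘ₗ
          (Coalgebra.comul (R := ℝ) (A := H)).rTensor H ∘ₗ TensorProduct.map i i := by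
      have a : TensorProduct.map i (TensorProduct.map i i) ∘ₗ
          (TensorProduct.assoc ℝ (trunc 𝒜 N) (trunc 𝒜 N) (trunc 𝒜 N)).toLinearMap =
          (TensorProduct.assoc ℝ H H H).toLinearMap ∘ₗ
            TensorProduct.map (TensorProduct.map i i) i := by
        ext; rfl
      rw [← LinearMap.comp_assoc, a, LinearMap.comp_assoc, LinearMap.rTensor,
        ← TensorProduct.map_comp, hδ, LinearMap.rTensor, ← TensorProduct.map_comp]
      rfl
    have h2 : TensorProduct.map i (TensorProduct.map i i) ∘ₗ
          (truncComul 𝒜 N).lTensor (trunc 𝒜 N) =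
        (Coalgebra.comul (R := ℝ) (A := H)).lTensor H ∘ₗ TensorProduct.map i i := by
      rw [LinearMap.lTensor, ← TensorProduct.map_comp, hδ, LinearMap.lTensor,
        ← TensorProduct.map_comp]
      rfl
    have e1 := LinearMap.congr_fun h1 (truncComul 𝒜 N x)
    have e2 := LinearMap.congr_fun h2 (truncComul 𝒜 N x)
    simp only [LinearMap.comp_apply, hx] at e1 e2
    simp only [LinearMap.comp_apply]
    rw [e1, e2]
    exact Coalgebra.coassoc_apply (R := ℝ) (i x)
  rTensor_counit_comp_comul := by
    set i := (trunc 𝒜 N).subtype with hi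
    have hδ := map_subtype_truncComul 𝒜 N
    have hp := truncProj_comp_subtype 𝒜 N
    rw [← hi] at hδ hp
    have inj : Function.Injective (i.lTensor ℝ) := by
      refine Function.LeftInverse.injective (g := (truncProj 𝒜 N).lTensor ℝ) fun z => ?_
      rw [← LinearMap.comp_apply, ← LinearMap.lTensor_comp, hp]
      simp
    refine LinearMap.ext fun x => inj ?_
    have hx : TensorProduct.map i i (truncComul 𝒜 N x) = Coalgebra.comul (R := ℝ) (i x) :=
      LinearMap.congr_fun hδ x
    have h1 : i.lTensor ℝ ∘ₗ
        (Coalgebra.counit (R := ℝ) (A := H) ∘ₗ i).rTensor (trunc 𝒜 N) =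
        (Coalgebra.counit (R := ℝ) (A := H)).rTensor H ∘ₗ TensorProduct.map i i := by
      rw [LinearMap.lTensor, LinearMap.rTensor, LinearMap.rTensor, ← TensorProduct.map_comp,
        ← TensorProduct.map_comp]
      rfl
    have e1 := LinearMap.congr_fun h1 (truncComul 𝒜 N x)
    simp only [LinearMap.comp_apply, hx] at e1
    simp only [LinearMap.comp_apply]
    rw [e1, Coalgebra.rTensor_counit_comul]
    rfl
  lTensor_counit_comp_comul := by
    set i := (trunc 𝒜 N).subtype with hi
    have hδ := map_subtype_truncComul 𝒜 N
    have hp := truncProj_comp_subtype 𝒜 N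
    rw [← hi] at hδ hp
    have inj : Function.Injective (i.rTensor ℝ) := by
      refine Function.LeftInverse.injective (g := (truncProj 𝒜 N).rTensor ℝ) fun z => ?_
      rw [← LinearMap.comp_apply, ← LinearMap.rTensor_comp, hp]
      simp
    refine LinearMap.ext fun x => inj ?_
    have hx : TensorProduct.map i i (truncComul 𝒜 N x) = Coalgebra.comul (R := ℝ) (i x) :=
      LinearMap.congr_fun hδ x
    have h1 : i.rTensor ℝ ∘ₗ
        (Coalgebra.counit (R := ℝ) (A := H) ∘ₗ i).lTensor (trunc 𝒜 N) =
        (Coalgebra.counit (R := ℝ) (A := H)).lTensor H ∘ₗ TensorProduct.map i i := by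
      rw [LinearMap.rTensor, LinearMap.lTensor, LinearMap.lTensor, ← TensorProduct.map_comp,
        ← TensorProduct.map_comp]
      rfl
    have e1 := LinearMap.congr_fun h1 (truncComul 𝒜 N x)
    simp only [LinearMap.comp_apply, hx] at e1
    simp only [LinearMap.comp_apply]
    rw [e1, Coalgebra.lTensor_counit_comul]
    rfl

/-- The dual algebra `(H_N^*, ⋆, ε)`: the dual space of `H_N` with the convolution product. -/
abbrev TruncDual (N : ℕ) : Type _ := WithConv (trunc 𝒜 N →ₗ[ℝ] ℝ)

end Trunc

/-! ### Infinitesimal characters and the truncated character group -/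

/-- The infinitesimal characters of `H`: linear maps `α : H → ℝ` with
`α (x y) = α x * ε y + ε x * α y`. -/
def infChar (H : Type*) [Ring H] [HopfAlgebra ℝ H] : Submodule ℝ (Module.Dual ℝ H) where
  carrier := {α | ∀ x y : H, α (x * y) =
    α x * Coalgebra.counit (R := ℝ) y + Coalgebra.counit (R := ℝ) x * α y}
  add_mem' := by
    intro α β hα hβ x y
    simp only [LinearMap.add_apply, hα x y, hβ x y]
    ring
  zero_mem' := by
    intro x y
    simp
  smul_mem' := by
    intro c α hα x y
    simp only [LinearMap.smul_apply, smul_eq_mul, hα x y]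
    ring

section Group

variable {H : Type*} [Ring H] [HopfAlgebra ℝ H] (𝒜 : ℕ → Submodule ℝ H) [GradedAlgebra 𝒜]
  [LocallyFiniteGradedConnected 𝒜]

/-- The truncated Lie algebra `𝔤^N ⊆ H_N^*` : the restrictions to `H_N` of the infinitesimal
characters of `H`. -/
def truncInfChar (N : ℕ) : Set (TruncDual 𝒜 N) :=
  {α | ∃ β ∈ infChar H, α = WithConv.toConv (β ∘ₗ (trunc 𝒜 N).subtype)}

variable {𝒜}

/-- The truncated exponential `exp_N α = ∑_{k ≤ N} α^{⋆ k} / k!`. -/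
def truncExp {N : ℕ} (α : TruncDual 𝒜 N) : TruncDual 𝒜 N :=
  ∑ k ∈ Finset.range (N + 1), ((k ! : ℝ)⁻¹) • α ^ k

/-- The truncated logarithm `log_N X = ∑_{1 ≤ k ≤ N} (-1)^(k+1) (X - ε)^{⋆ k} / k`. -/
def truncLog {N : ℕ} (X : TruncDual 𝒜 N) : TruncDual 𝒜 N :=
  ∑ k ∈ Finset.Icc 1 N, ((-1 : ℝ) ^ (k + 1) / k) • (X - 1) ^ k

variable (𝒜) in
/-- The truncated character group `G^N = exp_N (𝔤^N)`. -/
def charGroup (N : ℕ) : Set (TruncDual 𝒜 N) := truncExp '' truncInfChar 𝒜 N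

/-- The canonical inclusion `H_n^* → H_m^*` for `n ≤ m`, extending a functional by zero on the
components of degree larger than `n`. -/
def extendZero {n : ℕ} (m : ℕ) (f : TruncDual 𝒜 n) : TruncDual 𝒜 m :=
  WithConv.toConv (f.ofConv ∘ₗ truncProj 𝒜 n ∘ₗ (trunc 𝒜 m).subtype)

/-- The restriction of a functional on `H_(n+1)` to `H_n`. -/
def restrict {n : ℕ} (f : TruncDual 𝒜 (n + 1)) : TruncDual 𝒜 n :=
  WithConv.toConv (f.ofConv ∘ₗ Submodule.inclusion (trunc_mono 𝒜 n.le_succ))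

/-- The homogeneous component `X_k` of `X`, which agrees with `X` on `H_(k)` and vanishes on the
other homogeneous components. -/
def component {N : ℕ} (k : ℕ) (X : TruncDual 𝒜 N) : TruncDual 𝒜 N :=
  WithConv.toConv
    (X.ofConv ∘ₗ truncProj 𝒜 N ∘ₗ GradedAlgebra.proj 𝒜 k ∘ₗ (trunc 𝒜 N).subtype)

/-! ### The homogeneous norm and metric -/

variable {ι : Type*} [Fintype ι] {N : ℕ}

/-- `D = max_v ∑ |c(v₁, v₂; v)|`, where `Δ v = ∑ c(v₁, v₂; v) v₁ ⊗ v₂` in the basis `b`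
(in `ι → ℝ`, the norm is the maximum norm). -/
def coprodConst (b : Module.Basis ι ℝ (trunc 𝒜 N)) : ℝ :=
  ‖fun i : ι => ∑ p : ι × ι,
    |(b.tensorProduct b).repr (Coalgebra.comul (R := ℝ) (b i)) p|‖

/-- The norm `D * max_v |f v|` on `H_N^*`, where `v` runs through the basis `b`. -/
def dualNorm (b : Module.Basis ι ℝ (trunc 𝒜 N)) (f : TruncDual 𝒜 N) : ℝ :=
  coprodConst b * ‖fun i : ι => f (b i)‖

/-- The homogeneous norm
`|X| = max_k (k! ‖X_k‖)^(1/k) + max_k (k! ‖(X⁻¹)_k‖)^(1/k)`, with `k = 1, …, N`. -/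
def homNorm (b : Module.Basis ι ℝ (trunc 𝒜 N)) (X : TruncDual 𝒜 N) : ℝ :=
  (⨆ k : Fin N, (((k : ℕ) + 1)! * dualNorm b (component (k + 1) X)) ^ (1 / ((k : ℝ) + 1))) +
  ⨆ k : Fin N,
    (((k : ℕ) + 1)! * dualNorm b (component (k + 1) (Ring.inverse X))) ^ (1 / ((k : ℝ) + 1))

/-- The left invariant homogeneous metric `ρ_N(X, Y) = |Y⁻¹ ⋆ X|`. -/
def homDist (b : Module.Basis ι ℝ (trunc 𝒜 N)) (X Y : TruncDual 𝒜 N) : ℝ :=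
  homNorm b (Ring.inverse Y * X)

/-- An `(H_N, γ)`-Hölder path: a path in `G^N` starting at the unit which is `γ`-Hölder for the
metric `ρ_N`. -/
structure IsHolderPath (b : Module.Basis ι ℝ (trunc 𝒜 N)) (γ : ℝ)
    (X : unitInterval → TruncDual 𝒜 N) : Prop where
  mem_charGroup : ∀ t, X t ∈ charGroup 𝒜 N
  zero : X 0 = 1
  holder : ∃ C : ℝ, ∀ s t : unitInterval,
    homDist b (X s) (X t) ≤ C * |(t : ℝ) - (s : ℝ)| ^ γ

end Group

/-! ### The Baker-Campbell-Hausdorff series with Reutenauer's coefficients -/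

/-- The descent number of a permutation: the number of `i` with `σ(i) > σ(i+1)`. -/
def descentNumber {k : ℕ} (σ : Equiv.Perm (Fin k)) : ℕ :=
  Set.ncard {i : Fin k | ∃ h : (i : ℕ) + 1 < k, σ ⟨(i : ℕ) + 1, h⟩ < σ i}

/-- `a_σ = (-1)^d(σ) / k * binom(k-1, d(σ))⁻¹` for `σ ∈ S_k`. -/
def reutenauerCoeff {k : ℕ} (σ : Equiv.Perm (Fin k)) : ℝ :=
  (-1) ^ descentNumber σ / k * ((Nat.choose (k - 1) (descentNumber σ) : ℝ))⁻¹

/-- `φ_k(α_1, …, α_k) = ∑_{σ ∈ S_k} a_σ α_{σ(1)} ⋯ α_{σ(k)}`. -/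
def reutenauerPhi {A : Type*} [Ring A] [Algebra ℝ A] {k : ℕ} (α : Fin k → A) : A :=
  ∑ σ : Equiv.Perm (Fin k), reutenauerCoeff σ • (List.ofFn fun i => α (σ i)).prod

/-- The part of the Baker-Campbell-Hausdorff series formed by brackets of at most `K` factors:
`∑_{1 ≤ k ≤ K} ∑_{i+j=k} φ_k(α, …, α, β, …, β) / (i! j!)`, with `i` times `α`, `j` times `β`. -/
def bch {A : Type*} [Ring A] [Algebra ℝ A] (K : ℕ) (α β : A) : A :=
  ∑ k ∈ Finset.Icc 1 K, ∑ p ∈ Finset.HasAntidiagonal.antidiagonal k,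
    ((p.1 ! : ℝ) * (p.2 ! : ℝ))⁻¹ •
      reutenauerPhi (Fin.append (fun _ : Fin p.1 => α) (fun _ : Fin p.2 => β))

/-! ### The dyadic recursion -/

/-- The dyadic point `t^m_k = k 2^(-m)` of `[0,1]`, for `k ≤ 2^m`. -/
def dyadic (m k : ℕ) : unitInterval :=
  Set.projIcc (0 : ℝ) 1 zero_le_one ((k : ℝ) / 2 ^ m)

section Recursion

variable {H : Type*} [Ring H] [HopfAlgebra ℝ H] {𝒜 : ℕ → Submodule ℝ H} [GradedAlgebra 𝒜]
  [LocallyFiniteGradedConnected 𝒜] {n : ℕ}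

/-- `L = log_n (X_s⁻¹ ⋆ X_t)` for `s = t^m_k`, `t = t^m_{k+1}`, included in `H_(n+1)^*`. -/
def dyadicLog (X : unitInterval → TruncDual 𝒜 n) (m k : ℕ) : TruncDual 𝒜 (n + 1) :=
  extendZero (n + 1)
    (truncLog (Ring.inverse (X (dyadic m k)) * X (dyadic m (k + 1))))

/-- The elements `Z^m_k` of degree `n + 1` attached to the dyadic intervals `[t^m_k, t^m_{k+1}]`:
`Z^0_0 = 0`, and both halves of `[t^m_k, t^m_{k+1}]` receive
`1/2 * Z^m_k - 1/2 * BCH_(n+1)(L^(m+1)_{2k}, L^(m+1)_{2k+1})`, where `BCH_(n+1)` is the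
homogeneous component of degree `n + 1` of the Baker-Campbell-Hausdorff series. -/
def dyadicZ (X : unitInterval → TruncDual 𝒜 n) : ℕ → ℕ → TruncDual 𝒜 (n + 1)
  | 0, _ => 0
  | m + 1, j =>
      (1 / 2 : ℝ) • dyadicZ X m (j / 2) -
      (1 / 2 : ℝ) • component (n + 1)
        (bch (n + 1) (dyadicLog X (m + 1) (2 * (j / 2)))
          (dyadicLog X (m + 1) (2 * (j / 2) + 1)))

end Recursion

end RoughExt

end

/-! Put θ = γ(n+1). A path over X in the dual of H_(n+1) has the form Y_t = L_t + P_t, where L_t =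
exp_{n+1}(log_n X_t) is `pathLift` and P_t lives in degree n+1 alone. Functionals of top degree are
killed by the augmentation ideal, so they pass unchanged through products with normalised elements
(`mul_of_top`, `of_top_mul`), and Y_t is a character when P_t is infinitesimal. Let E_{st} =
exp_{n+1}(log_n(X_s⁻¹X_t)) be `incrLift`. Its difference A_{st} from L_s⁻¹L_t (`liftDefect`) is
again of top degree, and Y_s⁻¹Y_t = E_{st} + (P_t - P_s - A_{st}) by `inverse_mul_pathLift_add`.
Since E_{st} is already of order |t-s|^{γk} in each degree k, the Hölder condition for Y means |P_t
- P_s - A_{st}| ≤ C|t-s|^θ, a scalar problem for each x in degree n+1.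

The defect A_{st} - A_{su} - A_{ut} is the top component of E_{st} - E_{su}E_{ut}, hence of order θ
(`nearlyAdditive_liftDefect`). Here θ < 1, because γ⁻¹ ≥ n+1 is not an integer, so the approximate
primitive P is not unique, but one is obtained by halving: each half of a dyadic interval receives
half of the parent's correction and half of the defect. Then |z_{m+1}| ≤ |z_m|/2 + C 2^{-θm}/2, so
z_m = O(2^{-θm}) thanks to θ < 1; thanks to θ > 0 these bounds are summable and P exists as a limit
(`exists_isDyadicPrimitive`). Primitives with the same dyadic corrections coincide
(`IsDyadicPrimitive.unique`). This gives the uniqueness claim, and it also transfers linearity in x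
and the infinitesimal character identity from A to P (`exists_correction`).

For the recursion, E_{su}E_{ut} is the exponential of log E_{st} + A_{su} + A_{ut} - A_{st}, so the
top BCH component is A_{su} + A_{ut} - A_{st} (`component_bch_incrLog`) and Z is the dyadic
correction. It remains to see that Reutenauer's series is log(exp α exp β) (`bch_eq_logSum`). The
logarithm of X is the coefficient of s in the polynomial s ↦ X^s. The multilinear part of (exp α_1 ⋯
exp α_k)^s sums over the maps f placing each letter in one of the s factors; the word of σ arises
from binom(s + asc σ, k) maps, and the linear coefficient of this binomial is Reutenauer's. The same
description of the logarithm shows that logarithms of characters are infinitesimal. -/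

namespace RoughExt

/-! ### Truncated exponential and logarithm in an algebra -/

section ExpLog

variable {A : Type*} [Ring A] [Algebra ℝ A]

/-- The truncated exponential `∑_{k ≤ N} a ^ k / k!` in an arbitrary real algebra. -/
noncomputable def expSum (N : ℕ) (a : A) : A :=
  ∑ k ∈ Finset.range (N + 1), ((k ! : ℝ)⁻¹) • a ^ k

/-- The truncated logarithm `∑_{1 ≤ k ≤ N} (-1)^(k+1) (X - 1) ^ k / k` in an arbitrary real
algebra. -/
noncomputable def logSum (N : ℕ) (X : A) : A :=
  ∑ k ∈ Finset.Icc 1 N, ((-1 : ℝ) ^ (k + 1) / k) • (X - 1) ^ k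

theorem expSum_mul_of_commute {N : ℕ} {a b : A} (hab : Commute a b) (ha : a ^ (N + 1) = 0)
    (hb : b ^ (N + 1) = 0) (hs : (a + b) ^ (N + 1) = 0) :
    expSum N a * expSum N b = expSum N (a + b) := by
  -- `IsNilpotent.exp` has rational coefficients, so the scalars are restricted to ℚ.
  let _ : Module ℚ A := Module.compHom A (algebraMap ℚ ℝ)
  have key : ∀ c : A, c ^ (N + 1) = 0 → expSum N c = IsNilpotent.exp c := by
    intro c hc
    rw [IsNilpotent.exp_eq_sum hc]
    refine Finset.sum_congr rfl fun k _ => ?_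
    change _ = (algebraMap ℚ ℝ (k ! : ℚ)⁻¹) • c ^ k
    rw [map_inv₀, map_natCast]
  rw [key a ha, key b hb, key _ hs, IsNilpotent.exp_add_of_commute hab ⟨_, ha⟩ ⟨_, hb⟩]

theorem expSum_zero (N : ℕ) : expSum N (0 : A) = 1 := by
  rw [expSum, Finset.sum_range_succ', Finset.sum_eq_zero] <;> simp

theorem expSum_mul_expSum_neg {N : ℕ} {a : A} (ha : a ^ (N + 1) = 0) :
    expSum N a * expSum N (-a) = 1 := by
  rw [expSum_mul_of_commute (Commute.neg_right (Commute.refl a)) ha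
    (by rw [neg_pow, ha, mul_zero]) (by simp), add_neg_cancel, expSum_zero]

theorem expSum_pow {N : ℕ} {a : A} (ha : a ^ (N + 1) = 0) (s : ℕ) :
    expSum N a ^ s = expSum N ((s : ℝ) • a) := by
  induction s with
  | zero => simp [expSum_zero]
  | succ s ih =>
    have h : ((s + 1 : ℕ) : ℝ) • a = (s : ℝ) • a + a := by
      rw [Nat.cast_succ, add_smul, one_smul]
    rw [pow_succ, ih, h, expSum_mul_of_commute ((Commute.refl a).smul_left _)
      (by rw [smul_pow, ha, smul_zero]) ha (by rw [← h, smul_pow, ha, smul_zero])]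

/-! ### Linear coefficients of polynomial sequences -/

/-- The sequence `f : ℕ → A` is weakly polynomial, and `c` is the coefficient of its linear
term. -/
def HasLinCoeff {V : Type*} [AddCommGroup V] [Module ℝ V] (f : ℕ → V) (c : V) : Prop :=
  ∀ ℓ : Module.Dual ℝ V, ∃ p : Polynomial ℝ, (∀ s : ℕ, ℓ (f s) = p.eval (s : ℝ)) ∧
    p.coeff 1 = ℓ c

theorem polynomial_eq_of_eval_nat {p q : Polynomial ℝ}
    (h : ∀ s : ℕ, p.eval (s : ℝ) = q.eval (s : ℝ)) : p = q := by
  refine Polynomial.eq_of_infinite_eval_eq p q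
    ((Set.infinite_range_of_injective (Nat.cast_injective (R := ℝ))).mono ?_)
  rintro _ ⟨s, rfl⟩
  exact h s

namespace HasLinCoeff

variable {V : Type*} [AddCommGroup V] [Module ℝ V]

theorem unique {f : ℕ → V} {c d : V} (hc : HasLinCoeff f c) (hd : HasLinCoeff f d) : c = d := by
  rw [← sub_eq_zero, ← Module.forall_dual_apply_eq_zero_iff ℝ]
  intro ℓ
  obtain ⟨p, hp, hpc⟩ := hc ℓ
  obtain ⟨q, hq, hqd⟩ := hd ℓ
  have : p = q := polynomial_eq_of_eval_nat fun s => by rw [← hp, ← hq]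
  rw [map_sub, ← hpc, ← hqd, this, sub_self]

theorem eval_smul (p : Polynomial ℝ) (v : V) :
    HasLinCoeff (fun s : ℕ => p.eval (s : ℝ) • v) (p.coeff 1 • v) := fun ℓ =>
  ⟨p * Polynomial.C (ℓ v), fun s => by simp, by simp⟩

theorem sum {ι : Type*} (t : Finset ι) {f : ι → ℕ → V} {c : ι → V}
    (h : ∀ i ∈ t, HasLinCoeff (f i) (c i)) :
    HasLinCoeff (fun s => ∑ i ∈ t, f i s) (∑ i ∈ t, c i) := by
  intro ℓ
  choose! p hp hc using fun i hi => h i hi ℓ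
  refine ⟨∑ i ∈ t, p i, fun s => ?_, ?_⟩
  · rw [map_sum, Polynomial.eval_finsetSum]
    exact Finset.sum_congr rfl fun i hi => hp i hi s
  · rw [map_sum, Polynomial.finsetSum_coeff]
    exact Finset.sum_congr rfl hc

theorem smul (r : ℝ) {f : ℕ → V} {c : V} (h : HasLinCoeff f c) :
    HasLinCoeff (fun s => r • f s) (r • c) := by
  intro ℓ
  obtain ⟨p, hp, hc⟩ := h ℓ
  exact ⟨Polynomial.C r * p, fun s => by simp [hp], by simp [hc]⟩

end HasLinCoeff

/-- The polynomial `s ↦ binom(s + e, e + d + 1)`. -/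
noncomputable def shiftedBinom (e d : ℕ) : Polynomial ℝ :=
  Polynomial.C (((e + d + 1)! : ℝ)⁻¹) * (Polynomial.X *
    ((∏ i ∈ Finset.range e, (Polynomial.X + Polynomial.C ((i : ℝ) + 1))) *
      ∏ i ∈ Finset.range d, (Polynomial.X - Polynomial.C ((i : ℝ) + 1))))

/-- The factors s, s-1, …, s-d form a falling factorial; the factors s+1, …, s+e extend it upwards
to the one of length e+d+1 starting at s+e. -/
theorem shiftedBinom_eval (e d s : ℕ) :
    (shiftedBinom e d).eval (s : ℝ) = ((s + e).choose (e + d + 1) : ℝ) := by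
  have hd : ∀ d : ℕ, (s : ℝ) * ∏ i ∈ Finset.range d, ((s : ℝ) - (i + 1)) =
      (s.descFactorial (d + 1) : ℝ) := by
    intro d
    induction d with
    | zero => simp
    | succ d ih =>
      rw [Finset.prod_range_succ, ← mul_assoc, ih, Nat.descFactorial_succ s (d + 1)]
      rcases le_or_gt (d + 1) s with h | h
      · rw [Nat.cast_mul, Nat.cast_sub h]; push_cast; ring
      · rw [Nat.descFactorial_of_lt h]; simp
  have he : ∀ e : ℕ, (s : ℝ) * ((∏ i ∈ Finset.range e, ((s : ℝ) + (i + 1))) *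
      ∏ i ∈ Finset.range d, ((s : ℝ) - (i + 1))) =
      ((s + e).descFactorial (e + d + 1) : ℝ) := by
    intro e
    induction e with
    | zero => simpa using hd d
    | succ e ih =>
      rw [show e + 1 + d + 1 = (e + d + 1) + 1 by ring, ← add_assoc,
        Nat.succ_descFactorial_succ, Nat.cast_mul, ← ih, Finset.prod_range_succ]
      push_cast; ring
  have hf : ((e + d + 1)! : ℝ) ≠ 0 := by positivity
  simp only [shiftedBinom, Polynomial.eval_mul, Polynomial.eval_C, Polynomial.eval_X,
    Polynomial.eval_prod, Polynomial.eval_add, Polynomial.eval_sub]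
  rw [he, Nat.descFactorial_eq_factorial_mul_choose]
  push_cast
  rw [inv_mul_cancel_left₀ hf]

/-- After removal of the factor `X`, evaluation at 0 gives e! (-1)^d d! / (e+d+1)!. -/
theorem shiftedBinom_coeff_one (e d : ℕ) :
    (shiftedBinom e d).coeff 1 =
      (-1) ^ d / ((e + d + 1 : ℕ) : ℝ) * (((e + d).choose d : ℝ))⁻¹ := by
  have h1 : ∏ i ∈ Finset.range e, ((i : ℝ) + 1) = (e ! : ℝ) := by
    rw [← Finset.prod_range_add_one_eq_factorial]; push_cast; rfl
  have h2 : ∏ i ∈ Finset.range d, (-((i : ℝ) + 1)) = (-1) ^ d * (d ! : ℝ) := by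
    rw [← Finset.prod_range_add_one_eq_factorial, Finset.prod_neg]; push_cast; simp
  rw [shiftedBinom, Polynomial.coeff_C_mul, Polynomial.coeff_X_mul,
    Polynomial.coeff_zero_eq_eval_zero, Polynomial.eval_mul, Polynomial.eval_prod,
    Polynomial.eval_prod]
  simp only [Polynomial.eval_add, Polynomial.eval_sub, Polynomial.eval_X, Polynomial.eval_C,
    zero_add, zero_sub]
  rw [h1, h2, Nat.factorial_succ]
  have h3 : ((e + d).choose d : ℝ) * (d ! : ℝ) * (e ! : ℝ) = ((e + d)! : ℝ) := by
    exact_mod_cast (by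
      have := Nat.choose_mul_factorial_mul_factorial (Nat.le_add_left d e)
      rwa [Nat.add_sub_cancel] at this)
  have hc : ((e + d).choose d : ℝ) ≠ 0 :=
    Nat.cast_ne_zero.mpr (Nat.choose_pos (Nat.le_add_left d e)).ne'
  have hd : (d ! : ℝ) ≠ 0 := by positivity
  have he : (e ! : ℝ) ≠ 0 := by positivity
  have hk : ((e + d + 1 : ℕ) : ℝ) ≠ 0 := by positivity
  rw [Nat.cast_mul, ← h3]
  field_simp

/-- The powers of a unipotent element depend polynomially on the exponent. -/
theorem pow_eq_sum_choose {N : ℕ} {X : A} (hX : (X - 1) ^ (N + 1) = 0) (s : ℕ) :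
    X ^ s = 1 + ∑ k ∈ Finset.Icc 1 N, (s.choose k : ℝ) • (X - 1) ^ k := by
  have h0 : ∀ k, N < k → (X - 1) ^ k = 0 := fun k hk => pow_eq_zero_of_le hk hX
  have h1 : X ^ s = ∑ k ∈ Finset.range (s + 1), (s.choose k : ℝ) • (X - 1) ^ k := by
    conv_lhs => rw [← sub_add_cancel X 1, (Commute.one_right (X - 1)).add_pow]
    refine Finset.sum_congr rfl fun k _ => ?_
    rw [one_pow, mul_one, ← Nat.cast_commute, ← nsmul_eq_mul, Nat.cast_smul_eq_nsmul]
  -- The upper limits s and N are reconciled at M = s + N: the binomial vanishes beyond s, the power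
  -- beyond N.
  have h2 : ∀ M, s ≤ M → N ≤ M → X ^ s = ∑ k ∈ Finset.range (M + 1),
      (s.choose k : ℝ) • (X - 1) ^ k := by
    intro M hs _
    rw [h1]
    refine Finset.sum_subset (Finset.range_subset_range.mpr (by omega)) fun k _ hk => ?_
    rw [Nat.choose_eq_zero_of_lt (by simpa using hk), Nat.cast_zero, zero_smul]
  rw [h2 (s + N) (by omega) (by omega), Finset.sum_range_succ']
  simp only [Nat.choose_zero_right, Nat.cast_one, pow_zero, one_smul]
  rw [add_comm, Finset.range_eq_Ico, Finset.sum_Ico_add' (fun k => (s.choose k : ℝ) • (X - 1) ^ k)]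
  congr 1
  symm
  refine Finset.sum_subset (fun k hk => ?_) fun k hk hk' => ?_
  · simp at hk ⊢; omega
  · simp at hk hk'
    rw [h0 k (by omega), smul_zero]

/-- The linear coefficient of binom(s, k) is (-1)^(k+1)/k. The logarithm thus becomes the derivative
of s ↦ X^s at 0, and identities for logarithms reduce to comparing linear coefficients. -/
theorem hasLinCoeff_pow {N : ℕ} {X : A} (hX : (X - 1) ^ (N + 1) = 0) :
    HasLinCoeff (fun s => X ^ s) (logSum N X) := by
  have h1 : HasLinCoeff (fun _ : ℕ => (1 : A)) 0 := by
    simpa [Polynomial.coeff_one] using HasLinCoeff.eval_smul (1 : Polynomial ℝ) (1 : A)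
  have h2 : HasLinCoeff (fun s : ℕ => ∑ k ∈ Finset.Icc 1 N, (s.choose k : ℝ) • (X - 1) ^ k)
      (logSum N X) := by
    refine HasLinCoeff.sum _ fun k hk => ?_
    obtain ⟨d, rfl⟩ : ∃ d, k = d + 1 := ⟨k - 1, by simp at hk; omega⟩
    have := HasLinCoeff.eval_smul (shiftedBinom 0 d) ((X - 1) ^ (d + 1))
    simp only [shiftedBinom_eval, shiftedBinom_coeff_one] at this
    simpa [pow_succ] using this
  intro ℓ
  obtain ⟨p, hp, hpc⟩ := h1 ℓ
  obtain ⟨q, hq, hqc⟩ := h2 ℓ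
  refine ⟨p + q, fun s => ?_, by rw [Polynomial.coeff_add, hpc, hqc, map_zero, zero_add]⟩
  change ℓ (X ^ s) = _
  rw [pow_eq_sum_choose hX, map_add, Polynomial.eval_add, ← hp s, ← hq s]

theorem expSum_sub_one (N : ℕ) (a : A) :
    expSum N a - 1 = a * ∑ k ∈ Finset.range N, (((k + 1)! : ℝ)⁻¹) • a ^ k := by
  rw [expSum, Finset.sum_range_succ', Finset.mul_sum]
  simp [pow_succ']

theorem expSum_sub_one_pow {N : ℕ} {a : A} (ha : a ^ (N + 1) = 0) :
    (expSum N a - 1) ^ (N + 1) = 0 := by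
  rw [expSum_sub_one, Commute.mul_pow, ha, zero_mul]
  exact Commute.sum_right _ _ _ fun k _ => ((Commute.refl a).pow_right k).smul_right _

/-- The powers of exp a are exp(s a), visibly polynomial in s with linear coefficient a. -/
theorem logSum_expSum {N : ℕ} {a : A} (ha : a ^ (N + 1) = 0) : logSum N (expSum N a) = a := by
  refine (hasLinCoeff_pow (expSum_sub_one_pow ha)).unique ?_
  have h : HasLinCoeff (fun s : ℕ => expSum N a ^ s) (∑ k ∈ Finset.range (N + 1),
      (Polynomial.X ^ k : Polynomial ℝ).coeff 1 • ((k ! : ℝ)⁻¹) • a ^ k) := by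
    have := HasLinCoeff.sum (Finset.range (N + 1)) fun k _ =>
      HasLinCoeff.eval_smul (Polynomial.X ^ k : Polynomial ℝ) (((k ! : ℝ)⁻¹) • a ^ k)
    convert this using 2 with s
    rw [expSum_pow ha, expSum]
    refine Finset.sum_congr rfl fun k _ => ?_
    rw [smul_pow, Polynomial.eval_pow, Polynomial.eval_X, smul_comm]
  have e : (∑ k ∈ Finset.range (N + 1),
      (Polynomial.X ^ k : Polynomial ℝ).coeff 1 • ((k ! : ℝ)⁻¹) • a ^ k) = a := by
    rw [Finset.sum_eq_single 1]
    · simp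
    · intro k _ hk
      rw [Polynomial.coeff_X_pow, if_neg (Ne.symm hk), zero_smul]
    -- For N = 0 the linear term is missing from the sum, but then nilpotency says a = 0.
    · intro h1
      have : N = 0 := by simpa using h1
      subst this
      rw [show a ^ 1 = 0 from ha, smul_zero, smul_zero]
  rwa [e] at h

/-- The tensor square of an algebra. -/
abbrev TensorSq (A : Type*) [Ring A] [Algebra ℝ A] : Type _ := A ⊗[ℝ] A

/-- The exponential of a primitive element is group-like. -/
theorem expSum_primitive {N : ℕ} {a : A} (ha : a ^ (N + 1) = 0) :
    expSum (2 * N) (a ⊗ₜ[ℝ] 1 + 1 ⊗ₜ[ℝ] a : TensorSq A) =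
      expSum (2 * N) a ⊗ₜ expSum (2 * N) a := by
  have hz : a ^ (2 * N + 1) = 0 := pow_eq_zero_of_le (by omega) ha
  have hl : ∀ k, ((a ⊗ₜ[ℝ] (1 : A)) ^ k) = (a ^ k) ⊗ₜ 1 := fun k => by
    rw [Algebra.TensorProduct.tmul_pow, one_pow]
  have hr : ∀ k, (((1 : A) ⊗ₜ[ℝ] a) ^ k) = 1 ⊗ₜ (a ^ k) := fun k => by
    rw [Algebra.TensorProduct.tmul_pow, one_pow]
  have hc : Commute (a ⊗ₜ[ℝ] (1 : A)) ((1 : A) ⊗ₜ[ℝ] a) := by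
    rw [Commute, SemiconjBy, Algebra.TensorProduct.tmul_mul_tmul,
      Algebra.TensorProduct.tmul_mul_tmul]
    simp
  -- Two commuting elements of nilpotency order N+1 have a sum of order 2N+1; this is why the
  -- exponential is truncated at 2N.
  have hs : (a ⊗ₜ[ℝ] (1 : A) + (1 : A) ⊗ₜ[ℝ] a) ^ (2 * N + 1) = 0 := by
    refine hc.add_pow_eq_zero_of_add_le_succ_of_pow_eq_zero (m := N + 1) (n := N + 1) ?_ ?_
      (by omega)
    · rw [hl, ha, TensorProduct.zero_tmul]
    · rw [hr, ha, TensorProduct.tmul_zero]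
  rw [← expSum_mul_of_commute hc (by rw [hl, hz, TensorProduct.zero_tmul])
    (by rw [hr, hz, TensorProduct.tmul_zero]) hs]
  have e1 : expSum (2 * N) (a ⊗ₜ[ℝ] (1 : A)) = expSum (2 * N) a ⊗ₜ 1 := by
    simp only [expSum, hl, TensorProduct.sum_tmul, TensorProduct.smul_tmul']
  have e2 : expSum (2 * N) ((1 : A) ⊗ₜ[ℝ] a) = 1 ⊗ₜ expSum (2 * N) a := by
    simp only [expSum, hr, TensorProduct.tmul_sum, TensorProduct.tmul_smul]
  rw [e1, e2, Algebra.TensorProduct.tmul_mul_tmul, mul_one, one_mul]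

end ExpLog

/-! ### Filtered algebras -/

section Filtered

variable {A : Type*} [Ring A] [Algebra ℝ A] {F : ℕ → Submodule ℝ A} [SetLike.GradedMonoid F]
  {N : ℕ}

theorem pow_mem_filtration {a : A} (ha : a ∈ F 1) (k : ℕ) : a ^ k ∈ F k := by
  simpa using SetLike.pow_mem_graded k ha

theorem filtration_pow_eq_zero (hN : F (N + 1) = ⊥) {a : A} (ha : a ∈ F 1) : a ^ (N + 1) = 0 := by
  have := pow_mem_filtration ha (N + 1)
  rwa [hN, Submodule.mem_bot] at this

theorem logSum_mem (hF : Antitone F) {X : A} (hX : X - 1 ∈ F 1) : logSum N X ∈ F 1 :=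
  Submodule.sum_mem _ fun k hk => Submodule.smul_mem _ _
    (hF (Finset.mem_Icc.mp hk).1 (pow_mem_filtration hX k))

theorem expSum_sub_one_mem (hF : Antitone F) {a : A} (ha : a ∈ F 1) : expSum N a - 1 ∈ F 1 := by
  rw [expSum_sub_one, Finset.mul_sum]
  refine Submodule.sum_mem _ fun k _ => ?_
  rw [mul_smul_comm, ← pow_succ']
  exact Submodule.smul_mem _ _ (hF (Nat.le_add_left 1 k) (pow_mem_filtration ha _))

theorem mul_sub_one_mem (hF : Antitone F) {X Y : A} (hX : X - 1 ∈ F 1) (hY : Y - 1 ∈ F 1) :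
    X * Y - 1 ∈ F 1 := by
  have e : X * Y - 1 = (X - 1) * (Y - 1) + (X - 1) + (Y - 1) := by noncomm_ring
  rw [e]
  exact add_mem (add_mem (hF one_le_two (SetLike.mul_mem_graded hX hY)) hX) hY

/-- For commuting u = X-1 and v = Y-1, every u^k - v^k is divisible by u - v, so log X - log Y = (1
+ w)(u - v) with w in the nilpotent ideal. The factor 1 + w is a unit. -/
theorem logSum_injective_of_commute (hF : Antitone F) (hN : F (N + 1) = ⊥) {X Y : A}
    (hX : X - 1 ∈ F 1) (hY : Y - 1 ∈ F 1) (h : Commute X Y) (hl : logSum N X = logSum N Y) :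
    X = Y := by
  rcases Nat.eq_zero_or_pos N with rfl | hpos
  · rw [zero_add] at hN
    rw [hN, Submodule.mem_bot, sub_eq_zero] at hX hY
    rw [hX, hY]
  set u := X - 1 with hu
  set v := Y - 1 with hv
  have huv : Commute u v :=
    (h.sub_left (Commute.one_left _)).sub_right (Commute.one_right _)
  have hmem : ∀ k, 2 ≤ k → (∑ i ∈ Finset.range k, u ^ i * v ^ (k - 1 - i)) ∈ F 1 := by
    intro k hk
    refine Submodule.sum_mem _ fun i hi => ?_
    have := SetLike.mul_mem_graded (pow_mem_filtration hX i) (pow_mem_filtration hY (k - 1 - i))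
    exact hF (by simp at hi; omega) this
  set w := ∑ k ∈ Finset.Icc 2 N, ((-1 : ℝ) ^ (k + 1) / k) •
    (∑ i ∈ Finset.range k, u ^ i * v ^ (k - 1 - i)) with hw
  have hwF : w ∈ F 1 := Submodule.sum_mem _ fun k hk => Submodule.smul_mem _ _
    (hmem k (Finset.mem_Icc.mp hk).1)
  have hzero : (1 + w) * (u - v) = 0 := by
    have e : logSum N X - logSum N Y = (1 + w) * (u - v) := by
      rw [logSum, logSum, ← Finset.sum_sub_distrib, ← Finset.insert_Icc_succ_left_eq_Icc hpos,
        Finset.sum_insert (by simp), add_mul, hw, Finset.sum_mul]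
      congr 1
      · simp [hu, hv]
      · refine Finset.sum_congr rfl fun k _ => ?_
        rw [smul_mul_assoc, huv.geom_sum₂_mul, smul_sub]
    rw [← e, hl, sub_self]
  have hunit : IsUnit (1 + w) :=
    IsNilpotent.isUnit_one_add ⟨N + 1, filtration_pow_eq_zero hN hwF⟩
  have : u - v = 0 := by simpa using hunit.mul_left_cancel (hzero.trans (mul_zero _).symm)
  simpa [hu, hv, sub_eq_zero] using this

/-- The elements exp(log X) and X commute and have the same logarithm. -/
theorem expSum_logSum (hF : Antitone F) (hN : F (N + 1) = ⊥) {X : A} (hX : X - 1 ∈ F 1) :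
    expSum N (logSum N X) = X := by
  have hl := logSum_mem (N := N) hF hX
  refine logSum_injective_of_commute hF hN (expSum_sub_one_mem hF hl) hX ?_
    (logSum_expSum (filtration_pow_eq_zero hN hl))
  have h1 : Commute (logSum N X) X := Commute.sum_left _ _ _ fun k _ =>
    ((((Commute.refl X).sub_left (Commute.one_left X)).pow_left k).smul_left _)
  exact Commute.sum_left _ _ _ fun k _ => (h1.pow_left k).smul_left _

end Filtered

/-! ### Powers of multilinear exponentials and the descent statistic -/

section PowWord

variable {A : Type*} [Ring A] {k : ℕ}

/-- The product of the letters indexed by `B`, in increasing order. -/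
noncomputable def blockProd (α : Fin k → A) (B : Finset (Fin k)) : A :=
  ((B.sort (· ≤ ·)).map α).prod

/-- The multilinear part, in the letters indexed by `S`, of the `s`-th power of the product of the
exponentials of the letters. -/
noncomputable def powWord (α : Fin k → A) : ℕ → Finset (Fin k) → A
  | 0, S => if S = ∅ then 1 else 0
  | s + 1, S => ∑ B ∈ S.powerset, blockProd α B * powWord α s (S \ B)

/-- A map f records in which of the s factors each letter of `S` is placed; letters outside `S` get
the dummy value 0, so that each choice is counted once. -/
theorem powWord_eq_sum (α : Fin k → A) (s : ℕ) (S : Finset (Fin k)) :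
    powWord α s S =
      ∑ f ∈ Fintype.piFinset (fun i => if i ∈ S then Finset.range s else {0}),
        ((List.range s).map fun l => blockProd α (S.filter fun i => f i = l)).prod := by
  induction s generalizing S with
  | zero =>
    rw [powWord]
    split_ifs with h
    · subst h
      simp [Fintype.piFinset_singleton]
    · obtain ⟨i, hi⟩ := Finset.nonempty_iff_ne_empty.mpr h
      rw [Finset.sum_eq_zero]
      intro f hf
      have := Fintype.mem_piFinset.mp hf i
      simp [hi] at this
  | succ s ih =>
    simp only [powWord, ih, Finset.mul_sum]
    rw [Finset.sum_sigma']
    -- The block `B` of the first factor is the fibre over 0; the remaining factors are renumbered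
    -- by one.
    refine Finset.sum_bij' (fun x _ => fun i => if i ∈ S \ x.1 then x.2 i + 1 else 0)
      (fun f _ => ⟨S.filter fun i => f i = 0, fun i => f i - 1⟩) ?_ ?_ ?_ ?_ ?_
    · rintro ⟨B, f⟩ hx
      simp only [Finset.mem_sigma, Finset.mem_powerset, Fintype.mem_piFinset] at hx ⊢
      intro i
      have := hx.2 i
      by_cases hi : i ∈ S \ B
      · rw [if_pos hi] at this
        rw [if_pos hi, if_pos (Finset.mem_sdiff.mp hi).1]
        simpa using this
      · rw [if_neg hi]
        split_ifs <;> simp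
    · intro f hf
      simp only [Finset.mem_sigma, Finset.mem_powerset, Fintype.mem_piFinset] at hf ⊢
      refine ⟨Finset.filter_subset _ _, fun i => ?_⟩
      have := hf i
      by_cases hi : i ∈ S
      · rw [if_pos hi, Finset.mem_range] at this
        by_cases h0 : f i = 0
        · simp [hi, h0]
        · simp [hi, h0]; omega
      · rw [if_neg hi, Finset.mem_singleton] at this
        simp [hi, this]
    · rintro ⟨B, f⟩ hx
      simp only [Finset.mem_sigma, Finset.mem_powerset, Fintype.mem_piFinset] at hx
      have hB : (S.filter fun i => (if i ∈ S \ B then f i + 1 else 0) = 0) = B := by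
        ext i
        by_cases hi : i ∈ S <;> by_cases hb : i ∈ B <;> simp [hi, hb]
        exact hi (hx.1 hb)
      refine Sigma.ext hB (heq_of_eq (funext fun i => ?_))
      have := hx.2 i
      by_cases hi : i ∈ S \ B
      · simp only [if_pos hi, Nat.add_sub_cancel]
      · rw [if_neg hi, Finset.mem_singleton] at this
        simp only [if_neg hi, this]
    · intro f hf
      funext i
      have := Fintype.mem_piFinset.mp hf i
      by_cases hi : i ∈ S
      · by_cases h0 : f i = 0
        · simp [hi, h0]
        · simp [hi, h0]; omega
      · rw [if_neg hi, Finset.mem_singleton] at this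
        simp [hi, this]
    · rintro ⟨B, f⟩ hx
      simp only [Finset.mem_sigma, Finset.mem_powerset, Fintype.mem_piFinset] at hx
      rw [List.range_succ_eq_map, List.map_cons, List.prod_cons, List.map_map]
      congr 2
      · ext i
        by_cases hi : i ∈ S <;> by_cases hb : i ∈ B <;> simp [hi, hb]
        exact hi (hx.1 hb)
      · refine List.map_congr_left fun l _ => ?_
        simp only [Function.comp_apply]
        congr 1
        ext i
        by_cases hi : i ∈ S <;> by_cases hb : i ∈ B <;> simp [hi, hb]

/-- Both lists contain each index once and increase for the lexicographic order on (f i, i), hence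
are equal: reading the fibres in turn is stable sorting. -/
theorem flatMap_sort_eq_ofFn_sort (f : Fin k → ℕ) (s : ℕ) (hf : ∀ i, f i < s) :
    (List.range s).flatMap (fun l => (Finset.univ.filter fun i => f i = l).sort (· ≤ ·)) =
      List.ofFn (Tuple.sort f) := by
  obtain ⟨hmono, htie⟩ := Tuple.eq_sort_iff.mp (rfl : Tuple.sort f = Tuple.sort f)
  let r : Fin k → Fin k → Prop := fun a b => f a < f b ∨ (f a = f b ∧ a < b)
  have p1 : ((List.range s).flatMap
      (fun l => (Finset.univ.filter fun i => f i = l).sort (· ≤ ·))).Pairwise r := by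
    rw [List.pairwise_flatMap]
    refine ⟨fun l _ => ?_, ?_⟩
    · have := (Finset.sortedLT_sort (Finset.univ.filter fun i => f i = l)).pairwise
      refine this.imp_of_mem fun {a b} ha hb hab => Or.inr ⟨?_, hab⟩
      simp at ha hb
      rw [ha, hb]
    · refine List.pairwise_lt_range.imp fun {l m} hlm a ha b hb => Or.inl ?_
      simp at ha hb
      rw [ha, hb]
      exact hlm
  have p2 : (List.ofFn (Tuple.sort f)).Pairwise r := by
    rw [List.pairwise_ofFn]
    intro i j hij
    rcases (hmono hij.le).lt_or_eq with h | h
    · exact Or.inl h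
    · exact Or.inr ⟨h, htie i j hij h⟩
  have irr : ∀ a, ¬ r a a := fun a h => by simp [r] at h
  have nd : ∀ {l : List (Fin k)}, l.Pairwise r → l.Nodup := fun h =>
    h.imp fun {a b} hab (e : a = b) => irr a (by rwa [← e] at hab)
  refine List.Perm.eq_of_pairwise (fun a b _ _ hab hba => ?_) p1 p2 ?_
  · rcases hab with h | ⟨h, h'⟩ <;> rcases hba with g | ⟨g, g'⟩
    all_goals omega
  · rw [List.perm_ext_iff_of_nodup (nd p1) (nd p2)]
    intro a
    simp only [List.mem_flatMap, List.mem_range, Finset.mem_sort, Finset.mem_filter,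
      Finset.mem_univ, true_and, List.mem_ofFn]
    exact ⟨fun _ => ⟨(Tuple.sort f).symm a, by simp⟩, fun _ => ⟨f a, hf a, rfl⟩⟩

theorem powWord_univ (α : Fin k → A) (s : ℕ) :
    powWord α s Finset.univ =
      ∑ f ∈ Fintype.piFinset (fun _ : Fin k => Finset.range s),
        (List.ofFn fun i => α (Tuple.sort f i)).prod := by
  rw [powWord_eq_sum]
  simp only [Finset.mem_univ, if_true]
  refine Finset.sum_congr rfl fun f hf => ?_
  have hfs : ∀ i, f i < s := fun i => by simpa using Fintype.mem_piFinset.mp hf i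
  have e : (List.ofFn fun i => α (Tuple.sort f i)) = (List.ofFn (Tuple.sort f)).map α := by
    rw [List.map_ofFn]; rfl
  rw [e, ← flatMap_sort_eq_ofFn_sort f s hfs, List.map_flatMap, List.flatMap, List.prod_flatten,
    List.map_map]
  rfl

/-- The number of ascents of `σ` at positions before `i`. -/
def ascentsBefore {K : ℕ} (σ : Equiv.Perm (Fin (K + 1))) (i : ℕ) : ℕ :=
  (Finset.univ.filter fun j : Fin K => (j : ℕ) < i ∧ σ j.castSucc < σ j.succ).card

theorem ascentsBefore_succ {K : ℕ} (σ : Equiv.Perm (Fin (K + 1))) (j : Fin K) :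
    ascentsBefore σ (j + 1) =
      ascentsBefore σ j + if σ j.castSucc < σ j.succ then 1 else 0 := by
  rw [ascentsBefore, ascentsBefore]
  split_ifs with h
  · rw [← Finset.card_insert_of_notMem (a := j) (by simp)]
    congr 1
    ext x
    simp only [Finset.mem_filter, Finset.mem_univ, true_and, Finset.mem_insert]
    constructor
    · rintro ⟨h1, h2⟩
      rcases Nat.lt_succ_iff_lt_or_eq.mp h1 with h3 | h3
      · exact Or.inr ⟨h3, h2⟩
      · exact Or.inl (Fin.ext h3)
    · rintro (rfl | ⟨h1, h2⟩)
      · exact ⟨by omega, h⟩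
      · exact ⟨by omega, h2⟩
  · rw [add_zero]
    congr 1
    ext x
    simp only [Finset.mem_filter, Finset.mem_univ, true_and]
    constructor
    · rintro ⟨h1, h2⟩
      rcases Nat.lt_succ_iff_lt_or_eq.mp h1 with h3 | h3
      · exact ⟨h3, h2⟩
      · exact absurd (Fin.ext h3 ▸ h2) h
    · rintro ⟨h1, h2⟩
      exact ⟨by omega, h2⟩

theorem ascentsBefore_add_descentNumber {K : ℕ} (σ : Equiv.Perm (Fin (K + 1))) :
    ascentsBefore σ K + descentNumber σ = K := by
  have hd : descentNumber σ =
      (Finset.univ.filter fun j : Fin K => ¬ σ j.castSucc < σ j.succ).card := by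
    rw [descentNumber, ← Finset.card_map Fin.castSuccEmb, ← Set.ncard_coe_finset]
    congr 1
    ext i
    simp only [Set.mem_ofPred_eq, Finset.coe_map, Set.mem_image, Finset.mem_coe, Finset.mem_filter,
      Finset.mem_univ, true_and, not_lt]
    constructor
    · rintro ⟨h, hlt⟩
      exact ⟨⟨i, by omega⟩, hlt.le, rfl⟩
    · rintro ⟨j, hj, rfl⟩
      exact ⟨by simp, lt_of_le_of_ne hj fun e => by simpa [Fin.ext_iff] using σ.injective e⟩
  have ha : ascentsBefore σ K =
      (Finset.univ.filter fun j : Fin K => σ j.castSucc < σ j.succ).card := by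
    rw [ascentsBefore]; congr 1; ext j; simp
  rw [ha, hd, Finset.card_filter_add_card_filter_not, Finset.card_univ, Fintype.card_fin]

/-- Stable sorting gives σ when f ∘ σ increases weakly at the ascents of σ and strictly at its
descents. Adding 1 at each ascent turns all these conditions into strict ones. -/
theorem sort_eq_iff_strictMono {K : ℕ} (σ : Equiv.Perm (Fin (K + 1))) (f : Fin (K + 1) → ℕ) :
    Tuple.sort f = σ ↔ StrictMono fun i : Fin (K + 1) => f (σ i) + ascentsBefore σ i := by
  rw [eq_comm, Tuple.eq_sort_iff', Fin.strictMono_iff_lt_succ, Fin.strictMono_iff_lt_succ]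
  refine forall_congr' fun j => ?_
  have e : (σ.trans (Tuple.graphEquiv₁ f)) j.castSucc < (σ.trans (Tuple.graphEquiv₁ f)) j.succ ↔
      (f (σ j.castSucc) < f (σ j.succ) ∨
        (f (σ j.castSucc) = f (σ j.succ) ∧ σ j.castSucc < σ j.succ)) :=
    Prod.Lex.toLex_lt_toLex
  rw [e]
  simp only [Fin.val_castSucc, Fin.val_succ, ascentsBefore_succ]
  split_ifs with h
  · simp only [h, and_true]; omega
  · simp only [h, and_false, or_false]; omega

/-- Strictly increasing sequences correspond to their images, so the maps sorted by σ correspond to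
the (K+1)-element subsets of an interval lengthened by the number of ascents. -/
theorem card_sort_eq {K : ℕ} (σ : Equiv.Perm (Fin (K + 1))) (s : ℕ) :
    ((Fintype.piFinset fun _ : Fin (K + 1) => Finset.range s).filter
      fun f => Tuple.sort f = σ).card = (s + ascentsBefore σ K).choose (K + 1) := by
  have hasc : ∀ i : Fin (K + 1), ascentsBefore σ i ≤ i := by
    intro i
    induction i using Fin.induction with
    | zero => simp [ascentsBefore]
    | succ j ih =>
      rw [Fin.val_succ, ascentsBefore_succ]
      simp only [Fin.val_castSucc] at ih
      split_ifs <;> omega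
  have hle : ∀ i : Fin (K + 1), ascentsBefore σ i ≤ ascentsBefore σ K := fun i =>
    Finset.card_le_card fun x hx => by
      simp only [Finset.mem_filter, Finset.mem_univ, true_and] at hx ⊢
      exact ⟨x.2, hx.2⟩
  rw [← Finset.card_range (s + ascentsBefore σ K), ← Finset.card_powersetCard]
  refine Finset.card_bij
    (fun f _ => Finset.univ.image fun i : Fin (K + 1) => f (σ i) + ascentsBefore σ i) ?_ ?_ ?_
  · intro f hf
    rw [Finset.mem_filter, Fintype.mem_piFinset, sort_eq_iff_strictMono] at hf
    rw [Finset.mem_powersetCard, Finset.card_image_of_injective _ hf.2.injective]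
    refine ⟨fun x hx => ?_, by simp⟩
    obtain ⟨i, -, rfl⟩ := Finset.mem_image.mp hx
    have h1 := hf.1 (σ i)
    have h2 := hle i
    simp only [Finset.mem_range] at h1 ⊢
    omega
  · intro f hf g hg hfg
    rw [Finset.mem_filter, sort_eq_iff_strictMono] at hf hg
    have hc : (Finset.univ.image fun i : Fin (K + 1) =>
        f (σ i) + ascentsBefore σ i).card = K + 1 := by
      rw [Finset.card_image_of_injective _ hf.2.injective]; simp
    have h1 := Finset.orderEmbOfFin_unique hc (fun i => Finset.mem_image_of_mem _
      (Finset.mem_univ i)) hf.2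
    have h2 := Finset.orderEmbOfFin_unique hc (fun i => by
      rw [hfg]; exact Finset.mem_image_of_mem _ (Finset.mem_univ i)) hg.2
    funext i
    have := congrFun (h1.trans h2.symm) (σ.symm i)
    simpa using this
  · intro T hT
    rw [Finset.mem_powersetCard] at hT
    set h := T.orderEmbOfFin hT.2 with hh
    -- The i-th element of a set of naturals is at least i, hence at least the number of ascents
    -- before i: the subtraction below is not truncated.
    have hi : ∀ i : Fin (K + 1), (i : ℕ) ≤ h i := by
      intro i
      induction i using Fin.induction with
      | zero => simp
      | succ j ih =>
        have := h.strictMono (Fin.castSucc_lt_succ (i := j))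
        rw [Fin.val_succ]
        simp only [Fin.val_castSucc] at ih
        omega
    have hsub : ∀ i : Fin (K + 1), ascentsBefore σ i ≤ h i := fun i => (hasc i).trans (hi i)
    have hmono : Monotone fun i : Fin (K + 1) => h i - ascentsBefore σ i := by
      rw [Fin.monotone_iff_le_succ]
      intro j
      have h1 := h.strictMono (Fin.castSucc_lt_succ (i := j))
      have h2 := hsub j.succ
      have h3 := hsub j.castSucc
      simp only [Fin.val_castSucc, Fin.val_succ, ascentsBefore_succ] at h1 h2 h3 ⊢
      split_ifs at h2 ⊢ <;> omega
    have hlt : ∀ i : Fin (K + 1), h i - ascentsBefore σ i < s := by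
      intro i
      refine (hmono (Fin.le_last i)).trans_lt ?_
      have h1 := Finset.mem_range.mp (hT.1 (Finset.orderEmbOfFin_mem T hT.2 (Fin.last K)))
      have h2 := hsub (Fin.last K)
      rw [← hh] at h1
      simp only [Fin.val_last] at h2 ⊢
      omega
    have hfun : (fun i : Fin (K + 1) => (fun j => h (σ.symm j) - ascentsBefore σ (σ.symm j)) (σ i)
        + ascentsBefore σ i) = h := by
      funext i
      simp only [Equiv.symm_apply_apply]
      exact Nat.sub_add_cancel (hsub i)
    refine ⟨fun j => h (σ.symm j) - ascentsBefore σ (σ.symm j), ?_, ?_⟩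
    · rw [Finset.mem_filter, Fintype.mem_piFinset, sort_eq_iff_strictMono, hfun]
      exact ⟨fun j => Finset.mem_range.mpr (hlt _), h.strictMono⟩
    · rw [hfun]
      exact Finset.image_orderEmbOfFin_univ T hT.2

/-- Grouping the placements f by their sorting permutation σ gives the word of σ with multiplicity
binom(s + asc σ, k). As ascents and descents add up to k-1, its linear coefficient is
`reutenauerCoeff σ`. -/
theorem hasLinCoeff_powWord [Algebra ℝ A] (α : Fin k → A) :
    HasLinCoeff (fun s => powWord α s Finset.univ) (reutenauerPhi α) := by
  cases k with
  | zero =>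
    -- For the empty word the coefficient is a quotient by 0, which is 0 by convention; this is the
    -- right value, since the power word is the constant 1.
    have h1 : reutenauerPhi α = 0 := by simp [reutenauerPhi, reutenauerCoeff]
    have h2 : (fun s => powWord α s Finset.univ) = fun s : ℕ =>
        (1 : Polynomial ℝ).eval (s : ℝ) • (1 : A) := by
      funext s
      rw [powWord_univ]
      simp
    rw [h1, h2]
    simpa [Polynomial.coeff_one] using HasLinCoeff.eval_smul (1 : Polynomial ℝ) (1 : A)
  | succ K =>
    have := HasLinCoeff.sum (Finset.univ : Finset (Equiv.Perm (Fin (K + 1)))) fun σ _ =>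
      HasLinCoeff.eval_smul (shiftedBinom (ascentsBefore σ K) (descentNumber σ))
        (List.ofFn fun i => α (σ i)).prod
    convert this using 2 with s σ
    · rw [powWord_univ, ← Finset.sum_fiberwise _ (fun f => Tuple.sort f)]
      refine Finset.sum_congr rfl fun σ _ => ?_
      rw [shiftedBinom_eval, ascentsBefore_add_descentNumber, ← card_sort_eq,
        Nat.cast_smul_eq_nsmul, ← Finset.sum_const]
      exact Finset.sum_congr rfl fun f hf => by rw [(Finset.mem_filter.mp hf).2]
    · rw [reutenauerPhi]
      refine Finset.sum_congr rfl fun σ _ => ?_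
      rw [shiftedBinom_coeff_one, ascentsBefore_add_descentNumber, reutenauerCoeff]
      rfl

end PowWord

/-! ### The Baker-Campbell-Hausdorff formula in a filtered algebra -/

theorem sum_powerset_filter {M τ : Type*} [AddCommMonoid M] [DecidableEq τ] (S : Finset τ)
    (p : τ → Prop) [DecidablePred p] (g : ℕ → ℕ → M) :
    ∑ B ∈ S.powerset, g (B.filter p).card (B.filter fun i => ¬ p i).card =
      ∑ a ∈ Finset.range ((S.filter p).card + 1),
        ∑ b ∈ Finset.range ((S.filter fun i => ¬ p i).card + 1),
          (S.filter p).card.choose a • (S.filter fun i => ¬ p i).card.choose b • g a b := by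
  have h : ∑ B ∈ S.powerset, g (B.filter p).card (B.filter fun i => ¬ p i).card =
      ∑ B ∈ (S.filter p).powerset, ∑ C ∈ (S.filter fun i => ¬ p i).powerset, g B.card C.card := by
    rw [← Finset.sum_product']
    refine Finset.sum_bij' (fun B _ => (B.filter p, B.filter fun i => ¬ p i))
      (fun x _ => x.1 ∪ x.2) ?_ ?_ ?_ ?_ ?_
    · intro B hB
      rw [Finset.mem_powerset] at hB
      simp only [Finset.mem_product, Finset.mem_powerset]
      exact ⟨Finset.filter_subset_filter _ hB, Finset.filter_subset_filter _ hB⟩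
    · rintro ⟨B, C⟩ hx
      simp only [Finset.mem_product, Finset.mem_powerset] at hx ⊢
      exact Finset.union_subset (hx.1.trans (Finset.filter_subset _ _))
        (hx.2.trans (Finset.filter_subset _ _))
    · intro B _
      exact Finset.filter_union_filter_not_eq p B
    · rintro ⟨B, C⟩ hx
      simp only [Finset.mem_product, Finset.mem_powerset] at hx
      have hB : ∀ i ∈ B, p i := fun i hi => (Finset.mem_filter.mp (hx.1 hi)).2
      have hC : ∀ i ∈ C, ¬ p i := fun i hi => (Finset.mem_filter.mp (hx.2 hi)).2
      ext i
      · simp only [Finset.mem_filter, Finset.mem_union]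
        have := hB i; have := hC i; tauto
      · simp only [Finset.mem_filter, Finset.mem_union]
        have := hB i; have := hC i; tauto
    · intro B _; rfl
  rw [h]
  have h2 : ∀ B : Finset τ, ∑ C ∈ (S.filter fun i => ¬ p i).powerset, g B.card C.card =
      ∑ b ∈ Finset.range ((S.filter fun i => ¬ p i).card + 1),
        (S.filter fun i => ¬ p i).card.choose b • g B.card b := fun B =>
    Finset.sum_powerset_apply_card (fun b => g B.card b)
  simp only [h2]
  rw [Finset.sum_powerset_apply_card (fun a => ∑ b ∈ Finset.range
    ((S.filter fun i => ¬ p i).card + 1), (S.filter fun i => ¬ p i).card.choose b • g a b)]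
  simp only [Finset.smul_sum]

/-! ### Specialisation of the letters to two values -/

section TwoLetters

variable {A : Type*} [Ring A]

/-- As `p` is downward closed, in a sorted list every letter x precedes every letter y. -/
theorem prod_map_two_letters {τ : Type*} [LinearOrder τ] (x y : A) (p : τ → Prop)
    [DecidablePred p] (hp : ∀ a b, a ≤ b → p b → p a) (l : List τ) (hl : l.Pairwise (· ≤ ·)) :
    (l.map fun i => if p i then x else y).prod =
      x ^ l.countP (fun i => p i) * y ^ l.countP (fun i => ¬ p i) := by
  induction l with
  | nil => simp
  | cons a l ih =>
    rw [List.pairwise_cons] at hl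
    rw [List.map_cons, List.prod_cons, ih hl.2]
    by_cases ha : p a
    · simp [ha, pow_succ', mul_assoc]
    · have h0 : l.countP (fun i => p i) = 0 := by
        rw [List.countP_eq_zero]
        intro b hb
        simpa using fun h => ha (hp a b (hl.1 b hb) h)
      simp [ha, h0, pow_succ']

theorem blockProd_two_letters {k : ℕ} (x y : A) (i : ℕ) (B : Finset (Fin k)) :
    blockProd (fun m : Fin k => if (m : ℕ) < i then x else y) B =
      x ^ (B.filter fun m : Fin k => (m : ℕ) < i).card *
        y ^ (B.filter fun m : Fin k => ¬ (m : ℕ) < i).card := by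
  have hc : ∀ (p : Fin k → Prop) [DecidablePred p],
      (B.sort (· ≤ ·)).countP (fun m => p m) = (B.filter p).card := by
    intro p _
    rw [← Multiset.coe_countP, Finset.sort_eq, Multiset.countP_eq_card_filter]
    rfl
  rw [blockProd, prod_map_two_letters x y (fun m : Fin k => (m : ℕ) < i)
    (fun a b hab hb => lt_of_le_of_lt (by exact_mod_cast hab) hb) _
    (Finset.sortedLT_sort B).sortedLE.pairwise, hc, hc]

variable [Algebra ℝ A]

/-- The component of bidegree `p` of `(exp x * exp y) ^ s`. -/
noncomputable def bidegreePow (x y : A) : ℕ → ℕ × ℕ → A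
  | 0, p => if p = (0, 0) then 1 else 0
  | s + 1, p => ∑ q ∈ Finset.HasAntidiagonal.antidiagonal p.1,
      ∑ r ∈ Finset.HasAntidiagonal.antidiagonal p.2,
      (((q.1 ! : ℝ) * (r.1 ! : ℝ))⁻¹ • (x ^ q.1 * y ^ r.1)) * bidegreePow x y s (q.2, r.2)

/-- With repeated letters a block contributes according to its numbers of x and y only. The
binomials counting the blocks with given numbers turn into the divided powers of the exponentials,
up to the overall factor a! b!. -/
theorem powWord_two_letters {k : ℕ} (x y : A) (i s : ℕ) (S : Finset (Fin k)) :
    powWord (fun m : Fin k => if (m : ℕ) < i then x else y) s S =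
      (((S.filter fun m : Fin k => (m : ℕ) < i).card ! : ℝ) *
        ((S.filter fun m : Fin k => ¬ (m : ℕ) < i).card ! : ℝ)) •
      bidegreePow x y s ((S.filter fun m : Fin k => (m : ℕ) < i).card,
        (S.filter fun m : Fin k => ¬ (m : ℕ) < i).card) := by
  induction s generalizing S with
  | zero =>
    rw [powWord, bidegreePow]
    by_cases h : S = ∅
    · subst h; simp
    · rw [if_neg h, if_neg, smul_zero]
      intro h0
      simp only [Prod.mk.injEq] at h0
      apply h
      rw [← Finset.card_eq_zero,
        ← Finset.card_filter_add_card_filter_not (fun m : Fin k => (m : ℕ) < i),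
        h0.1, h0.2]
  | succ s ih =>
    set a := (S.filter fun m : Fin k => (m : ℕ) < i).card with ha
    set b := (S.filter fun m : Fin k => ¬ (m : ℕ) < i).card with hb
    let g : ℕ → ℕ → A := fun a' b' => (((a - a')! : ℝ) * ((b - b')! : ℝ)) •
      (x ^ a' * y ^ b' * bidegreePow x y s (a - a', b - b'))
    have h1 : ∀ B ∈ S.powerset,
        blockProd (fun m : Fin k => if (m : ℕ) < i then x else y) B *
          powWord (fun m : Fin k => if (m : ℕ) < i then x else y) s (S \ B) =
        g (B.filter fun m : Fin k => (m : ℕ) < i).card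
          (B.filter fun m : Fin k => ¬ (m : ℕ) < i).card := by
      intro B hB
      rw [Finset.mem_powerset] at hB
      have e : ∀ (p : Fin k → Prop) [DecidablePred p],
          ((S \ B).filter p).card = (S.filter p).card - (B.filter p).card := by
        intro p _
        rw [← Finset.card_sdiff_of_subset (Finset.filter_subset_filter p hB)]
        congr 1
        ext m
        simp only [Finset.mem_filter, Finset.mem_sdiff]
        tauto
      rw [ih, blockProd_two_letters, e, e, mul_smul_comm]
    rw [powWord, Finset.sum_congr rfl h1]
    refine (sum_powerset_filter S (fun m : Fin k => (m : ℕ) < i) g).trans ?_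
    rw [← ha, ← hb, bidegreePow, Finset.smul_sum,
      Finset.Nat.sum_antidiagonal_eq_sum_range_succ_mk]
    refine Finset.sum_congr rfl fun a' ha' => ?_
    rw [Finset.smul_sum, Finset.Nat.sum_antidiagonal_eq_sum_range_succ_mk]
    refine Finset.sum_congr rfl fun b' hb' => ?_
    have ha'' : a' ≤ a := Nat.lt_succ_iff.mp (Finset.mem_range.mp ha')
    have hb'' : b' ≤ b := Nat.lt_succ_iff.mp (Finset.mem_range.mp hb')
    simp only [g, smul_mul_assoc, smul_smul, ← Nat.cast_smul_eq_nsmul ℝ]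
    congr 1
    have e1 : (a.choose a' : ℝ) * a' ! * (a - a')! = a ! := by
      exact_mod_cast Nat.choose_mul_factorial_mul_factorial ha''
    have e2 : (b.choose b' : ℝ) * b' ! * (b - b')! = b ! := by
      exact_mod_cast Nat.choose_mul_factorial_mul_factorial hb''
    rw [← e1, ← e2]
    have : (a' ! : ℝ) ≠ 0 := by positivity
    have : (b' ! : ℝ) ≠ 0 := by positivity
    field_simp

theorem powWord_append (x y : A) (s : ℕ) (p : ℕ × ℕ) :
    powWord (Fin.append (fun _ : Fin p.1 => x) (fun _ : Fin p.2 => y)) s Finset.univ =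
      ((p.1 ! : ℝ) * (p.2 ! : ℝ)) • bidegreePow x y s p := by
  have e : Fin.append (fun _ : Fin p.1 => x) (fun _ : Fin p.2 => y) =
      fun m : Fin (p.1 + p.2) => if (m : ℕ) < p.1 then x else y := by
    funext m
    refine Fin.addCases (fun i => ?_) (fun i => ?_) m <;> simp
  have h1 : ((Finset.univ : Finset (Fin (p.1 + p.2))).filter
      fun m : Fin (p.1 + p.2) => (m : ℕ) < p.1).card =
      p.1 := by
    rw [Fin.card_filter_val_lt]; simp
  have h2 : ((Finset.univ : Finset (Fin (p.1 + p.2))).filter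
      fun m : Fin (p.1 + p.2) => ¬ (m : ℕ) < p.1).card =
      p.2 := by
    have := Finset.card_filter_add_card_filter_not
      (s := (Finset.univ : Finset (Fin (p.1 + p.2)))) (fun m : Fin (p.1 + p.2) => (m : ℕ) < p.1)
    rw [h1, Finset.card_univ, Fintype.card_fin] at this
    omega
  rw [e, powWord_two_letters, h1, h2]

end TwoLetters

/-! ### Expansion of powers of exp x exp y -/

section Filtered

variable {A : Type*} [Ring A] [Algebra ℝ A] {F : ℕ → Submodule ℝ A} [SetLike.GradedMonoid F]
  {N : ℕ}

/-- The truncated Cauchy product is exact, since all terms of weight above N vanish. -/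
theorem sum_mul_sum_filtered (hF : Antitone F) (hN : F (N + 1) = ⊥) (u v : ℕ → A)
    (hu : ∀ k, u k ∈ F k) (hv : ∀ k, v k ∈ F k) :
    (∑ k ∈ Finset.range (N + 1), u k) * ∑ k ∈ Finset.range (N + 1), v k =
      ∑ k ∈ Finset.range (N + 1), ∑ p ∈ Finset.HasAntidiagonal.antidiagonal k, u p.1 * v p.2 := by
  rw [Finset.sum_mul_sum, ← Finset.sum_product', Finset.sum_sigma']
  symm
  refine Finset.sum_of_injOn (fun x => x.2) ?_ ?_ ?_ ?_
  · rintro ⟨k, p⟩ hx ⟨k', p'⟩ hx' h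
    simp at hx hx' h
    subst h
    rw [← hx.2, ← hx'.2]
  · rintro ⟨k, p⟩ hx
    simp at hx ⊢
    omega
  · rintro ⟨i, j⟩ _ hij
    have hlt : N + 1 ≤ i + j := by
      by_contra hlt
      exact hij ⟨⟨i + j, (i, j)⟩, by simp; omega, rfl⟩
    have := hF hlt (SetLike.mul_mem_graded (hu i) (hv j))
    rwa [hN, Submodule.mem_bot] at this
  · intro x _; rfl

theorem bidegreePow_mem {x y : A} (hx : x ∈ F 1) (hy : y ∈ F 1) (s : ℕ) (p : ℕ × ℕ) :
    bidegreePow x y s p ∈ F (p.1 + p.2) := by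
  induction s generalizing p with
  | zero =>
    rw [bidegreePow]
    split_ifs with h
    · subst h; exact SetLike.one_mem_graded F
    · exact Submodule.zero_mem _
  | succ s ih =>
    rw [bidegreePow]
    refine Submodule.sum_mem _ fun q hq => Submodule.sum_mem _ fun r hr => ?_
    rw [Finset.HasAntidiagonal.mem_antidiagonal] at hq hr
    have := SetLike.mul_mem_graded (Submodule.smul_mem _ (((q.1 ! : ℝ) * (r.1 ! : ℝ))⁻¹)
      (SetLike.mul_mem_graded (pow_mem_filtration hx q.1) (pow_mem_filtration hy r.1)))
      (ih (q.2, r.2))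
    convert this using 2
    simp only
    omega

/-- Both sides sum over 2 × 2 arrays of naturals with total k, grouped by rows or by columns;
transposition matches them. -/
theorem sum_antidiagonal_interchange {M : Type*} [AddCommMonoid M] (g : ℕ → ℕ → ℕ → ℕ → M)
    (k : ℕ) :
    ∑ p ∈ Finset.HasAntidiagonal.antidiagonal k,
      ∑ q ∈ Finset.HasAntidiagonal.antidiagonal p.1, ∑ r ∈ Finset.HasAntidiagonal.antidiagonal p.2,
      g q.1 r.1 q.2 r.2 =
    ∑ p ∈ Finset.HasAntidiagonal.antidiagonal k,
      ∑ q ∈ Finset.HasAntidiagonal.antidiagonal p.1, ∑ r ∈ Finset.HasAntidiagonal.antidiagonal p.2,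
      g q.1 q.2 r.1 r.2 := by
  simp only [← Finset.sum_product']
  rw [Finset.sum_sigma', Finset.sum_sigma']
  let e : (Σ _ : ℕ × ℕ, (ℕ × ℕ) × (ℕ × ℕ)) → Σ _ : ℕ × ℕ, (ℕ × ℕ) × (ℕ × ℕ) := fun x =>
    ⟨(x.2.1.1 + x.2.2.1, x.2.1.2 + x.2.2.2), ((x.2.1.1, x.2.2.1), (x.2.1.2, x.2.2.2))⟩
  have he : ∀ x ∈ (Finset.HasAntidiagonal.antidiagonal k).sigma fun p =>
      Finset.HasAntidiagonal.antidiagonal p.1 ×ˢ Finset.HasAntidiagonal.antidiagonal p.2,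
      e x ∈ (Finset.HasAntidiagonal.antidiagonal k).sigma
        fun p => Finset.HasAntidiagonal.antidiagonal p.1 ×ˢ
          Finset.HasAntidiagonal.antidiagonal p.2 := by
    rintro ⟨⟨a, b⟩, ⟨q1, q2⟩, ⟨r1, r2⟩⟩ h
    simp [e] at h ⊢
    omega
  have hee : ∀ x ∈ (Finset.HasAntidiagonal.antidiagonal k).sigma fun p =>
      Finset.HasAntidiagonal.antidiagonal p.1 ×ˢ Finset.HasAntidiagonal.antidiagonal p.2,
      e (e x) = x := by
    rintro ⟨⟨a, b⟩, ⟨q1, q2⟩, ⟨r1, r2⟩⟩ h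
    simp at h
    obtain ⟨-, rfl, rfl⟩ := h
    rfl
  exact Finset.sum_bij' (fun x _ => e x) (fun x _ => e x) he he hee hee fun x _ => rfl

theorem expSum_mul_expSum_pow (hF : Antitone F) (hN : F (N + 1) = ⊥) {x y : A} (hx : x ∈ F 1)
    (hy : y ∈ F 1) (s : ℕ) :
    (expSum N x * expSum N y) ^ s =
      ∑ k ∈ Finset.range (N + 1), ∑ p ∈ Finset.HasAntidiagonal.antidiagonal k,
        bidegreePow x y s p := by
  have hexp : expSum N x * expSum N y = ∑ k ∈ Finset.range (N + 1),
      ∑ p ∈ Finset.HasAntidiagonal.antidiagonal k,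
        ((p.1 ! : ℝ) * (p.2 ! : ℝ))⁻¹ • (x ^ p.1 * y ^ p.2) := by
    rw [expSum, expSum, sum_mul_sum_filtered hF hN _ _
      (fun k => Submodule.smul_mem _ _ (pow_mem_filtration hx k))
      (fun k => Submodule.smul_mem _ _ (pow_mem_filtration hy k))]
    refine Finset.sum_congr rfl fun k _ => Finset.sum_congr rfl fun p _ => ?_
    rw [smul_mul_smul_comm, mul_inv]
  induction s with
  | zero =>
    rw [pow_zero, Finset.sum_eq_single_of_mem 0 (by simp)]
    · simp [bidegreePow]
    · intro k _ hk
      refine Finset.sum_eq_zero fun p hp => ?_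
      rw [bidegreePow, if_neg]
      rintro rfl
      exact hk (Finset.HasAntidiagonal.mem_antidiagonal.mp hp).symm
  | succ s ih =>
    rw [pow_succ', ih, hexp, sum_mul_sum_filtered hF hN]
    · refine Finset.sum_congr rfl fun k _ => ?_
      simp only [Finset.sum_mul_sum, bidegreePow]
      rw [sum_antidiagonal_interchange fun a b c d =>
        (((a ! : ℝ) * (b ! : ℝ))⁻¹ • (x ^ a * y ^ b)) * bidegreePow x y s (c, d)]
    · intro k
      refine Submodule.sum_mem _ fun p hp => Submodule.smul_mem _ _ ?_
      rw [← Finset.HasAntidiagonal.mem_antidiagonal.mp hp]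
      exact SetLike.mul_mem_graded (pow_mem_filtration hx _) (pow_mem_filtration hy _)
    · intro k
      refine Submodule.sum_mem _ fun p hp => ?_
      rw [← Finset.HasAntidiagonal.mem_antidiagonal.mp hp]
      exact bidegreePow_mem hx hy s p

/-- The Baker-Campbell-Hausdorff formula with Reutenauer's coefficients. -/
theorem bch_eq_logSum (hF : Antitone F) (hN : F (N + 1) = ⊥) {x y : A} (hx : x ∈ F 1)
    (hy : y ∈ F 1) : bch N x y = logSum N (expSum N x * expSum N y) := by
  have hX : expSum N x * expSum N y - 1 ∈ F 1 :=
    mul_sub_one_mem hF (expSum_sub_one_mem hF hx) (expSum_sub_one_mem hF hy)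
  -- Both sides are the linear coefficient of s ↦ (exp x exp y)^s: the right one by the binomial
  -- expansion, the left one by the expansion into words.
  refine HasLinCoeff.unique ?_ (hasLinCoeff_pow (filtration_pow_eq_zero hN hX))
  have h : HasLinCoeff (fun s => (expSum N x * expSum N y) ^ s)
      (∑ k ∈ Finset.range (N + 1), ∑ p ∈ Finset.HasAntidiagonal.antidiagonal k,
        ((p.1 ! : ℝ) * (p.2 ! : ℝ))⁻¹ •
          reutenauerPhi (Fin.append (fun _ : Fin p.1 => x) (fun _ : Fin p.2 => y))) := by
    have := HasLinCoeff.sum (Finset.range (N + 1)) fun k _ =>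
      HasLinCoeff.sum (Finset.HasAntidiagonal.antidiagonal k) fun p _ =>
        (hasLinCoeff_powWord
          (Fin.append (fun _ : Fin p.1 => x) (fun _ : Fin p.2 => y))).smul
            (((p.1 ! : ℝ) * (p.2 ! : ℝ))⁻¹)
    convert this using 2 with s
    rw [expSum_mul_expSum_pow hF hN hx hy]
    refine Finset.sum_congr rfl fun k _ => Finset.sum_congr rfl fun p _ => ?_
    rw [powWord_append, inv_smul_smul₀ (by positivity)]
  convert h using 1
  -- The extra term k = 0 vanishes because its Reutenauer coefficient is 0.
  rw [bch, Finset.range_eq_Ico, Finset.sum_eq_sum_Ico_succ_bot (Nat.succ_pos N)]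
  simp [reutenauerPhi, reutenauerCoeff]
  rfl

end Filtered

/-! ### Dyadic correction of nearly additive functions -/

open Filter Topology

/-- `A` is additive up to an error of order `θ`. -/
def NearlyAdditive (θ : ℝ) (A : unitInterval → unitInterval → ℝ) : Prop :=
  ∃ C : ℝ, ∀ s u t : unitInterval,
    |A s t - A s u - A u t| ≤ C * (|(u : ℝ) - s| + |(t : ℝ) - u|) ^ θ

/-- The dyadic corrections attached to a nearly additive function. -/
noncomputable def dyadicCorrection (A : unitInterval → unitInterval → ℝ) : ℕ → ℕ → ℝ
  | 0, _ => 0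
  | m + 1, j => 1 / 2 * dyadicCorrection A m (j / 2) +
      1 / 2 * (A (dyadic (m + 1) (2 * (j / 2))) (dyadic (m + 1) (2 * (j / 2) + 2)) -
        A (dyadic (m + 1) (2 * (j / 2))) (dyadic (m + 1) (2 * (j / 2) + 1)) -
        A (dyadic (m + 1) (2 * (j / 2) + 1)) (dyadic (m + 1) (2 * (j / 2) + 2)))

/-- The increments of `P` approximate `A` up to order `θ`, and differ from it on dyadic intervals
exactly by the dyadic corrections. -/
structure IsDyadicPrimitive (θ : ℝ) (A : unitInterval → unitInterval → ℝ)
    (P : unitInterval → ℝ) : Prop where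
  zero : P 0 = 0
  holder : ∃ C : ℝ, ∀ s t : unitInterval, |P t - P s - A s t| ≤ C * |(t : ℝ) - s| ^ θ
  dyadic_eq : ∀ m k : ℕ, k < 2 ^ m → P (dyadic m (k + 1)) - P (dyadic m k) -
    A (dyadic m k) (dyadic m (k + 1)) = dyadicCorrection A m k

theorem dyadic_succ_two_mul (m k : ℕ) : dyadic (m + 1) (2 * k) = dyadic m k := by
  have : (((2 * k : ℕ) : ℝ)) / 2 ^ (m + 1) = (k : ℝ) / 2 ^ m := by
    push_cast; rw [pow_succ]; field_simp
  rw [dyadic, dyadic, this]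

theorem dyadic_add (m k i : ℕ) : dyadic (m + i) (k * 2 ^ i) = dyadic m k := by
  have : (((k * 2 ^ i : ℕ) : ℝ)) / 2 ^ (m + i) = (k : ℝ) / 2 ^ m := by
    push_cast; rw [pow_add]; field_simp
  rw [dyadic, dyadic, this]

theorem coe_dyadic {m k : ℕ} (h : k ≤ 2 ^ m) : (dyadic m k : ℝ) = k / 2 ^ m := by
  have h1 : (k : ℝ) ≤ 2 ^ m := by exact_mod_cast h
  rw [dyadic, Set.projIcc_of_mem zero_le_one
    ⟨by positivity, (div_le_one (by positivity)).mpr h1⟩]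

theorem dyadic_zero (m : ℕ) : dyadic m 0 = 0 :=
  Subtype.ext (by rw [coe_dyadic (Nat.zero_le _)]; simp)

theorem abs_dyadic_succ_sub_le (m k : ℕ) :
    |(dyadic m (k + 1) : ℝ) - dyadic m k| ≤ (1 / 2 : ℝ) ^ m := by
  refine (Set.abs_projIcc_sub_projIcc zero_le_one).trans_eq ?_
  rw [← sub_div, Nat.cast_succ, add_sub_cancel_left, abs_of_nonneg (by positivity), one_div_pow]

/-- The last dyadic point of level `m` before `t`. -/
noncomputable def dyadicIndex (m : ℕ) (t : unitInterval) : ℕ := ⌊(t : ℝ) * 2 ^ m⌋₊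

theorem dyadicIndex_le (m : ℕ) (t : unitInterval) : (dyadicIndex m t : ℝ) ≤ t * 2 ^ m :=
  Nat.floor_le (mul_nonneg t.2.1 (by positivity))

theorem lt_dyadicIndex_add_one (m : ℕ) (t : unitInterval) :
    (t : ℝ) * 2 ^ m < dyadicIndex m t + 1 := Nat.lt_floor_add_one _

theorem dyadicIndex_le_two_pow (m : ℕ) (t : unitInterval) : dyadicIndex m t ≤ 2 ^ m := by
  have h := dyadicIndex_le m t
  have h2 : (t : ℝ) * 2 ^ m ≤ 2 ^ m := mul_le_of_le_one_left (by positivity) t.2.2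
  exact_mod_cast h.trans h2

theorem dyadicIndex_succ (m : ℕ) (t : unitInterval) :
    dyadicIndex (m + 1) t = 2 * dyadicIndex m t ∨
      dyadicIndex (m + 1) t = 2 * dyadicIndex m t + 1 := by
  have h1 := dyadicIndex_le m t
  have h2 := lt_dyadicIndex_add_one m t
  have h3 := dyadicIndex_le (m + 1) t
  have h4 := lt_dyadicIndex_add_one (m + 1) t
  rw [pow_succ] at h3 h4
  have h5 : ((dyadicIndex (m + 1) t : ℕ) : ℝ) < ((2 * dyadicIndex m t + 2 : ℕ) : ℝ) := by
    push_cast; linarith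
  have h6 : ((2 * dyadicIndex m t : ℕ) : ℝ) < ((dyadicIndex (m + 1) t + 1 : ℕ) : ℝ) := by
    push_cast; linarith
  rw [Nat.cast_lt] at h5 h6
  omega

theorem abs_sub_dyadic_dyadicIndex_le (m : ℕ) (t : unitInterval) :
    |(t : ℝ) - dyadic m (dyadicIndex m t)| ≤ (1 / 2 : ℝ) ^ m := by
  have h1 := dyadicIndex_le m t
  have h2 := lt_dyadicIndex_add_one m t
  have hp : (0 : ℝ) < 2 ^ m := by positivity
  rw [coe_dyadic (dyadicIndex_le_two_pow m t), one_div_pow, abs_of_nonneg]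
  · rw [sub_le_iff_le_add, ← add_div, le_div_iff₀ hp]; linarith
  · rw [sub_nonneg, div_le_iff₀ hp]; exact h1

theorem dyadicIndex_dyadic {m k : ℕ} (h : k ≤ 2 ^ m) (i : ℕ) :
    dyadicIndex (m + i) (dyadic m k) = k * 2 ^ i := by
  rw [dyadicIndex, coe_dyadic h]
  have : (k : ℝ) / 2 ^ m * 2 ^ (m + i) = ((k * 2 ^ i : ℕ) : ℝ) := by
    push_cast; rw [pow_add]; field_simp
  rw [this, Nat.floor_natCast]

section Exponent

variable {θ : ℝ}

theorem half_pow_rpow (m : ℕ) : ((1 / 2 : ℝ) ^ m) ^ θ = ((1 / 2 : ℝ) ^ θ) ^ m := by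
  rw [← Real.rpow_natCast, ← Real.rpow_natCast, ← Real.rpow_mul (by norm_num),
    ← Real.rpow_mul (by norm_num), mul_comm]

theorem half_rpow_lt_one (h0 : 0 < θ) : (1 / 2 : ℝ) ^ θ < 1 :=
  Real.rpow_lt_one (by norm_num) (by norm_num) h0

theorem half_lt_half_rpow (h1 : θ < 1) : 1 / 2 < (1 / 2 : ℝ) ^ θ := by
  conv_lhs => rw [← Real.rpow_one (1 / 2 : ℝ)]
  exact Real.rpow_lt_rpow_of_exponent_gt (by norm_num) (by norm_num) h1

theorem two_mul_rpow_le (h1 : θ < 1) {x : ℝ} (hx : 0 ≤ x) : (2 * x) ^ θ ≤ 2 * x ^ θ := by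
  rw [Real.mul_rpow zero_le_two hx]
  refine mul_le_mul_of_nonneg_right ?_ (Real.rpow_nonneg hx _)
  conv_rhs => rw [← Real.rpow_one 2]
  exact Real.rpow_le_rpow_of_exponent_le one_le_two h1.le

end Exponent

/-- The value at the `k`-th dyadic point of level `m` of the primitive with the prescribed dyadic
increments. -/
noncomputable def dyadicSum (A : unitInterval → unitInterval → ℝ) (m k : ℕ) : ℝ :=
  ∑ j ∈ Finset.range k, (A (dyadic m j) (dyadic m (j + 1)) + dyadicCorrection A m j)

theorem dyadicSum_succ (A : unitInterval → unitInterval → ℝ) (m k : ℕ) :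
    dyadicSum A m (k + 1) =
      dyadicSum A m k + (A (dyadic m k) (dyadic m (k + 1)) + dyadicCorrection A m k) :=
  Finset.sum_range_succ _ _

theorem dyadicSum_two_mul (A : unitInterval → unitInterval → ℝ) (m k : ℕ) :
    dyadicSum A (m + 1) (2 * k) = dyadicSum A m k := by
  induction k with
  | zero => simp [dyadicSum]
  | succ k ih =>
    have e1 : 2 * k / 2 = k := by omega
    have e2 : (2 * k + 1) / 2 = k := by omega
    have e3 : dyadic (m + 1) (2 * k + 2) = dyadic m (k + 1) := dyadic_succ_two_mul m (k + 1)
    rw [show 2 * (k + 1) = 2 * k + 1 + 1 by ring, dyadicSum_succ, dyadicSum_succ, ih,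
      dyadicSum_succ, dyadicCorrection, dyadicCorrection, e1, e2,
      show 2 * k + 1 + 1 = 2 * k + 2 by ring, e3, dyadic_succ_two_mul]
    ring

theorem dyadicSum_mul_two_pow (A : unitInterval → unitInterval → ℝ) (m k i : ℕ) :
    dyadicSum A (m + i) (k * 2 ^ i) = dyadicSum A m k := by
  induction i with
  | zero => simp
  | succ i ih =>
    rw [← ih, pow_succ', mul_left_comm, ← add_assoc]
    exact dyadicSum_two_mul A (m + i) (k * 2 ^ i)

/-! ### Existence of dyadic primitives -/

section Existence

variable {θ : ℝ} {A : unitInterval → unitInterval → ℝ} {C : ℝ}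

theorem abs_dyadicCorrection_le (h1 : θ < 1) (hC : 0 ≤ C)
    (hA : ∀ s u t : unitInterval,
      |A s t - A s u - A u t| ≤ C * (|(u : ℝ) - s| + |(t : ℝ) - u|) ^ θ) (h0 : 0 < θ) :
    ∃ K : ℝ, 0 ≤ K ∧ ∀ m j, |dyadicCorrection A m j| ≤ K * ((1 / 2 : ℝ) ^ θ) ^ m := by
  set q := (1 / 2 : ℝ) ^ θ with hq
  have hq2 : 0 < 2 * q - 1 := by have := half_lt_half_rpow h1; linarith
  have hq0 : 0 < q := by positivity
  -- This K solves K q = K/2 + C/2, which closes the induction; it is finite because q = 2^{-θ} >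
  -- 1/2, that is θ < 1.
  refine ⟨C / (2 * q - 1), by positivity, fun m => ?_⟩
  set K := C / (2 * q - 1) with hK
  have hKC : K * (2 * q - 1) = C := by rw [hK]; field_simp
  induction m with
  | zero => intro j; simp only [dyadicCorrection, abs_zero]; positivity
  | succ m ih =>
    intro j
    have hz := ih (j / 2)
    have hd := hA (dyadic (m + 1) (2 * (j / 2))) (dyadic (m + 1) (2 * (j / 2) + 1))
      (dyadic (m + 1) (2 * (j / 2) + 2))
    have hr : (|(dyadic (m + 1) (2 * (j / 2) + 1) : ℝ) - dyadic (m + 1) (2 * (j / 2))| +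
        |(dyadic (m + 1) (2 * (j / 2) + 2) : ℝ) - dyadic (m + 1) (2 * (j / 2) + 1)|) ^ θ ≤
        q ^ m := by
      rw [hq, ← half_pow_rpow]
      refine Real.rpow_le_rpow (by positivity) ?_ h0.le
      have e1 := abs_dyadic_succ_sub_le (m + 1) (2 * (j / 2))
      have e2 := abs_dyadic_succ_sub_le (m + 1) (2 * (j / 2) + 1)
      rw [pow_succ] at e1 e2
      rw [show 2 * (j / 2) + 2 = 2 * (j / 2) + 1 + 1 by ring]
      linarith
    have hd' := hd.trans (mul_le_mul_of_nonneg_left hr hC)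
    rw [dyadicCorrection]
    refine (abs_add_le _ _).trans ?_
    rw [abs_mul, abs_mul, abs_of_pos (by norm_num : (0 : ℝ) < 1 / 2)]
    have e : K * q ^ (m + 1) = 1 / 2 * (K * q ^ m) + 1 / 2 * (C * q ^ m) := by
      rw [← hKC, pow_succ]; ring
    rw [e]
    gcongr

/-- The primitive is the limit of approximations that follow the prescribed increments up to the
last dyadic point before t and use `A` on the rest. Refining the level costs one correction and one
defect, a geometric series in q = 2^{-θ} < 1. -/
theorem exists_isDyadicPrimitive (h0 : 0 < θ) (h1 : θ < 1) (h : NearlyAdditive θ A) :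
    ∃ P, IsDyadicPrimitive θ A P := by
  obtain ⟨C, hC, hA⟩ : ∃ C : ℝ, 0 ≤ C ∧ ∀ s u t : unitInterval,
      |A s t - A s u - A u t| ≤ C * (|(u : ℝ) - s| + |(t : ℝ) - u|) ^ θ := by
    obtain ⟨C, hA⟩ := h
    exact ⟨|C|, abs_nonneg C, fun s u t => (hA s u t).trans
      (mul_le_mul_of_nonneg_right (le_abs_self C) (Real.rpow_nonneg (by positivity) _))⟩
  obtain ⟨K, hK, hz⟩ := abs_dyadicCorrection_le h1 hC hA h0
  set q := (1 / 2 : ℝ) ^ θ with hq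
  have hq0 : 0 < q := by positivity
  have hq1 : q < 1 := half_rpow_lt_one h0
  have hdiag : ∀ s, A s s = 0 := fun s => by
    have := hA s s s
    simpa [Real.zero_rpow h0.ne'] using this
  have hdef1 : ∀ (m : ℕ) (s u t : unitInterval),
      |(u : ℝ) - s| + |(t : ℝ) - u| ≤ (1 / 2 : ℝ) ^ m →
      |A s t - A s u - A u t| ≤ C * q ^ m := fun m s u t hst => by
    refine (hA s u t).trans (mul_le_mul_of_nonneg_left ?_ hC)
    rw [hq, ← half_pow_rpow]
    exact Real.rpow_le_rpow (by positivity) hst h0.le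
  have hdef2 : ∀ (m : ℕ) (s u t : unitInterval),
      |(u : ℝ) - s| ≤ (1 / 2 : ℝ) ^ m → |(t : ℝ) - u| ≤ (1 / 2 : ℝ) ^ m →
      |A s t - A s u - A u t| ≤ 2 * C * q ^ m := fun m s u t hu ht => by
    rw [mul_comm 2 C, mul_assoc]
    refine (hA s u t).trans (mul_le_mul_of_nonneg_left ?_ hC)
    rw [hq, ← half_pow_rpow]
    refine (Real.rpow_le_rpow (by positivity) ?_ h0.le).trans (two_mul_rpow_le h1 (by positivity))
    linarith
  let e : unitInterval → ℕ → ℝ := fun t m =>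
    dyadicSum A m (dyadicIndex m t) + A (dyadic m (dyadicIndex m t)) t
  have hstep : ∀ t m, dist (e t m) (e t (m + 1)) ≤ (K + C) * q ^ m := by
    intro t m
    rw [dist_comm, Real.dist_eq]
    rcases dyadicIndex_succ m t with hi | hi
    · simp only [e, hi, dyadicSum_two_mul, dyadic_succ_two_mul, sub_self, abs_zero]
      positivity
    · have e1 : e t (m + 1) - e t m = dyadicCorrection A (m + 1) (2 * dyadicIndex m t) -
          (A (dyadic m (dyadicIndex m t)) t -
            A (dyadic m (dyadicIndex m t)) (dyadic (m + 1) (2 * dyadicIndex m t + 1)) -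
            A (dyadic (m + 1) (2 * dyadicIndex m t + 1)) t) := by
        simp only [e, hi, dyadicSum_succ, dyadicSum_two_mul, dyadic_succ_two_mul]
        ring
      rw [e1, add_mul]
      refine (abs_sub _ _).trans (add_le_add ?_ (hdef1 m _ _ _ ?_))
      · refine (hz _ _).trans (mul_le_mul_of_nonneg_left ?_ hK)
        exact pow_le_pow_of_le_one hq0.le hq1.le (Nat.le_succ m)
      · have h2 := abs_dyadic_succ_sub_le (m + 1) (2 * dyadicIndex m t)
        have h3 := abs_sub_dyadic_dyadicIndex_le (m + 1) t
        rw [dyadic_succ_two_mul, pow_succ] at h2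
        rw [hi, pow_succ] at h3
        linarith
  have hlim : ∀ t, ∃ P, Tendsto (e t) atTop (𝓝 P) := fun t =>
    cauchySeq_tendsto_of_complete (cauchySeq_of_le_geometric q (K + C) hq1 (hstep t))
  choose P hP using hlim
  have hPe : ∀ t m, |P t - e t m| ≤ (K + C) / (1 - q) * q ^ m := fun t m => by
    have := dist_le_of_le_geometric_of_tendsto q (K + C) hq1 (hstep t) (hP t) m
    rw [dist_comm, Real.dist_eq] at this
    rwa [div_mul_eq_mul_div]
  set E := (K + C) / (1 - q) with hE
  have hE0 : 0 ≤ E := div_nonneg (by positivity) (by linarith)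
  -- From level m on the approximations are constant at a dyadic point of level m, as `A` vanishes
  -- on the diagonal.
  have hPd : ∀ m k, k ≤ 2 ^ m → P (dyadic m k) = dyadicSum A m k := by
    intro m k hk
    refine tendsto_nhds_unique ((hP (dyadic m k)).comp (tendsto_add_atTop_nat m)) ?_
    refine tendsto_const_nhds.congr fun i => ?_
    simp only [Function.comp_apply, e]
    rw [add_comm i m, dyadicIndex_dyadic hk, dyadic_add, dyadicSum_mul_two_pow, hdiag, add_zero]
  refine ⟨P, ⟨?_, ?_, ?_⟩⟩
  · rw [← dyadic_zero 0, hPd 0 0 (Nat.zero_le _), dyadicSum, Finset.sum_range_zero]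
  -- The two E bound the distances to the limit at s and t; K bounds one dyadic correction, and each
  -- 2C one additivity defect.
  · set D := E + E + (K + 2 * C + 2 * C) with hD
    have hD0 : 0 ≤ D := by positivity
    have main : ∀ s t : unitInterval, (s : ℝ) < t →
        |P t - P s - A s t| ≤ 2 * D * |(t : ℝ) - s| ^ θ := by
      intro s t hst
      have hδ : 0 < (t : ℝ) - s := sub_pos.mpr hst
      -- The level with 2^{-(m+1)} < t - s ≤ 2^{-m}: the last dyadic points before s and t are then
      -- equal or adjacent.
      obtain ⟨m, hm1, hm2⟩ := exists_nat_pow_near_of_lt_one hδ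
        (by linarith [t.2.2, s.2.1]) (by norm_num : (0 : ℝ) < 1 / 2) (by norm_num)
      have hqm : q ^ m ≤ 2 * |(t : ℝ) - s| ^ θ := by
        rw [hq, ← half_pow_rpow, abs_of_pos hδ]
        refine (Real.rpow_le_rpow (by positivity) ?_ h0.le).trans (two_mul_rpow_le h1 hδ.le)
        rw [pow_succ] at hm1
        linarith
      have hδm : |(t : ℝ) - s| ≤ (1 / 2 : ℝ) ^ m := by rwa [abs_of_pos hδ]
      have hs := abs_sub_dyadic_dyadicIndex_le m s
      have ht := abs_sub_dyadic_dyadicIndex_le m t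
      have hidx : dyadicIndex m t = dyadicIndex m s ∨ dyadicIndex m t = dyadicIndex m s + 1 := by
        have i1 := dyadicIndex_le m s
        have i2 := lt_dyadicIndex_add_one m s
        have i3 := dyadicIndex_le m t
        have i4 := lt_dyadicIndex_add_one m t
        have hp : (0 : ℝ) < 2 ^ m := by positivity
        have i5 : ((t : ℝ) - s) * 2 ^ m ≤ 1 := by
          rwa [one_div_pow, le_div_iff₀ hp] at hm2
        have i6 : (s : ℝ) * 2 ^ m < t * 2 ^ m := mul_lt_mul_of_pos_right hst hp
        have i7 : ((dyadicIndex m t : ℕ) : ℝ) < ((dyadicIndex m s + 2 : ℕ) : ℝ) := by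
          push_cast; linarith
        have i8 : ((dyadicIndex m s : ℕ) : ℝ) < ((dyadicIndex m t + 1 : ℕ) : ℝ) := by
          push_cast; linarith
        rw [Nat.cast_lt] at i7 i8
        omega
      have hmid : |e t m - e s m - A s t| ≤ (K + 2 * C + 2 * C) * q ^ m := by
        rcases hidx with hi | hi
        · have e1 : e t m - e s m - A s t = A (dyadic m (dyadicIndex m s)) t -
              A (dyadic m (dyadicIndex m s)) s - A s t := by
            simp only [e, hi]; ring
          rw [e1]
          refine (hdef2 m _ _ _ hs hδm).trans (mul_le_mul_of_nonneg_right ?_ (by positivity))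
          linarith
        · have e1 : e t m - e s m - A s t = dyadicCorrection A m (dyadicIndex m s) -
              (A (dyadic m (dyadicIndex m s)) t -
                A (dyadic m (dyadicIndex m s)) (dyadic m (dyadicIndex m s + 1)) -
                A (dyadic m (dyadicIndex m s + 1)) t) +
              (A (dyadic m (dyadicIndex m s)) t -
                A (dyadic m (dyadicIndex m s)) s - A s t) := by
            simp only [e, hi, dyadicSum_succ]; ring
          rw [hi] at ht
          rw [e1, add_mul, add_mul]
          exact (abs_add_le _ _).trans (add_le_add ((abs_sub _ _).trans (add_le_add (hz _ _)
            (hdef2 m _ _ _ (abs_dyadic_succ_sub_le m _) ht))) (hdef2 m _ _ _ hs hδm))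
      have e2 : P t - P s - A s t = (P t - e t m) - (P s - e s m) + (e t m - e s m - A s t) := by
        ring
      have hfin : |P t - P s - A s t| ≤ D * q ^ m := by
        rw [e2, hD, add_mul, add_mul]
        exact (abs_add_le _ _).trans (add_le_add ((abs_sub _ _).trans
          (add_le_add (hPe t m) (hPe s m))) hmid)
      calc |P t - P s - A s t| ≤ D * q ^ m := hfin
        _ ≤ D * (2 * |(t : ℝ) - s| ^ θ) := mul_le_mul_of_nonneg_left hqm hD0
        _ = 2 * D * |(t : ℝ) - s| ^ θ := by ring
    refine ⟨2 * D + 2 * C, fun s t => ?_⟩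
    have hr : 0 ≤ |(t : ℝ) - s| ^ θ := by positivity
    rcases lt_trichotomy (s : ℝ) t with hst | hst | hst
    · refine (main s t hst).trans (mul_le_mul_of_nonneg_right ?_ hr)
      linarith
    · obtain rfl : s = t := Subtype.ext hst
      rw [hdiag, sub_self, sub_self, abs_zero]
      positivity
    · have h2 := main t s hst
      have h3 := hA s t s
      rw [hdiag] at h3
      -- Reversed times reduce to the ordered case, because A s t + A t s is minus the defect of the
      -- triple (s, t, s).
      have e3 : P t - P s - A s t = -(P s - P t - A t s) + (0 - A s t - A t s) := by ring
      rw [abs_sub_comm (s : ℝ) t] at h2 h3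
      rw [← two_mul] at h3
      have h4 := h3.trans (mul_le_mul_of_nonneg_left (two_mul_rpow_le h1 (abs_nonneg _)) hC)
      rw [e3, add_mul]
      refine (abs_add_le _ _).trans (add_le_add (by rwa [abs_neg]) ?_)
      linarith
  · intro m k hk
    rw [hPd m (k + 1) hk, hPd m k hk.le, dyadicSum_succ]
    ring

end Existence

/-! ### Uniqueness and linearity of dyadic primitives -/

namespace IsDyadicPrimitive

variable {θ : ℝ} {A B : unitInterval → unitInterval → ℝ} {P Q : unitInterval → ℝ}

theorem apply_dyadic_unique (hP : IsDyadicPrimitive θ A P) (hQ : IsDyadicPrimitive θ A Q)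
    (m k : ℕ) (hk : k ≤ 2 ^ m) : P (dyadic m k) = Q (dyadic m k) := by
  induction k with
  | zero => rw [dyadic_zero, hP.zero, hQ.zero]
  | succ k ih =>
    have h1 := hP.dyadic_eq m k hk
    have h2 := hQ.dyadic_eq m k hk
    have h3 := ih (Nat.le_of_succ_le hk)
    linarith

/-- P and Q agree at dyadic points. Between such a point and t both follow the same `A` up to order
θ > 0, so `A` cancels in the difference, which is O(2^{-θm}) for every m. -/
theorem unique (h0 : 0 < θ) (hP : IsDyadicPrimitive θ A P) (hQ : IsDyadicPrimitive θ A Q) :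
    P = Q := by
  funext t
  obtain ⟨C, hC⟩ := hP.holder
  obtain ⟨D, hD⟩ := hQ.holder
  have hbound : ∀ m, |P t - Q t| ≤ (|C| + |D|) * ((1 / 2 : ℝ) ^ θ) ^ m := by
    intro m
    set s := dyadic m (dyadicIndex m t) with hs
    have e : P t - Q t = (P t - P s - A s t) - (Q t - Q s - A s t) := by
      rw [hP.apply_dyadic_unique hQ m _ (dyadicIndex_le_two_pow m t)]; ring
    have hr : |(t : ℝ) - s| ^ θ ≤ ((1 / 2 : ℝ) ^ θ) ^ m := by
      rw [← half_pow_rpow]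
      exact Real.rpow_le_rpow (abs_nonneg _) (abs_sub_dyadic_dyadicIndex_le m t) h0.le
    rw [e, add_mul]
    refine (abs_sub _ _).trans (add_le_add ((hC s t).trans ?_) ((hD s t).trans ?_))
    · exact mul_le_mul (le_abs_self C) hr (by positivity) (abs_nonneg C)
    · exact mul_le_mul (le_abs_self D) hr (by positivity) (abs_nonneg D)
  have hlim : Tendsto (fun m : ℕ => (|C| + |D|) * ((1 / 2 : ℝ) ^ θ) ^ m) atTop (𝓝 0) := by
    simpa using (tendsto_pow_atTop_nhds_zero_of_lt_one (by positivity)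
      (half_rpow_lt_one h0)).const_mul (|C| + |D|)
  have : |P t - Q t| ≤ 0 := ge_of_tendsto' hlim hbound
  exact sub_eq_zero.mp (abs_nonpos_iff.mp this)

theorem dyadicCorrection_add_smul (r : ℝ) (m k : ℕ) :
    dyadicCorrection (fun s t => A s t + r * B s t) m k =
      dyadicCorrection A m k + r * dyadicCorrection B m k := by
  induction m generalizing k with
  | zero => simp [dyadicCorrection]
  | succ m ih => simp only [dyadicCorrection, ih]; ring

theorem add_smul (hP : IsDyadicPrimitive θ A P) (r : ℝ) (hQ : IsDyadicPrimitive θ B Q) :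
    IsDyadicPrimitive θ (fun s t => A s t + r * B s t) (fun t => P t + r * Q t) := by
  refine ⟨by simp [hP.zero, hQ.zero], ?_, fun m k hk => ?_⟩
  · obtain ⟨C, hC⟩ := hP.holder
    obtain ⟨D, hD⟩ := hQ.holder
    refine ⟨C + |r| * D, fun s t => ?_⟩
    have e : P t + r * Q t - (P s + r * Q s) - (A s t + r * B s t) =
        (P t - P s - A s t) + r * (Q t - Q s - B s t) := by ring
    rw [e, add_mul, mul_assoc]
    refine (abs_add_le _ _).trans (add_le_add (hC s t) ?_)
    rw [abs_mul]
    exact mul_le_mul_of_nonneg_left (hD s t) (abs_nonneg r)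
  · rw [dyadicCorrection_add_smul, ← hP.dyadic_eq m k hk, ← hQ.dyadic_eq m k hk]
    ring

theorem zero_zero : IsDyadicPrimitive θ (fun _ _ => 0) (fun _ => 0) := by
  have h : ∀ m k, dyadicCorrection (fun _ _ => 0) m k = 0 := by
    intro m
    induction m with
    | zero => intro k; rfl
    | succ m ih => intro k; simp [dyadicCorrection, ih]
  exact ⟨rfl, ⟨0, fun s t => by simp⟩, fun m k _ => by simp [h]⟩

end IsDyadicPrimitive

/-! ### Functionals on homogeneous elements -/

section Homogeneous

variable {H : Type*} [Ring H] [HopfAlgebra ℝ H] {𝒜 : ℕ → Submodule ℝ H} [GradedAlgebra 𝒜] {N : ℕ}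

/-- The extension of a functional on `H_N` by zero to the components of larger degree. -/
noncomputable def evalExt (f : TruncDual 𝒜 N) : H →ₗ[ℝ] ℝ := f.ofConv ∘ₗ truncProj 𝒜 N

/-- The value of `evalExt f` at `x`, as a linear function of `f`. -/
noncomputable def evalAt (x : H) : TruncDual 𝒜 N →ₗ[ℝ] ℝ where
  toFun f := evalExt f x
  map_add' _ _ := rfl
  map_smul' _ _ := rfl

@[simp] theorem evalAt_apply (x : H) (f : TruncDual 𝒜 N) : evalAt x f = evalExt f x := rfl

theorem truncProj_of_lt {k : ℕ} (h : N < k) {x : H} (hx : x ∈ 𝒜 k) : truncProj 𝒜 N x = 0 := by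
  refine Subtype.ext ?_
  simp only [truncProj, LinearMap.codRestrict_apply, LinearMap.sum_apply, GradedAlgebra.proj_apply]
  refine Finset.sum_eq_zero fun j hj => ?_
  refine DirectSum.decompose_of_mem_ne 𝒜 hx ?_
  have := Finset.mem_range.mp hj
  omega

theorem truncProj_of_le {k : ℕ} (h : k ≤ N) {x : H} (hx : x ∈ 𝒜 k) :
    truncProj 𝒜 N x = ⟨x, le_trunc 𝒜 h hx⟩ :=
  Subtype.ext (truncProj_coe_of_mem 𝒜 h hx)

theorem evalExt_of_lt (f : TruncDual 𝒜 N) {k : ℕ} (h : N < k) {x : H} (hx : x ∈ 𝒜 k) :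
    evalExt f x = 0 := by
  rw [evalExt, LinearMap.comp_apply, truncProj_of_lt h hx, map_zero]

theorem evalExt_coe (f : TruncDual 𝒜 N) (x : trunc 𝒜 N) : evalExt f x = f x := by
  rw [evalExt, LinearMap.comp_apply, truncProj_coe]

theorem truncDual_ext {f g : TruncDual 𝒜 N}
    (h : ∀ k ≤ N, ∀ x ∈ 𝒜 k, evalExt f x = evalExt g x) : f = g := by
  refine WithConv.ext (LinearMap.ext fun x => ?_)
  have hle : trunc 𝒜 N ≤ LinearMap.eqLocus (evalExt f) (evalExt g) :=
    iSup₂_le fun k hk y hy => h k hk y hy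
  have := hle x.2
  rw [LinearMap.mem_eqLocus, evalExt_coe, evalExt_coe] at this
  exact this

theorem evalExt_extendZero {n m : ℕ} (f : TruncDual 𝒜 n) {k : ℕ} (hk : k ≤ m) {x : H}
    (hx : x ∈ 𝒜 k) : evalExt (extendZero m f) x = evalExt f x := by
  rw [evalExt, LinearMap.comp_apply, truncProj_of_le hk hx]
  rfl

theorem evalExt_restrict {n : ℕ} (f : TruncDual 𝒜 (n + 1)) {k : ℕ} (hk : k ≤ n) {x : H}
    (hx : x ∈ 𝒜 k) : evalExt (restrict f) x = evalExt f x := by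
  rw [evalExt, LinearMap.comp_apply, truncProj_of_le hk hx, evalExt, LinearMap.comp_apply,
    truncProj_of_le (hk.trans n.le_succ) hx]
  rfl

theorem evalExt_component_same (f : TruncDual 𝒜 N) {k : ℕ} (hk : k ≤ N) {x : H} (hx : x ∈ 𝒜 k) :
    evalExt (component k f) x = evalExt f x := by
  rw [evalExt, LinearMap.comp_apply, truncProj_of_le hk hx]
  change evalExt f (GradedAlgebra.proj 𝒜 k x) = _
  rw [GradedAlgebra.proj_apply, DirectSum.decompose_of_mem_same 𝒜 hx]

theorem evalExt_component_ne (f : TruncDual 𝒜 N) {j k : ℕ} (hjk : j ≠ k) {x : H} (hx : x ∈ 𝒜 k) :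
    evalExt (component j f) x = 0 := by
  rcases le_or_gt k N with hk | hk
  · rw [evalExt, LinearMap.comp_apply, truncProj_of_le hk hx]
    change evalExt f (GradedAlgebra.proj 𝒜 j x) = _
    rw [GradedAlgebra.proj_apply, DirectSum.decompose_of_mem_ne 𝒜 hx hjk.symm, map_zero]
  · exact evalExt_of_lt _ hk hx

/-! ### The degree filtration of the dual algebra -/

variable (𝒜 N) in
/-- The functionals on `H_N` that vanish on the components of degree less than `k`. -/
def degFiltration (k : ℕ) : Submodule ℝ (TruncDual 𝒜 N) where
  carrier := {f | ∀ j < k, ∀ x ∈ 𝒜 j, evalExt f x = 0}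
  add_mem' {f g} hf hg j hj x hx := by
    rw [← evalAt_apply, map_add, evalAt_apply, evalAt_apply, hf j hj x hx, hg j hj x hx, add_zero]
  zero_mem' j _ x _ := by rw [← evalAt_apply, map_zero]
  smul_mem' c f hf j hj x hx := by
    rw [← evalAt_apply, map_smul, evalAt_apply, hf j hj x hx, smul_zero]

theorem degFiltration_antitone : Antitone (degFiltration 𝒜 N) :=
  fun _ _ hij _ hf l hl => hf l (hl.trans_le hij)

theorem degFiltration_eq_bot : degFiltration 𝒜 N (N + 1) = ⊥ := by
  rw [eq_bot_iff]
  intro f hf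
  rw [Submodule.mem_bot]
  exact truncDual_ext fun k hk x hx => by
    rw [hf k (Nat.lt_succ_of_le hk) x hx, ← evalAt_apply, map_zero]

theorem component_mem_degFiltration (f : TruncDual 𝒜 N) (k : ℕ) :
    component k f ∈ degFiltration 𝒜 N k := fun _ hj _ hx => evalExt_component_ne f hj.ne' hx

theorem restrict_extendZero {n : ℕ} (f : TruncDual 𝒜 n) : restrict (extendZero (n + 1) f) = f :=
  truncDual_ext fun k hk x hx => by
    rw [evalExt_restrict _ hk hx, evalExt_extendZero f (hk.trans n.le_succ) hx]

theorem component_of_top {f : TruncDual 𝒜 N} (hf : f ∈ degFiltration 𝒜 N N) :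
    component N f = f := by
  refine truncDual_ext fun k hk x hx => ?_
  rcases hk.lt_or_eq with h | rfl
  · rw [evalExt_component_ne _ h.ne' hx, hf k h x hx]
  · rw [evalExt_component_same _ hk hx]

theorem evalExt_of_top {f : TruncDual 𝒜 N} (hf : f ∈ degFiltration 𝒜 N N) (x : H) :
    evalExt f x = evalExt f (GradedAlgebra.proj 𝒜 N x) := by
  induction x using DirectSum.Decomposition.inductionOn 𝒜 with
  | zero => simp
  | add x y hx hy => rw [map_add, map_add, map_add, hx, hy]
  | @homogeneous k x =>
    rw [GradedAlgebra.proj_apply]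
    by_cases h : k = N
    · subst h; rw [DirectSum.decompose_of_mem_same 𝒜 x.2]
    · rw [DirectSum.decompose_of_mem_ne 𝒜 x.2 h, map_zero]
      rcases Nat.lt_or_gt_of_ne h with h | h
      · exact hf k h x x.2
      · exact evalExt_of_lt f h x.2

/-- Multiplicative functionals on `H_N`. -/
structure IsTruncChar (X : TruncDual 𝒜 N) : Prop where
  map_one : evalExt X 1 = 1
  map_mul : ∀ i j, i + j ≤ N → ∀ x ∈ 𝒜 i, ∀ y ∈ 𝒜 j,
    evalExt X (x * y) = evalExt X x * evalExt X y

/-- Infinitesimal characters of `H_N`. -/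
def IsTruncInf (α : TruncDual 𝒜 N) : Prop :=
  ∀ i j, i + j ≤ N → ∀ x ∈ 𝒜 i, ∀ y ∈ 𝒜 j, evalExt α (x * y) =
    evalExt α x * Coalgebra.counit (R := ℝ) y + Coalgebra.counit (R := ℝ) x * evalExt α y

theorem IsTruncInf.neg {α : TruncDual 𝒜 N} (h : IsTruncInf α) : IsTruncInf (-α) := by
  intro i j hij x hx y hy
  have e : ∀ z, evalExt (-α) z = - evalExt α z := fun z => rfl
  rw [e, e, e, h i j hij x hx y hy]
  ring

/-! ### The coproduct of homogeneous elements -/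

/-- A decomposition of the coproduct of `x` of degree `k` into tensors of homogeneous elements. -/
structure HomogeneousRepr (𝒜 : ℕ → Submodule ℝ H) (k : ℕ) (x : H) where
  /-- The number of tensors. -/
  size : ℕ
  /-- The bidegrees of the tensors. -/
  deg : Fin size → ℕ × ℕ
  /-- The left factors. -/
  left : Fin size → H
  /-- The right factors. -/
  right : Fin size → H
  deg_add : ∀ i, (deg i).1 + (deg i).2 = k
  left_mem : ∀ i, left i ∈ 𝒜 (deg i).1
  right_mem : ∀ i, right i ∈ 𝒜 (deg i).2
  comul_eq : Coalgebra.comul (R := ℝ) x = ∑ i, left i ⊗ₜ[ℝ] right i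

variable [LocallyFiniteGradedConnected 𝒜]

theorem exists_homogeneousRepr {k : ℕ} {x : H} (hx : x ∈ 𝒜 k) :
    Nonempty (HomogeneousRepr 𝒜 k x) := by
  let S : Set (H ⊗[ℝ] H) := {z | ∃ p : ℕ × ℕ, p.1 + p.2 = k ∧ ∃ a ∈ 𝒜 p.1, ∃ b ∈ 𝒜 p.2,
    a ⊗ₜ[ℝ] b = z}
  have hle : (⨆ p ∈ Finset.HasAntidiagonal.antidiagonal k,
      LinearMap.range (TensorProduct.map (𝒜 p.1).subtype (𝒜 p.2).subtype)) ≤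
      Submodule.span ℝ S := by
    refine iSup₂_le fun p hp => ?_
    rintro _ ⟨z, rfl⟩
    induction z using TensorProduct.induction_on with
    | zero => rw [map_zero]; exact Submodule.zero_mem _
    | tmul a b =>
      exact Submodule.subset_span ⟨p, Finset.HasAntidiagonal.mem_antidiagonal.mp hp, a, a.2, b,
        b.2, rfl⟩
    | add u v hu hv => rw [map_add]; exact Submodule.add_mem _ hu hv
  obtain ⟨m, c, g, hg⟩ := Submodule.mem_span_set'.mp
    (hle (LocallyFiniteGradedConnected.comul_mem k x hx))
  choose p hp a ha b hb hab using fun i => (g i).2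
  refine ⟨⟨m, p, fun i => c i • a i, b, hp, fun i => Submodule.smul_mem _ _ (ha i), hb, ?_⟩⟩
  rw [← hg]
  exact Finset.sum_congr rfl fun i _ => by rw [← hab i, TensorProduct.smul_tmul']

/-- Take Δx in homogeneous tensors. The degree k part of one counit identity and the degree 0 part
of the other keep the same tensors, those with left degree 0; after applying ε they give ε(x) and 0
respectively. -/
theorem counit_of_pos {k : ℕ} (hk : 0 < k) {x : H} (hx : x ∈ 𝒜 k) :
    Coalgebra.counit (R := ℝ) x = 0 := by
  obtain ⟨r⟩ := exists_homogeneousRepr hx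
  have h1 : ∑ i, Coalgebra.counit (R := ℝ) (r.left i) • r.right i = x := by
    have := Coalgebra.rTensor_counit_comul (R := ℝ) x
    rw [r.comul_eq, map_sum] at this
    simpa [map_sum] using congrArg (TensorProduct.lid ℝ H) this
  have h2 : ∑ i, Coalgebra.counit (R := ℝ) (r.right i) • r.left i = x := by
    have := Coalgebra.lTensor_counit_comul (R := ℝ) x
    rw [r.comul_eq, map_sum] at this
    simpa [map_sum] using congrArg (TensorProduct.rid ℝ H) this
  have hp : ∀ (j l : ℕ) (y : H), y ∈ 𝒜 l →
      GradedAlgebra.proj 𝒜 j y = if l = j then y else 0 := by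
    intro j l y hy
    rw [GradedAlgebra.proj_apply]
    split_ifs with h
    · subst h; exact DirectSum.decompose_of_mem_same 𝒜 hy
    · exact DirectSum.decompose_of_mem_ne 𝒜 hy h
  have e1 : Coalgebra.counit (R := ℝ) x = ∑ i, if (r.deg i).1 = 0 then
      Coalgebra.counit (R := ℝ) (r.left i) * Coalgebra.counit (R := ℝ) (r.right i) else 0 := by
    have : GradedAlgebra.proj 𝒜 k x = x := by rw [hp k k x hx, if_pos rfl]
    conv_lhs => rw [← this, ← h1, map_sum, map_sum]
    refine Finset.sum_congr rfl fun i _ => ?_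
    have hd := r.deg_add i
    rw [map_smul, hp k _ _ (r.right_mem i)]
    by_cases h0 : (r.deg i).1 = 0
    · rw [if_pos h0, if_pos (by omega), map_smul, smul_eq_mul]
    · rw [if_neg h0, if_neg (by omega), smul_zero, map_zero]
  have e2 : (0 : ℝ) = ∑ i, if (r.deg i).1 = 0 then
      Coalgebra.counit (R := ℝ) (r.left i) * Coalgebra.counit (R := ℝ) (r.right i) else 0 := by
    have : GradedAlgebra.proj 𝒜 0 x = 0 := by rw [hp 0 k x hx, if_neg hk.ne']
    conv_lhs => rw [← map_zero (Coalgebra.counit (R := ℝ) (A := H)), ← this, ← h2, map_sum,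
      map_sum]
    refine Finset.sum_congr rfl fun i _ => ?_
    rw [map_smul, hp 0 _ _ (r.left_mem i)]
    by_cases h0 : (r.deg i).1 = 0
    · rw [if_pos h0, if_pos h0, map_smul, smul_eq_mul, mul_comm]
    · rw [if_neg h0, if_neg h0, smul_zero, map_zero]
  rw [e1, ← e2]

theorem evalExt_one {k : ℕ} (hk : k ≤ N) {x : H} (hx : x ∈ 𝒜 k) :
    evalExt (1 : TruncDual 𝒜 N) x = Coalgebra.counit (R := ℝ) x := by
  rw [evalExt, LinearMap.comp_apply, truncProj_of_le hk hx]
  rfl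

theorem evalExt_mul (f g : TruncDual 𝒜 N) {k : ℕ} (hk : k ≤ N) {x : H} (hx : x ∈ 𝒜 k)
    (r : HomogeneousRepr 𝒜 k x) :
    evalExt (f * g) x = ∑ i, evalExt f (r.left i) * evalExt g (r.right i) := by
  have h : evalExt (f * g) x = LinearMap.mul' ℝ ℝ (TensorProduct.map f.ofConv g.ofConv
      (TensorProduct.map (truncProj 𝒜 N) (truncProj 𝒜 N) (Coalgebra.comul (R := ℝ) x))) := by
    rw [evalExt, LinearMap.comp_apply, truncProj_of_le hk hx]
    rfl
  rw [h, r.comul_eq]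
  simp only [map_sum, TensorProduct.map_tmul, LinearMap.mul'_apply]
  rfl

/-! ### The filtered dual algebra -/

/-- The submodules form a filtration rather than a grading; the class asks only for
multiplicativity. A tensor of total degree below i + j has left degree below i or right degree below
j. -/
instance : SetLike.GradedMonoid (degFiltration 𝒜 N) where
  one_mem _ hj := absurd hj (Nat.not_lt_zero _)
  mul_mem {i j} f g hf hg l hl x hx := by
    rcases le_or_gt l N with hlN | hlN
    · obtain ⟨r⟩ := exists_homogeneousRepr hx
      rw [evalExt_mul f g hlN hx r]
      refine Finset.sum_eq_zero fun t _ => ?_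
      have hd := r.deg_add t
      rcases lt_or_ge (r.deg t).1 i with h | h
      · rw [hf _ h _ (r.left_mem t), zero_mul]
      · rw [hg _ (by omega) _ (r.right_mem t), mul_zero]
    · exact evalExt_of_lt _ hlN hx

theorem mem_degFiltration_one {f : TruncDual 𝒜 N} :
    f ∈ degFiltration 𝒜 N 1 ↔ evalExt f 1 = 0 := by
  constructor
  · intro h
    exact h 0 one_pos 1 (SetLike.one_mem_graded 𝒜)
  · intro h j hj x hx
    obtain rfl : j = 0 := by omega
    rw [LocallyFiniteGradedConnected.connected (𝒜 := 𝒜)] at hx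
    obtain ⟨c, rfl⟩ := Submodule.mem_span_singleton.mp hx
    rw [map_smul, h, smul_zero]

theorem evalExt_one_one : evalExt (1 : TruncDual 𝒜 N) 1 = 1 := by
  rw [evalExt_one (Nat.zero_le N) (SetLike.one_mem_graded 𝒜), Bialgebra.counit_one]

theorem sub_one_mem_degFiltration {X : TruncDual 𝒜 N} :
    X - 1 ∈ degFiltration 𝒜 N 1 ↔ evalExt X 1 = 1 := by
  rw [mem_degFiltration_one, ← evalAt_apply, map_sub, evalAt_apply, evalAt_apply,
    evalExt_one_one, sub_eq_zero]

/-- A functional of top degree annihilates the augmentation ideal of the dual algebra. -/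
theorem top_mul_eq_zero {f g : TruncDual 𝒜 N} (hf : f ∈ degFiltration 𝒜 N N)
    (hg : g ∈ degFiltration 𝒜 N 1) : f * g = 0 := by
  have := SetLike.mul_mem_graded hf hg
  rwa [degFiltration_eq_bot, Submodule.mem_bot] at this

theorem mul_top_eq_zero {f g : TruncDual 𝒜 N} (hf : f ∈ degFiltration 𝒜 N 1)
    (hg : g ∈ degFiltration 𝒜 N N) : f * g = 0 := by
  have := SetLike.mul_mem_graded hf hg
  rwa [add_comm, degFiltration_eq_bot, Submodule.mem_bot] at this

/-! ### Truncated characters -/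

/-- The bilinear form on `H` attached to an element of `H_N^* ⊗ H_N^*`. -/
noncomputable def pairing : TensorSq (TruncDual 𝒜 N) →ₗ[ℝ] H → H → ℝ :=
  TensorProduct.lift (LinearMap.mk₂ ℝ (fun f g x y => evalExt f x * evalExt g y)
    (fun _ _ _ => by funext x y; exact add_mul _ _ _)
    (fun _ _ _ => by funext x y; exact mul_assoc _ _ _)
    (fun _ _ _ => by funext x y; exact mul_add _ _ _)
    (fun _ _ _ => by funext x y; exact mul_left_comm _ _ _))

@[simp] theorem pairing_tmul (f g : TruncDual 𝒜 N) (x y : H) :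
    pairing (f ⊗ₜ[ℝ] g) x y = evalExt f x * evalExt g y := rfl

theorem pairing_mul (S T : TensorSq (TruncDual 𝒜 N)) {i j : ℕ} (hi : i ≤ N) (hj : j ≤ N)
    {x y : H} (hx : x ∈ 𝒜 i) (hy : y ∈ 𝒜 j) (r : HomogeneousRepr 𝒜 i x)
    (q : HomogeneousRepr 𝒜 j y) :
    pairing (S * T) x y = ∑ a, ∑ b,
      pairing S (r.left a) (q.left b) * pairing T (r.right a) (q.right b) := by
  induction S using TensorProduct.induction_on with
  | zero => simp
  | add S₁ S₂ h₁ h₂ =>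
    simp only [add_mul, map_add, Pi.add_apply, h₁, h₂, Finset.sum_add_distrib]
  | tmul f g =>
    induction T using TensorProduct.induction_on with
    | zero => simp
    | add T₁ T₂ h₁ h₂ =>
      simp only [mul_add, map_add, Pi.add_apply, h₁, h₂, Finset.sum_add_distrib]
    | tmul f' g' =>
      rw [Algebra.TensorProduct.tmul_mul_tmul, pairing_tmul, evalExt_mul f f' hi hx r,
        evalExt_mul g g' hj hy q, Finset.sum_mul_sum]
      refine Finset.sum_congr rfl fun a _ => Finset.sum_congr rfl fun b _ => ?_
      simp only [pairing_tmul]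
      ring

/-- `T` represents the bilinear form `(x, y) ↦ f (x * y)` in total degree at most `N`. -/
def Represents (f : TruncDual 𝒜 N) (T : TensorSq (TruncDual 𝒜 N)) : Prop :=
  ∀ i j, i + j ≤ N → ∀ x ∈ 𝒜 i, ∀ y ∈ 𝒜 j, evalExt f (x * y) = pairing T x y

namespace Represents

variable {f g : TruncDual 𝒜 N} {S T : TensorSq (TruncDual 𝒜 N)}

theorem one : Represents (1 : TruncDual 𝒜 N) 1 := by
  intro i j hij x hx y hy
  rw [Algebra.TensorProduct.one_def, pairing_tmul, evalExt_one hij (SetLike.mul_mem_graded hx hy),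
    evalExt_one (by omega) hx, evalExt_one (by omega) hy, Bialgebra.counit_mul]

/-- The coproduct is multiplicative, so the transpose of multiplication is compatible with
convolution; the degree bound passes to both factors. -/
theorem mul (hf : Represents f S) (hg : Represents g T) : Represents (f * g) (S * T) := by
  intro i j hij x hx y hy
  obtain ⟨r⟩ := exists_homogeneousRepr hx
  obtain ⟨q⟩ := exists_homogeneousRepr hy
  have h : evalExt (f * g) (x * y) = ∑ a, ∑ b,
      evalExt f (r.left a * q.left b) * evalExt g (r.right a * q.right b) := by
    have h1 : evalExt (f * g) (x * y) = LinearMap.mul' ℝ ℝ (TensorProduct.map f.ofConv g.ofConv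
        (TensorProduct.map (truncProj 𝒜 N) (truncProj 𝒜 N)
          (Coalgebra.comul (R := ℝ) (x * y)))) := by
      rw [evalExt, LinearMap.comp_apply, truncProj_of_le hij (SetLike.mul_mem_graded hx hy)]
      rfl
    rw [h1, Bialgebra.comul_mul, r.comul_eq, q.comul_eq, Finset.sum_mul_sum]
    simp only [map_sum, Algebra.TensorProduct.tmul_mul_tmul, TensorProduct.map_tmul,
      LinearMap.mul'_apply]
    rfl
  rw [h, pairing_mul S T (by omega) (by omega) hx hy r q]
  refine Finset.sum_congr rfl fun a _ => Finset.sum_congr rfl fun b _ => ?_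
  have h1 := r.deg_add a
  have h2 := q.deg_add b
  rw [hf _ _ (by omega) _ (r.left_mem a) _ (q.left_mem b),
    hg _ _ (by omega) _ (r.right_mem a) _ (q.right_mem b)]

theorem pow (hf : Represents f S) (k : ℕ) : Represents (f ^ k) (S ^ k) := by
  induction k with
  | zero => simpa using one
  | succ k ih => rw [pow_succ, pow_succ]; exact ih.mul hf

theorem smul (c : ℝ) (hf : Represents f S) : Represents (c • f) (c • S) := by
  intro i j hij x hx y hy
  rw [map_smul, Pi.smul_apply, Pi.smul_apply, ← hf i j hij x hx y hy]
  rfl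

theorem sum {ι : Type*} (t : Finset ι) {f : ι → TruncDual 𝒜 N}
    {S : ι → TensorSq (TruncDual 𝒜 N)} (h : ∀ i ∈ t, Represents (f i) (S i)) :
    Represents (∑ i ∈ t, f i) (∑ i ∈ t, S i) := by
  intro i j hij x hx y hy
  rw [map_sum, Finset.sum_apply, Finset.sum_apply, ← evalAt_apply, map_sum]
  exact Finset.sum_congr rfl fun l hl => h l hl i j hij x hx y hy

theorem expSum (hf : Represents f S) (M : ℕ) :
    Represents (RoughExt.expSum M f) (RoughExt.expSum M S) :=
  sum _ fun k _ => (hf.pow k).smul _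

end Represents

/-- Only total degree above N needs thought: a term α(x)ε(y) survives only for y of degree 0, and
then x has degree above N, where the extension vanishes. -/
theorem IsTruncInf.evalExt_mem_infChar {α : TruncDual 𝒜 N} (h : IsTruncInf α) :
    evalExt α ∈ infChar H := by
  intro x y
  induction x using DirectSum.Decomposition.inductionOn 𝒜 with
  | zero => simp
  | add x₁ x₂ h₁ h₂ => rw [add_mul, map_add, map_add, map_add, h₁, h₂]; ring
  | @homogeneous i x =>
    induction y using DirectSum.Decomposition.inductionOn 𝒜 with
    | zero => simp
    | add y₁ y₂ h₁ h₂ => rw [mul_add, map_add, map_add, map_add, h₁, h₂]; ring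
    | @homogeneous j y =>
      rcases le_or_gt (i + j) N with hij | hij
      · exact h i j hij x x.2 y y.2
      · rw [evalExt_of_lt α hij (SetLike.mul_mem_graded x.2 y.2)]
        have e1 : evalExt α (x : H) * Coalgebra.counit (R := ℝ) (y : H) = 0 := by
          rcases Nat.eq_zero_or_pos j with hj | hj
          · rw [evalExt_of_lt α (by omega) x.2, zero_mul]
          · rw [counit_of_pos hj y.2, mul_zero]
        have e2 : Coalgebra.counit (R := ℝ) (x : H) * evalExt α (y : H) = 0 := by
          rcases Nat.eq_zero_or_pos i with hi | hi
          · rw [evalExt_of_lt α (by omega) y.2, mul_zero]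
          · rw [counit_of_pos hi x.2, zero_mul]
        rw [e1, e2, add_zero]

theorem mem_truncInfChar_iff {α : TruncDual 𝒜 N} : α ∈ truncInfChar 𝒜 N ↔ IsTruncInf α := by
  constructor
  · rintro ⟨β, hβ, rfl⟩ i j hij x hx y hy
    have e : ∀ k ≤ N, ∀ z ∈ 𝒜 k, evalExt (WithConv.toConv (β ∘ₗ (trunc 𝒜 N).subtype)) z = β z := by
      intro k hk z hz
      rw [evalExt, LinearMap.comp_apply, truncProj_of_le hk hz]
      rfl
    rw [e _ hij _ (SetLike.mul_mem_graded hx hy), e i (by omega) x hx, e j (by omega) y hy]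
    exact hβ x y
  · intro h
    refine ⟨evalExt α, h.evalExt_mem_infChar, ?_⟩
    refine WithConv.ext (LinearMap.ext fun x => ?_)
    exact (evalExt_coe α x).symm

theorem IsTruncInf.mem_degFiltration {α : TruncDual 𝒜 N} (h : IsTruncInf α) :
    α ∈ degFiltration 𝒜 N 1 := by
  rw [mem_degFiltration_one]
  have h1 := SetLike.one_mem_graded 𝒜
  have := h 0 0 (Nat.zero_le N) 1 h1 1 h1
  rw [mul_one, Bialgebra.counit_one] at this
  linarith

theorem isTruncChar_iff_represents {X : TruncDual 𝒜 N} :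
    IsTruncChar X ↔ evalExt X 1 = 1 ∧ Represents X (X ⊗ₜ X) :=
  ⟨fun h => ⟨h.1, h.2⟩, fun h => ⟨h.1, h.2⟩⟩

theorem IsTruncInf.represents {α : TruncDual 𝒜 N} (h : IsTruncInf α) :
    Represents α (α ⊗ₜ[ℝ] 1 + 1 ⊗ₜ[ℝ] α : TensorSq (TruncDual 𝒜 N)) := by
  intro i j hij x hx y hy
  rw [map_add, Pi.add_apply, Pi.add_apply, pairing_tmul, pairing_tmul, evalExt_one (by omega) hy,
    evalExt_one (by omega) hx]
  exact h i j hij x hx y hy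

theorem expSum_eq_of_le {α : TruncDual 𝒜 N} (hα : α ∈ degFiltration 𝒜 N 1) {M : ℕ} (hM : N ≤ M) :
    expSum M α = truncExp α := by
  symm
  refine Finset.sum_subset (Finset.range_subset_range.mpr (by omega)) fun k _ hk => ?_
  rw [pow_eq_zero_of_le (by simpa using hk) (filtration_pow_eq_zero degFiltration_eq_bot hα),
    smul_zero]

theorem truncExp_eq (α : TruncDual 𝒜 N) : truncExp α = expSum N α := rfl

theorem truncLog_eq (X : TruncDual 𝒜 N) : truncLog X = logSum N X := rfl

/-- An infinitesimal character is represented by the primitive tensor α ⊗ 1 + 1 ⊗ α, whose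
exponential is exp α ⊗ exp α. Truncating at 2N changes nothing, as α^(N+1) = 0. -/
theorem IsTruncInf.truncExp {α : TruncDual 𝒜 N} (h : IsTruncInf α) :
    IsTruncChar (truncExp α) := by
  have hα := h.mem_degFiltration
  have hpow := filtration_pow_eq_zero degFiltration_eq_bot hα
  rw [isTruncChar_iff_represents, ← sub_one_mem_degFiltration]
  refine ⟨expSum_sub_one_mem degFiltration_antitone hα, ?_⟩
  have hr := h.represents.expSum (2 * N)
  rw [expSum_primitive hpow, expSum_eq_of_le hα (by omega)] at hr
  exact hr

theorem IsTruncChar.mul {X Y : TruncDual 𝒜 N} (hX : IsTruncChar X) (hY : IsTruncChar Y) :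
    IsTruncChar (X * Y) := by
  rw [isTruncChar_iff_represents, ← sub_one_mem_degFiltration] at *
  refine ⟨mul_sub_one_mem degFiltration_antitone hX.1 hY.1, ?_⟩
  · rw [← Algebra.TensorProduct.tmul_mul_tmul]
    exact hX.2.mul hY.2

/-- All powers X^s are multiplicative, so the polynomials s ↦ X^s(xy) and s ↦ X^s(x) X^s(y) agree.
Their linear coefficients give the claim: constant terms are counits and linear terms are values of
log X. -/
theorem IsTruncChar.truncLog {X : TruncDual 𝒜 N} (hX : IsTruncChar X) :
    IsTruncInf (truncLog X) := by
  intro i j hij x hx y hy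
  have hX1 := sub_one_mem_degFiltration.mpr hX.map_one
  have hlin := hasLinCoeff_pow (filtration_pow_eq_zero degFiltration_eq_bot hX1)
  have hr : ∀ s : ℕ, evalExt (X ^ s) (x * y) = evalExt (X ^ s) x * evalExt (X ^ s) y := by
    intro s
    have := (isTruncChar_iff_represents.mp hX).2.pow s
    rw [Algebra.TensorProduct.tmul_pow] at this
    exact this i j hij x hx y hy
  obtain ⟨p, hp, hp1⟩ := hlin (evalAt (x * y))
  obtain ⟨q, hq, hq1⟩ := hlin (evalAt x)
  obtain ⟨r, hr0, hr1⟩ := hlin (evalAt y)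
  have hpqr : p = q * r := polynomial_eq_of_eval_nat fun s => by
    rw [Polynomial.eval_mul, ← hp, ← hq, ← hr0]
    exact hr s
  have h0 : ∀ {k : ℕ}, k ≤ N → ∀ z ∈ 𝒜 k, ∀ p : Polynomial ℝ,
      (∀ s : ℕ, evalAt z (X ^ s) = p.eval (s : ℝ)) →
      p.coeff 0 = Coalgebra.counit (R := ℝ) z := by
    intro k hk z hz p hp
    have := hp 0
    rw [Nat.cast_zero, pow_zero, evalAt_apply, evalExt_one hk hz] at this
    rw [Polynomial.coeff_zero_eq_eval_zero, this]
  have e := congrArg (fun t => Polynomial.coeff t 1) hpqr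
  simp only [Polynomial.mul_coeff_one] at e
  rw [hp1, hq1, hr1, h0 (by omega) x hx q hq, h0 (by omega) y hy r hr0] at e
  simp only [evalAt_apply] at e
  rw [truncLog_eq, e]
  ring

theorem truncExp_truncLog {X : TruncDual 𝒜 N} (hX : evalExt X 1 = 1) :
    truncExp (truncLog X) = X :=
  expSum_logSum degFiltration_antitone degFiltration_eq_bot (sub_one_mem_degFiltration.mpr hX)

theorem truncLog_truncExp {α : TruncDual 𝒜 N} (hα : α ∈ degFiltration 𝒜 N 1) :
    truncLog (truncExp α) = α :=
  logSum_expSum (filtration_pow_eq_zero degFiltration_eq_bot hα)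

/-- Multiplicativity makes closure under products and inverses accessible without the BCH formula.
-/
theorem mem_charGroup_iff {X : TruncDual 𝒜 N} : X ∈ charGroup 𝒜 N ↔ IsTruncChar X := by
  constructor
  · rintro ⟨α, hα, rfl⟩
    exact (mem_truncInfChar_iff.mp hα).truncExp
  · intro h
    exact ⟨truncLog X, mem_truncInfChar_iff.mpr h.truncLog, truncExp_truncLog h.map_one⟩

theorem isUnit_of_evalExt_one {X : TruncDual 𝒜 N} (hX : evalExt X 1 = 1) : IsUnit X := by
  have := IsNilpotent.isUnit_one_add ⟨N + 1, filtration_pow_eq_zero degFiltration_eq_bot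
    (sub_one_mem_degFiltration.mpr hX)⟩
  rwa [add_sub_cancel] at this

theorem IsTruncChar.isUnit {X : TruncDual 𝒜 N} (hX : IsTruncChar X) : IsUnit X :=
  isUnit_of_evalExt_one hX.map_one

theorem IsTruncChar.inverse {X : TruncDual 𝒜 N} (hX : IsTruncChar X) :
    IsTruncChar (Ring.inverse X) := by
  have hα := hX.truncLog
  have hm := hα.mem_degFiltration
  have e : Ring.inverse X = RoughExt.truncExp (-RoughExt.truncLog X) := by
    have h := expSum_mul_expSum_neg (filtration_pow_eq_zero degFiltration_eq_bot hm)
    rw [← truncExp_eq, ← truncExp_eq, truncExp_truncLog hX.map_one] at h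
    rw [← mul_one (Ring.inverse X), ← h, Ring.inverse_mul_cancel_left _ _ hX.isUnit]
  rw [e]
  exact hα.neg.truncExp

end Homogeneous

/-! ### Families of functionals of homogeneous order -/

section Dominated

variable {H : Type*} [Ring H] [HopfAlgebra ℝ H] {𝒜 : ℕ → Submodule ℝ H} [GradedAlgebra 𝒜] {N : ℕ}
  {τ : Type*}

/-- On the component of degree `k`, the family `a` is of order `r ^ k`. -/
def Dominated (a : τ → TruncDual 𝒜 N) (r : τ → ℝ) : Prop :=
  ∀ k ≤ N, ∀ x ∈ 𝒜 k, ∃ C : ℝ, 0 ≤ C ∧ ∀ t, |evalExt (a t) x| ≤ C * r t ^ k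

namespace Dominated

variable {a c : τ → TruncDual 𝒜 N} {r r' : τ → ℝ}

theorem add (ha : Dominated a r) (hc : Dominated c r) : Dominated (fun t => a t + c t) r := by
  intro k hk x hx
  obtain ⟨C, hC, h1⟩ := ha k hk x hx
  obtain ⟨D, hD, h2⟩ := hc k hk x hx
  refine ⟨C + D, add_nonneg hC hD, fun t => ?_⟩
  rw [add_mul]
  exact (abs_add_le (evalExt (a t) x) (evalExt (c t) x)).trans (add_le_add (h1 t) (h2 t))

theorem smul (q : ℝ) (ha : Dominated a r) : Dominated (fun t => q • a t) r := by
  intro k hk x hx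
  obtain ⟨C, hC, h1⟩ := ha k hk x hx
  refine ⟨|q| * C, by positivity, fun t => ?_⟩
  have e : evalExt (q • a t) x = q * evalExt (a t) x := rfl
  rw [e, abs_mul, mul_assoc]
  exact mul_le_mul_of_nonneg_left (h1 t) (abs_nonneg q)

theorem sub (ha : Dominated a r) (hc : Dominated c r) : Dominated (fun t => a t - c t) r := by
  simpa [sub_eq_add_neg] using ha.add (hc.smul (-1))

theorem zero : Dominated (fun _ : τ => (0 : TruncDual 𝒜 N)) r := by
  intro k hk x hx
  refine ⟨0, le_rfl, fun t => ?_⟩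
  rw [← evalAt_apply, map_zero, abs_zero, zero_mul]

theorem sum {ι : Type*} (s : Finset ι) {f : ι → τ → TruncDual 𝒜 N}
    (h : ∀ i ∈ s, Dominated (f i) r) : Dominated (fun t => ∑ i ∈ s, f i t) r := by
  classical
  induction s using Finset.induction_on with
  | empty => simpa using zero
  | insert i s hi ih =>
    simp only [Finset.sum_insert hi]
    exact (h i (Finset.mem_insert_self i s)).add
      (ih fun j hj => h j (Finset.mem_insert_of_mem hj))

theorem mono (hr : ∀ t, 0 ≤ r t) (hrr : ∀ t, r t ≤ r' t) (ha : Dominated a r) :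
    Dominated a r' := by
  intro k hk x hx
  obtain ⟨C, hC, h1⟩ := ha k hk x hx
  exact ⟨C, hC, fun t => (h1 t).trans
    (mul_le_mul_of_nonneg_left (pow_le_pow_left₀ (hr t) (hrr t) k) hC)⟩

theorem comp {τ' : Type*} (ha : Dominated a r) (e : τ' → τ) :
    Dominated (fun t => a (e t)) (fun t => r (e t)) := by
  intro k hk x hx
  obtain ⟨C, hC, h1⟩ := ha k hk x hx
  exact ⟨C, hC, fun t => h1 (e t)⟩

theorem extendZero {n m : ℕ} {a : τ → TruncDual 𝒜 n}
    (ha : Dominated a r) : Dominated (fun t => extendZero m (a t)) r := by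
  intro k hk x hx
  rcases le_or_gt k n with hkn | hkn
  · obtain ⟨C, hC, h1⟩ := ha k hkn x hx
    exact ⟨C, hC, fun t => by rw [evalExt_extendZero _ hk hx]; exact h1 t⟩
  · refine ⟨0, le_rfl, fun t => ?_⟩
    rw [evalExt_extendZero _ hk hx, evalExt_of_lt _ hkn hx, abs_zero, zero_mul]

theorem of_top (h0 : ∀ t, a t ∈ degFiltration 𝒜 N N) (h : ∀ x ∈ 𝒜 N, ∃ C : ℝ, ∀ t,
    |evalExt (a t) x| ≤ C * r t ^ N) (hr : ∀ t, 0 ≤ r t) : Dominated a r := by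
  intro k hk x hx
  rcases hk.lt_or_eq with hlt | rfl
  · exact ⟨0, le_rfl, fun t => by rw [h0 t k hlt x hx, abs_zero, zero_mul]⟩
  · obtain ⟨C, hC⟩ := h x hx
    exact ⟨|C|, abs_nonneg C, fun t => (hC t).trans
      (mul_le_mul_of_nonneg_right (le_abs_self C) (pow_nonneg (hr t) _))⟩

variable [LocallyFiniteGradedConnected 𝒜]

theorem one : Dominated (fun _ : τ => (1 : TruncDual 𝒜 N)) r := by
  intro k hk x hx
  refine ⟨|Coalgebra.counit (R := ℝ) x|, abs_nonneg _, fun t => ?_⟩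
  rw [evalExt_one hk hx]
  rcases Nat.eq_zero_or_pos k with rfl | hpos
  · simp
  · rw [counit_of_pos hpos hx, abs_zero, zero_mul]

/-- The coproduct preserves total degree, so the bounds r^i and r^j of the two factors combine to
exactly r^k. -/
theorem mul (hr : ∀ t, 0 ≤ r t) (ha : Dominated a r) (hc : Dominated c r) :
    Dominated (fun t => a t * c t) r := by
  intro k hk x hx
  obtain ⟨q⟩ := exists_homogeneousRepr hx
  have hd := q.deg_add
  choose C hC h1 using fun i => ha (q.deg i).1 (by have := hd i; omega) _ (q.left_mem i)
  choose D hD h2 using fun i => hc (q.deg i).2 (by have := hd i; omega) _ (q.right_mem i)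
  refine ⟨∑ i, C i * D i, Finset.sum_nonneg fun i _ => mul_nonneg (hC i) (hD i), fun t => ?_⟩
  rw [evalExt_mul _ _ hk hx q, Finset.sum_mul]
  refine (Finset.abs_sum_le_sum_abs _ _).trans (Finset.sum_le_sum fun i _ => ?_)
  have hpow : r t ^ k = r t ^ (q.deg i).1 * r t ^ (q.deg i).2 := by rw [← pow_add, hd i]
  have e : C i * D i * r t ^ k = (C i * r t ^ (q.deg i).1) * (D i * r t ^ (q.deg i).2) := by
    rw [hpow]; ring
  rw [abs_mul, e]
  exact mul_le_mul (h1 i t) (h2 i t) (abs_nonneg _) (mul_nonneg (hC i) (pow_nonneg (hr t) _))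

theorem pow (hr : ∀ t, 0 ≤ r t) (ha : Dominated a r) (k : ℕ) :
    Dominated (fun t => a t ^ k) r := by
  induction k with
  | zero => simpa using one
  | succ k ih => simpa only [pow_succ] using ih.mul hr ha

theorem truncExp (hr : ∀ t, 0 ≤ r t) (ha : Dominated a r) :
    Dominated (fun t => truncExp (a t)) r :=
  sum _ fun k _ => (ha.pow hr k).smul _

theorem truncLog (hr : ∀ t, 0 ≤ r t) (ha : Dominated a r) :
    Dominated (fun t => truncLog (a t)) r :=
  sum _ fun k _ => ((ha.sub one).pow hr k).smul _

end Dominated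

end Dominated

/-! ### Comparison with the homogeneous norm -/

section HomNorm

variable {H : Type*} [Ring H] [HopfAlgebra ℝ H] {𝒜 : ℕ → Submodule ℝ H} [GradedAlgebra 𝒜] {N : ℕ}
  [LocallyFiniteGradedConnected 𝒜] {τ : Type*} {ι : Type*} [Fintype ι]

theorem coprodConst_nonneg (b : Module.Basis ι ℝ (trunc 𝒜 N)) : 0 ≤ coprodConst b := norm_nonneg _

/-- A vanishing constant would make the coproduct zero, contradicting the counit identity at 1. -/
theorem coprodConst_pos (b : Module.Basis ι ℝ (trunc 𝒜 N)) : 0 < coprodConst b := by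
  refine lt_of_le_of_ne (coprodConst_nonneg b) fun h0 => ?_
  have h1 : ∀ i, Coalgebra.comul (R := ℝ) (b i) = 0 := by
    intro i
    have h2 := congrFun (norm_eq_zero.mp h0.symm) i
    rw [Pi.zero_apply, Finset.sum_eq_zero_iff_of_nonneg fun _ _ => abs_nonneg _] at h2
    refine (b.tensorProduct b).repr.map_eq_zero_iff.mp (Finsupp.ext fun p => ?_)
    simpa using h2 p (Finset.mem_univ p)
  have h3 : ∀ x : trunc 𝒜 N, Coalgebra.comul (R := ℝ) x = 0 := by
    intro x
    rw [← b.sum_repr x, map_sum]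
    exact Finset.sum_eq_zero fun i _ => by rw [map_smul, h1, smul_zero]
  have hone : (1 : H) ∈ trunc 𝒜 N := le_trunc 𝒜 (Nat.zero_le N) (SetLike.one_mem_graded 𝒜)
  have h4 := Coalgebra.rTensor_counit_comul (R := ℝ) (⟨1, hone⟩ : trunc 𝒜 N)
  rw [h3, map_zero] at h4
  have h5 := congrArg (TensorProduct.lid ℝ (trunc 𝒜 N)) h4
  rw [map_zero, TensorProduct.lid_tmul, one_smul] at h5
  have h6 : (1 : H) = 0 := congrArg Subtype.val h5.symm
  have h7 := congrArg (Coalgebra.counit (R := ℝ)) h6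
  rw [Bialgebra.counit_one, map_zero] at h7
  exact one_ne_zero h7

theorem dualNorm_nonneg (b : Module.Basis ι ℝ (trunc 𝒜 N)) (f : TruncDual 𝒜 N) :
    0 ≤ dualNorm b f := mul_nonneg (coprodConst_nonneg b) (norm_nonneg _)

/-- The first of the two summands of the homogeneous norm. -/
noncomputable def gradedNorm (b : Module.Basis ι ℝ (trunc 𝒜 N)) (X : TruncDual 𝒜 N) : ℝ :=
  ⨆ k : Fin N, (((k : ℕ) + 1)! * dualNorm b (component (k + 1) X)) ^ (1 / ((k : ℝ) + 1))

theorem homNorm_eq (b : Module.Basis ι ℝ (trunc 𝒜 N)) (X : TruncDual 𝒜 N) :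
    homNorm b X = gradedNorm b X + gradedNorm b (Ring.inverse X) := rfl

theorem gradedNorm_nonneg (b : Module.Basis ι ℝ (trunc 𝒜 N)) (X : TruncDual 𝒜 N) :
    0 ≤ gradedNorm b X :=
  Real.iSup_nonneg fun _ => Real.rpow_nonneg (mul_nonneg (Nat.cast_nonneg _)
    (dualNorm_nonneg b _)) _

theorem dualNorm_component_le (b : Module.Basis ι ℝ (trunc 𝒜 N)) (X : TruncDual 𝒜 N) {k : ℕ}
    (h0 : 0 < k) (hk : k ≤ N) : dualNorm b (component k X) ≤ gradedNorm b X ^ k := by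
  obtain ⟨j, rfl⟩ : ∃ j, k = j + 1 := ⟨k - 1, by omega⟩
  set y := ((j + 1)! : ℝ) * dualNorm b (component (j + 1) X) with hy
  have hy0 : 0 ≤ y := mul_nonneg (Nat.cast_nonneg _) (dualNorm_nonneg b _)
  have h1 : y ^ (1 / ((j : ℝ) + 1)) ≤ gradedNorm b X :=
    le_ciSup (f := fun k : Fin N =>
      (((k : ℕ) + 1)! * dualNorm b (component (k + 1) X)) ^ (1 / ((k : ℝ) + 1)))
      (Set.finite_range _).bddAbove ⟨j, hk⟩
  have h2 : (y ^ (1 / ((j : ℝ) + 1))) ^ (j + 1) = y := by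
    rw [one_div, ← Nat.cast_succ]
    exact Real.rpow_inv_natCast_pow hy0 (Nat.succ_ne_zero j)
  have h3 : y ≤ gradedNorm b X ^ (j + 1) := by
    rw [← h2]
    exact pow_le_pow_left₀ (Real.rpow_nonneg hy0 _) h1 _
  refine le_trans ?_ h3
  rw [hy]
  refine le_mul_of_one_le_left (dualNorm_nonneg b _) ?_
  exact_mod_cast Nat.succ_le_of_lt (Nat.factorial_pos (j + 1))

theorem dominated_of_gradedNorm_le (b : Module.Basis ι ℝ (trunc 𝒜 N)) {a : τ → TruncDual 𝒜 N}
    (h1 : ∀ t, evalExt (a t) 1 = 1) {r : τ → ℝ} (hr : ∀ t, 0 ≤ r t) {C : ℝ}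
    (h : ∀ t, gradedNorm b (a t) ≤ C * r t) : Dominated a r := by
  intro k hk x hx
  have hD := coprodConst_pos b
  rcases Nat.eq_zero_or_pos k with rfl | hpos
  -- The homogeneous norm does not see degree 0; there the values are fixed by a(1) = 1.
  · rw [LocallyFiniteGradedConnected.connected (𝒜 := 𝒜)] at hx
    obtain ⟨c, rfl⟩ := Submodule.mem_span_singleton.mp hx
    exact ⟨|c|, abs_nonneg c, fun t => by rw [map_smul, h1]; simp⟩
  · set v : trunc 𝒜 N := ⟨x, le_trunc 𝒜 hk hx⟩ with hv
    refine ⟨(∑ i, |b.repr v i|) * (|C| ^ k / coprodConst b), by positivity, fun t => ?_⟩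
    have h0 := (gradedNorm_nonneg b (a t)).trans (h t)
    have h2 : ∀ i, |component k (a t) (b i)| ≤ |C| ^ k / coprodConst b * r t ^ k := by
      intro i
      rw [div_mul_eq_mul_div, le_div_iff₀ hD, mul_comm]
      calc coprodConst b * |component k (a t) (b i)| ≤ dualNorm b (component k (a t)) :=
            mul_le_mul_of_nonneg_left (norm_le_pi_norm (fun i => component k (a t) (b i)) i) hD.le
        _ ≤ gradedNorm b (a t) ^ k := dualNorm_component_le b (a t) hpos hk
        _ ≤ (C * r t) ^ k := pow_le_pow_left₀ (gradedNorm_nonneg b (a t)) (h t) k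
        _ ≤ |(C * r t) ^ k| := le_abs_self _
        _ = |C| ^ k * r t ^ k := by rw [abs_pow, abs_mul, mul_pow, abs_of_nonneg (hr t)]
    have h3 : evalExt (a t) x = ∑ i, b.repr v i * component k (a t) (b i) := by
      rw [← evalExt_component_same (a t) hk hx, evalExt, LinearMap.comp_apply,
        truncProj_of_le hk hx, ← hv]
      conv_lhs => rw [← b.sum_repr v, map_sum]
      exact Finset.sum_congr rfl fun i _ => map_smul _ _ _
    rw [h3, mul_assoc, Finset.sum_mul]
    refine (Finset.abs_sum_le_sum_abs _ _).trans (Finset.sum_le_sum fun i _ => ?_)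
    rw [abs_mul]
    exact mul_le_mul_of_nonneg_left (h2 i) (abs_nonneg _)

/-- Finitely many degrees and basis vectors are involved, so sums of constants serve as uniform
bounds; the k-th root turns r^k into r. -/
theorem exists_gradedNorm_le (b : Module.Basis ι ℝ (trunc 𝒜 N)) {a : τ → TruncDual 𝒜 N}
    {r : τ → ℝ} (hr : ∀ t, 0 ≤ r t) (h : Dominated a r) :
    ∃ C : ℝ, ∀ t, gradedNorm b (a t) ≤ C * r t := by
  have hproj : ∀ (k : ℕ) (x : H), GradedAlgebra.proj 𝒜 k x ∈ 𝒜 k := fun k x => by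
    rw [GradedAlgebra.proj_apply]; exact SetLike.coe_mem _
  choose C hC hCle using fun (k : Fin N) (i : ι) =>
    h (k + 1) k.2 _ (hproj (k + 1) (b i : H))
  have hS : ∀ k, 0 ≤ ∑ i, C k i := fun k => Finset.sum_nonneg fun i _ => hC k i
  let M : Fin N → ℝ := fun k =>
    (((k : ℕ) + 1)! * (coprodConst b * ∑ i, C k i)) ^ (1 / ((k : ℝ) + 1))
  have hM : ∀ k, 0 ≤ M k := fun k => Real.rpow_nonneg
    (mul_nonneg (Nat.cast_nonneg _) (mul_nonneg (coprodConst_nonneg b) (hS k))) _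
  refine ⟨∑ k, M k, fun t => Real.iSup_le (fun k => ?_)
    (mul_nonneg (Finset.sum_nonneg fun k _ => hM k) (hr t))⟩
  have h1 : dualNorm b (component (k + 1) (a t)) ≤
      coprodConst b * ∑ i, C k i * r t ^ ((k : ℕ) + 1) := by
    refine mul_le_mul_of_nonneg_left ?_ (coprodConst_nonneg b)
    refine (pi_norm_le_iff_of_nonneg (Finset.sum_nonneg fun i _ =>
      mul_nonneg (hC k i) (pow_nonneg (hr t) _))).mpr fun i => ?_
    refine le_trans (hCle k i t) ?_
    exact Finset.single_le_sum (f := fun i => C k i * r t ^ ((k : ℕ) + 1))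
      (fun i _ => mul_nonneg (hC k i) (pow_nonneg (hr t) _)) (Finset.mem_univ i)
  have h2 : (((k : ℕ) + 1)! * dualNorm b (component (k + 1) (a t))) ^ (1 / ((k : ℝ) + 1)) ≤
      M k * r t := by
    have e : r t = (r t ^ ((k : ℕ) + 1)) ^ (1 / ((k : ℝ) + 1)) := by
      rw [one_div, ← Nat.cast_succ]
      exact (Real.pow_rpow_inv_natCast (hr t) (Nat.succ_ne_zero _)).symm
    conv_rhs => rw [e]
    rw [← Real.mul_rpow (mul_nonneg (Nat.cast_nonneg _) (mul_nonneg (coprodConst_nonneg b) (hS k)))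
      (pow_nonneg (hr t) _)]
    refine Real.rpow_le_rpow (mul_nonneg (Nat.cast_nonneg _) (dualNorm_nonneg b _)) ?_
      (by positivity)
    rw [mul_assoc, mul_assoc, Finset.sum_mul]
    exact mul_le_mul_of_nonneg_left h1 (Nat.cast_nonneg _)
  exact h2.trans (mul_le_mul_of_nonneg_right
    (Finset.single_le_sum (fun k _ => hM k) (Finset.mem_univ k)) (hr t))

theorem inverse_eq_of_mul_eq_one {M : Type*} [MonoidWithZero M] {a c : M} (hu : IsUnit a)
    (h : a * c = 1) : Ring.inverse a = c := by
  rw [← mul_one (Ring.inverse a), ← h, Ring.inverse_mul_cancel_left _ _ hu]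

theorem inverse_inverse_mul {M : Type*} [MonoidWithZero M] {a c : M} (ha : IsUnit a)
    (hc : IsUnit c) : Ring.inverse (Ring.inverse a * c) = Ring.inverse c * a := by
  refine inverse_eq_of_mul_eq_one (ha.ringInverse.mul hc) ?_
  rw [mul_assoc, Ring.mul_inverse_cancel_left _ _ hc, Ring.inverse_mul_cancel _ ha]

/-- The Hölder condition in terms of the homogeneous components of the increments. -/
theorem holder_iff_dominated (b : Module.Basis ι ℝ (trunc 𝒜 N)) {γ : ℝ}
    {X : unitInterval → TruncDual 𝒜 N} (hX : ∀ t, IsTruncChar (X t)) :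
    (∃ C : ℝ, ∀ s t : unitInterval, homDist b (X s) (X t) ≤ C * |(t : ℝ) - (s : ℝ)| ^ γ) ↔
      Dominated (fun p : unitInterval × unitInterval => Ring.inverse (X p.1) * X p.2)
        (fun p => |(p.2 : ℝ) - p.1| ^ γ) := by
  have hr : ∀ p : unitInterval × unitInterval, 0 ≤ |(p.2 : ℝ) - p.1| ^ γ := fun p => by positivity
  constructor
  · rintro ⟨C, hC⟩
    have h1 : ∀ p : unitInterval × unitInterval, evalExt (Ring.inverse (X p.1) * X p.2) 1 = 1 :=
      fun p => ((hX p.1).inverse.mul (hX p.2)).map_one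
    refine dominated_of_gradedNorm_le b h1 hr (C := C) fun p => ?_
    have h := hC p.2 p.1
    rw [homDist, homNorm_eq, abs_sub_comm] at h
    exact (le_add_of_nonneg_right (gradedNorm_nonneg b _)).trans h
  · intro h
    obtain ⟨C, hC⟩ := exists_gradedNorm_le b hr h
    refine ⟨C + C, fun s t => ?_⟩
    -- The inverse of X_t⁻¹X_s is the increment X_s⁻¹X_t, so both summands of the norm are
    -- controlled by increments.
    rw [homDist, homNorm_eq, inverse_inverse_mul (hX t).isUnit (hX s).isUnit, add_mul]
    refine add_le_add ?_ (hC (s, t))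
    have := hC (t, s)
    rwa [abs_sub_comm] at this

end HomNorm

/-! ### Restriction and extension of characters -/

section Restriction

variable {H : Type*} [Ring H] [HopfAlgebra ℝ H] {𝒜 : ℕ → Submodule ℝ H} [GradedAlgebra 𝒜]
  [LocallyFiniteGradedConnected 𝒜] {N n : ℕ}

variable (𝒜 n) in
/-- The restriction to `H_n`, as a homomorphism of algebras. -/
noncomputable def restrictHom : TruncDual 𝒜 (n + 1) →ₐ[ℝ] TruncDual 𝒜 n :=
  AlgHom.ofLinearMap
    { toFun := restrict
      map_add' := fun _ _ => rfl
      map_smul' := fun _ _ => rfl }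
    (truncDual_ext fun k hk x hx => by
      refine (evalExt_restrict _ hk hx).trans ?_
      rw [evalExt_one (hk.trans n.le_succ) hx, evalExt_one hk hx])
    (fun f g => truncDual_ext fun k hk x hx => by
      obtain ⟨r⟩ := exists_homogeneousRepr hx
      refine (evalExt_restrict _ hk hx).trans ?_
      rw [evalExt_mul f g (hk.trans n.le_succ) hx r, evalExt_mul _ _ hk hx r]
      refine Finset.sum_congr rfl fun i _ => ?_
      have hd := r.deg_add i
      exact congrArg₂ (· * ·) (evalExt_restrict f (by omega) (r.left_mem i)).symm
        (evalExt_restrict g (by omega) (r.right_mem i)).symm)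

@[simp] theorem restrictHom_apply (f : TruncDual 𝒜 (n + 1)) : restrictHom 𝒜 n f = restrict f := rfl

theorem restrict_mul (f g : TruncDual 𝒜 (n + 1)) :
    restrict (f * g) = restrict f * restrict g := map_mul (restrictHom 𝒜 n) f g

theorem restrict_sub (f g : TruncDual 𝒜 (n + 1)) :
    restrict (f - g) = restrict f - restrict g := map_sub (restrictHom 𝒜 n) f g

theorem restrict_eq_zero_iff {f : TruncDual 𝒜 (n + 1)} :
    restrict f = 0 ↔ f ∈ degFiltration 𝒜 (n + 1) (n + 1) := by
  constructor
  · intro h j hj x hx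
    rw [← evalExt_restrict f (Nat.lt_succ_iff.mp hj) hx, h, ← evalAt_apply, map_zero]
  · intro h
    exact truncDual_ext fun k hk x hx => by
      rw [evalExt_restrict f hk hx, h k (Nat.lt_succ_of_le hk) x hx, ← evalAt_apply, map_zero]

theorem restrict_inverse {X : TruncDual 𝒜 (n + 1)} (hX : IsTruncChar X) :
    restrict (Ring.inverse X) = Ring.inverse (restrict X) := by
  symm
  refine inverse_eq_of_mul_eq_one (hX.isUnit.map (restrictHom 𝒜 n)) ?_
  rw [← restrict_mul, Ring.mul_inverse_cancel _ hX.isUnit]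
  exact map_one (restrictHom 𝒜 n)

theorem restrict_truncExp {α : TruncDual 𝒜 (n + 1)}
    (hα : restrict α ∈ degFiltration 𝒜 n 1) :
    restrict (truncExp α) = truncExp (restrict α) := by
  -- The extra exponential term of order n + 1 vanishes in the dual of H_n.
  rw [← expSum_eq_of_le hα n.le_succ, ← restrictHom_apply, truncExp, map_sum]
  refine Finset.sum_congr rfl fun k _ => ?_
  rw [map_smul, map_pow, restrictHom_apply]

theorem IsTruncInf.extendZero {α : TruncDual 𝒜 n} (h : IsTruncInf α) :
    IsTruncInf (extendZero (n + 1) α) :=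
  mem_truncInfChar_iff.mp ⟨evalExt α, h.evalExt_mem_infChar, rfl⟩

theorem component_extendZero (α : TruncDual 𝒜 n) :
    component (n + 1) (extendZero (n + 1) α) = 0 := by
  refine truncDual_ext fun k hk x hx => ?_
  rw [← evalAt_apply, ← evalAt_apply, map_zero, evalAt_apply]
  by_cases h : n + 1 = k
  · subst h
    rw [evalExt_component_same _ hk hx, evalExt_extendZero _ hk hx,
      evalExt_of_lt _ n.lt_succ_self hx]
  · exact evalExt_component_ne _ h hx

theorem component_add (k : ℕ) (f g : TruncDual 𝒜 N) :
    component k (f + g) = component k f + component k g := rfl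

theorem mul_of_top {f g : TruncDual 𝒜 N} (hf : f ∈ degFiltration 𝒜 N N)
    (hg : evalExt g 1 = 1) : f * g = f := by
  have := top_mul_eq_zero hf (sub_one_mem_degFiltration.mpr hg)
  rwa [mul_sub, mul_one, sub_eq_zero] at this

theorem of_top_mul {f g : TruncDual 𝒜 N} (hf : f ∈ degFiltration 𝒜 N N)
    (hg : evalExt g 1 = 1) : g * f = f := by
  have := mul_top_eq_zero (sub_one_mem_degFiltration.mpr hg) hf
  rwa [sub_mul, one_mul, sub_eq_zero] at this

/-- Products of β with elements of positive filtration vanish, so β enters only through the linear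
term. -/
theorem truncExp_add_top {α β : TruncDual 𝒜 (n + 1)} (hα : α ∈ degFiltration 𝒜 (n + 1) 1)
    (hβ : β ∈ degFiltration 𝒜 (n + 1) (n + 1)) : truncExp (α + β) = truncExp α + β := by
  have hβ1 : β ∈ degFiltration 𝒜 (n + 1) 1 := degFiltration_antitone (Nat.le_add_left 1 n) hβ
  have hpow : ∀ k, (α + β) ^ (k + 2) = α ^ (k + 2) := by
    intro k
    induction k with
    | zero =>
      rw [zero_add, pow_two, pow_two, mul_add, add_mul, add_mul, top_mul_eq_zero hβ hα,
        mul_top_eq_zero hα hβ, top_mul_eq_zero hβ hβ1, add_zero, add_zero, add_zero]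
    | succ k ih =>
      have hk : α ^ (k + 2) ∈ degFiltration 𝒜 (n + 1) 1 :=
        degFiltration_antitone (by omega) (pow_mem_filtration hα (k + 2))
      rw [show k + 1 + 2 = k + 2 + 1 by ring, pow_succ, ih, mul_add, mul_top_eq_zero hk hβ,
        add_zero, ← pow_succ]
  rw [truncExp, truncExp, Finset.sum_range_succ' _ (n + 1), Finset.sum_range_succ' _ n,
    Finset.sum_range_succ' _ (n + 1), Finset.sum_range_succ' _ n]
  simp only [add_assoc, one_add_one_eq_two, hpow]
  simp only [zero_add, pow_one, pow_zero, Nat.factorial_one, Nat.cast_one, inv_one, one_smul,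
    Nat.factorial_zero]
  abel

theorem isTruncInf_of_top {f : TruncDual 𝒜 (n + 1)}
    (hf : f ∈ degFiltration 𝒜 (n + 1) (n + 1)) (h : IsTruncChar (1 + f)) : IsTruncInf f := by
  have h0 : truncExp f = 1 + f := by
    have := truncExp_add_top (α := 0) (Submodule.zero_mem _) hf
    rwa [zero_add, truncExp_eq 0, expSum_zero] at this
  have := h.truncLog
  rwa [← h0, truncLog_truncExp (degFiltration_antitone (Nat.le_add_left 1 n) hf)] at this

theorem isTruncChar_one_add {f : TruncDual 𝒜 (n + 1)}
    (hf : f ∈ degFiltration 𝒜 (n + 1) (n + 1)) (h : IsTruncInf f) : IsTruncChar (1 + f) := by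
  have h0 : truncExp f = 1 + f := by
    have := truncExp_add_top (α := 0) (Submodule.zero_mem _) hf
    rwa [zero_add, truncExp_eq 0, expSum_zero] at this
  rw [← h0]
  exact h.truncExp

end Restriction

/-! ### The extension of a path by one degree -/

section Extension

variable {H : Type*} [Ring H] [HopfAlgebra ℝ H] {𝒜 : ℕ → Submodule ℝ H} [GradedAlgebra 𝒜]
  [LocallyFiniteGradedConnected 𝒜] {n : ℕ}

/-- The logarithm of the increment of `X` over `[s, t]`, included in `H_(n+1)^*`. -/
noncomputable def incrLog (X : unitInterval → TruncDual 𝒜 n) (s t : unitInterval) :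
    TruncDual 𝒜 (n + 1) :=
  extendZero (n + 1) (truncLog (Ring.inverse (X s) * X t))

/-- The lift of the increment of `X` over `[s, t]` whose logarithm has no component of degree
`n + 1`. -/
noncomputable def incrLift (X : unitInterval → TruncDual 𝒜 n) (s t : unitInterval) :
    TruncDual 𝒜 (n + 1) := truncExp (incrLog X s t)

/-- The lift of the path `X` whose logarithm has no component of degree `n + 1`. -/
noncomputable def pathLift (X : unitInterval → TruncDual 𝒜 n) (t : unitInterval) :
    TruncDual 𝒜 (n + 1) := truncExp (extendZero (n + 1) (truncLog (X t)))

/-- The difference between the lifted increments and the increments of the lifted path. -/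
noncomputable def liftDefect (X : unitInterval → TruncDual 𝒜 n) (s t : unitInterval) :
    TruncDual 𝒜 (n + 1) := incrLift X s t - Ring.inverse (pathLift X s) * pathLift X t

variable {X : unitInterval → TruncDual 𝒜 n}

theorem isTruncInf_extendZero_truncLog {Y : TruncDual 𝒜 n} (hY : IsTruncChar Y) :
    IsTruncInf (extendZero (n + 1) (truncLog Y)) := hY.truncLog.extendZero

theorem restrict_truncExp_extendZero_truncLog {Y : TruncDual 𝒜 n} (hY : IsTruncChar Y) :
    restrict (truncExp (extendZero (n + 1) (truncLog Y))) = Y := by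
  rw [restrict_truncExp, restrict_extendZero, truncExp_truncLog hY.map_one]
  rw [restrict_extendZero]
  exact hY.truncLog.mem_degFiltration

theorem isTruncChar_incr (hX : ∀ t, IsTruncChar (X t)) (s t : unitInterval) :
    IsTruncChar (Ring.inverse (X s) * X t) := (hX s).inverse.mul (hX t)

theorem incrLog_mem (hX : ∀ t, IsTruncChar (X t)) (s t : unitInterval) :
    incrLog X s t ∈ degFiltration 𝒜 (n + 1) 1 :=
  (isTruncInf_extendZero_truncLog (isTruncChar_incr hX s t)).mem_degFiltration

theorem isTruncChar_incrLift (hX : ∀ t, IsTruncChar (X t)) (s t : unitInterval) :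
    IsTruncChar (incrLift X s t) :=
  (isTruncInf_extendZero_truncLog (isTruncChar_incr hX s t)).truncExp

theorem isTruncChar_pathLift (hX : ∀ t, IsTruncChar (X t)) (t : unitInterval) :
    IsTruncChar (pathLift X t) := (isTruncInf_extendZero_truncLog (hX t)).truncExp

theorem isTruncChar_incr_pathLift (hX : ∀ t, IsTruncChar (X t)) (s t : unitInterval) :
    IsTruncChar (Ring.inverse (pathLift X s) * pathLift X t) :=
  isTruncChar_incr (isTruncChar_pathLift hX) s t

theorem restrict_pathLift (hX : ∀ t, IsTruncChar (X t)) (t : unitInterval) :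
    restrict (pathLift X t) = X t := restrict_truncExp_extendZero_truncLog (hX t)

theorem restrict_incrLift (hX : ∀ t, IsTruncChar (X t)) (s t : unitInterval) :
    restrict (incrLift X s t) = Ring.inverse (X s) * X t :=
  restrict_truncExp_extendZero_truncLog (isTruncChar_incr hX s t)

theorem liftDefect_mem (hX : ∀ t, IsTruncChar (X t)) (s t : unitInterval) :
    liftDefect X s t ∈ degFiltration 𝒜 (n + 1) (n + 1) := by
  rw [← restrict_eq_zero_iff, liftDefect, restrict_sub, restrict_incrLift hX, restrict_mul,
    restrict_inverse (isTruncChar_pathLift hX s), restrict_pathLift hX, restrict_pathLift hX,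
    sub_self]

/-- With G the increment of `pathLift`, the quotient of `incrLift` by G is a character equal to 1
plus the defect, and 1 + f = exp f in top degree. -/
theorem isTruncInf_liftDefect (hX : ∀ t, IsTruncChar (X t)) (s t : unitInterval) :
    IsTruncInf (liftDefect X s t) := by
  have hmem := liftDefect_mem hX s t
  refine isTruncInf_of_top hmem ?_
  set G := Ring.inverse (pathLift X s) * pathLift X t with hG
  have hGc : IsTruncChar G := isTruncChar_incr_pathLift hX s t
  have e : 1 + liftDefect X s t = Ring.inverse G * incrLift X s t := by
    have h1 : incrLift X s t = G + liftDefect X s t := (add_sub_cancel _ _).symm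
    rw [h1, mul_add, Ring.inverse_mul_cancel _ hGc.isUnit,
      of_top_mul hmem hGc.inverse.map_one]
  rw [e]
  exact hGc.inverse.mul (isTruncChar_incrLift hX s t)

/-- The increments of `pathLift` multiply exactly; the defects, being of top degree, merely add. -/
theorem incrLift_mul_incrLift (hX : ∀ t, IsTruncChar (X t)) (s u t : unitInterval) :
    incrLift X s u * incrLift X u t =
      incrLift X s t + (liftDefect X s u + liftDefect X u t - liftDefect X s t) := by
  have hsu := liftDefect_mem hX s u
  have hut := liftDefect_mem hX u t
  have h1 : ∀ a c, incrLift X a c =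
      Ring.inverse (pathLift X a) * pathLift X c + liftDefect X a c :=
    fun a c => (add_sub_cancel _ _).symm
  have h2 : Ring.inverse (pathLift X s) * pathLift X u *
      (Ring.inverse (pathLift X u) * pathLift X t) =
      Ring.inverse (pathLift X s) * pathLift X t := by
    rw [mul_assoc, Ring.mul_inverse_cancel_left _ _ (isTruncChar_pathLift hX u).isUnit]
  rw [h1 s u, h1 u t, h1 s t, mul_add, add_mul, add_mul, h2,
    mul_of_top hsu (isTruncChar_incr_pathLift hX u t).map_one,
    of_top_mul hut (isTruncChar_incr_pathLift hX s u).map_one,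
    top_mul_eq_zero hsu (degFiltration_antitone (Nat.le_add_left 1 n) hut)]
  abel

/-- BCH is the logarithm of the product of the two lifts, and that product is the exponential of
`incrLog X s t` plus the defects. The former has no component of degree n + 1. -/
theorem component_bch_incrLog (hX : ∀ t, IsTruncChar (X t)) (s u t : unitInterval) :
    component (n + 1) (bch (n + 1) (incrLog X s u) (incrLog X u t)) =
      liftDefect X s u + liftDefect X u t - liftDefect X s t := by
  have hZ : liftDefect X s u + liftDefect X u t - liftDefect X s t ∈
      degFiltration 𝒜 (n + 1) (n + 1) :=
    sub_mem (add_mem (liftDefect_mem hX s u) (liftDefect_mem hX u t)) (liftDefect_mem hX s t)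
  have h1 := bch_eq_logSum (N := n + 1) degFiltration_antitone degFiltration_eq_bot
    (incrLog_mem hX s u) (incrLog_mem hX u t)
  have h2 : expSum (n + 1) (incrLog X s u) * expSum (n + 1) (incrLog X u t) =
      truncExp (incrLog X s t + (liftDefect X s u + liftDefect X u t - liftDefect X s t)) :=
    (incrLift_mul_incrLift hX s u t).trans (truncExp_add_top (incrLog_mem hX s t) hZ).symm
  rw [h1, h2, ← truncLog_eq, truncLog_truncExp (add_mem (incrLog_mem hX s t)
    (degFiltration_antitone (Nat.le_add_left 1 n) hZ)), component_add, incrLog,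
    component_extendZero, zero_add, component_of_top hZ]

theorem dyadicZ_mem (m k : ℕ) : dyadicZ X m k ∈ degFiltration 𝒜 (n + 1) (n + 1) := by
  induction m generalizing k with
  | zero => exact Submodule.zero_mem _
  | succ m ih =>
    exact sub_mem (Submodule.smul_mem _ _ (ih _))
      (Submodule.smul_mem _ _ (component_mem_degFiltration _ _))

/-- The BCH component is minus the additivity defect of `liftDefect`, which explains the opposite
signs of the two recursions. -/
theorem evalExt_dyadicZ (hX : ∀ t, IsTruncChar (X t)) (x : H) (m k : ℕ) :
    evalExt (dyadicZ X m k) x =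
      dyadicCorrection (fun s t => evalExt (liftDefect X s t) x) m k := by
  induction m generalizing k with
  | zero => rw [dyadicZ, dyadicCorrection, ← evalAt_apply, map_zero]
  | succ m ih =>
    have h := component_bch_incrLog hX (dyadic (m + 1) (2 * (k / 2)))
      (dyadic (m + 1) (2 * (k / 2) + 1)) (dyadic (m + 1) (2 * (k / 2) + 2))
    have e : dyadicZ X (m + 1) k = (1 / 2 : ℝ) • dyadicZ X m (k / 2) - (1 / 2 : ℝ) •
        (liftDefect X (dyadic (m + 1) (2 * (k / 2))) (dyadic (m + 1) (2 * (k / 2) + 1)) +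
          liftDefect X (dyadic (m + 1) (2 * (k / 2) + 1)) (dyadic (m + 1) (2 * (k / 2) + 2)) -
          liftDefect X (dyadic (m + 1) (2 * (k / 2))) (dyadic (m + 1) (2 * (k / 2) + 2))) := by
      rw [← h]; rfl
    rw [e, dyadicCorrection, ← ih, ← evalAt_apply]
    simp only [map_sub, map_add, map_smul, smul_eq_mul, evalAt_apply]
    ring

theorem truncExp_dyadicLog_add_dyadicZ (hX : ∀ t, IsTruncChar (X t)) (m k : ℕ) :
    truncExp (dyadicLog X m k + dyadicZ X m k) =
      incrLift X (dyadic m k) (dyadic m (k + 1)) + dyadicZ X m k :=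
  truncExp_add_top (incrLog_mem hX _ _) (dyadicZ_mem m k)

theorem inverse_mul_pathLift_add (hX : ∀ t, IsTruncChar (X t))
    {P : unitInterval → TruncDual 𝒜 (n + 1)}
    (hP : ∀ t, P t ∈ degFiltration 𝒜 (n + 1) (n + 1)) (s t : unitInterval) :
    Ring.inverse (pathLift X s + P s) * (pathLift X t + P t) =
      incrLift X s t + (P t - P s - liftDefect X s t) := by
  have hs := isTruncChar_pathLift hX s
  have hG := isTruncChar_incr_pathLift hX s t
  have hunit : IsUnit (pathLift X s + P s) := by
    refine isUnit_of_evalExt_one ?_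
    have := hP s 0 (Nat.succ_pos n) 1 (SetLike.one_mem_graded 𝒜)
    rw [← evalAt_apply, map_add, evalAt_apply, evalAt_apply, this, add_zero, hs.map_one]
  have hPst : P t - P s ∈ degFiltration 𝒜 (n + 1) (n + 1) := sub_mem (hP t) (hP s)
  have h1 : incrLift X s t + (P t - P s - liftDefect X s t) =
      Ring.inverse (pathLift X s) * pathLift X t + (P t - P s) := by
    rw [liftDefect]; abel
  have h2 : (pathLift X s + P s) * (Ring.inverse (pathLift X s) * pathLift X t + (P t - P s)) =
      pathLift X t + P t := by
    rw [mul_add, add_mul, add_mul, Ring.mul_inverse_cancel_left _ _ hs.isUnit,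
      mul_of_top (hP s) hG.map_one, of_top_mul hPst hs.map_one,
      top_mul_eq_zero (hP s) (degFiltration_antitone (Nat.le_add_left 1 n) hPst)]
    abel
  rw [h1, ← h2, Ring.inverse_mul_cancel_left _ _ hunit]

/-! ### Estimates for the top-degree correction -/

section Analysis

variable {γ : ℝ}

theorem dominated_incrLift {τ : Type*} {r : τ → ℝ} (hr : ∀ p, 0 ≤ r p) {e : τ → unitInterval}
    {f : τ → unitInterval}
    (h : Dominated (fun p => Ring.inverse (X (e p)) * X (f p)) r) :
    Dominated (fun p => incrLift X (e p) (f p)) r :=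
  (h.truncLog hr).extendZero.truncExp hr

/-- The additivity defect is the top component of E_{st} - E_{su}E_{ut}. All three lifts are of
homogeneous order (|u-s| + |t-u|)^γ, hence so is this difference; in degree n + 1 that is the
exponent γ(n+1). -/
theorem nearlyAdditive_liftDefect (hX : ∀ t, IsTruncChar (X t)) (hγ : 0 ≤ γ)
    (h : Dominated (fun p : unitInterval × unitInterval => Ring.inverse (X p.1) * X p.2)
      (fun p => |(p.2 : ℝ) - p.1| ^ γ)) (x : H) :
    NearlyAdditive (γ * (n + 1 : ℕ)) (fun s t => evalExt (liftDefect X s t) x) := by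
  let τ := unitInterval × unitInterval × unitInterval
  let r : τ → ℝ := fun p => (|(p.2.1 : ℝ) - p.1| + |(p.2.2 : ℝ) - p.2.1|) ^ γ
  have hr : ∀ p, 0 ≤ r p := fun p => by positivity
  have hr0 : ∀ p : unitInterval × unitInterval, 0 ≤ |(p.2 : ℝ) - p.1| ^ γ := fun p => by positivity
  have h1 : Dominated (fun p : τ => incrLift X p.1 p.2.2) r := by
    refine dominated_incrLift hr ((h.comp fun p : τ => (p.1, p.2.2)).mono (fun p => hr0 _) fun p =>
      Real.rpow_le_rpow (abs_nonneg _) ?_ hγ)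
    calc |(p.2.2 : ℝ) - p.1| = |((p.2.1 : ℝ) - p.1) + ((p.2.2 : ℝ) - p.2.1)| := by ring_nf
      _ ≤ _ := abs_add_le _ _
  have h2 : Dominated (fun p : τ => incrLift X p.1 p.2.1) r :=
    dominated_incrLift hr ((h.comp fun p : τ => (p.1, p.2.1)).mono (fun p => hr0 _) fun p =>
      Real.rpow_le_rpow (abs_nonneg _) (le_add_of_nonneg_right (abs_nonneg _)) hγ)
  have h3 : Dominated (fun p : τ => incrLift X p.2.1 p.2.2) r :=
    dominated_incrLift hr ((h.comp fun p : τ => (p.2.1, p.2.2)).mono (fun p => hr0 _) fun p =>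
      Real.rpow_le_rpow (abs_nonneg _) (le_add_of_nonneg_left (abs_nonneg _)) hγ)
  have hproj : GradedAlgebra.proj 𝒜 (n + 1) x ∈ 𝒜 (n + 1) := by
    rw [GradedAlgebra.proj_apply]; exact SetLike.coe_mem _
  obtain ⟨C, -, hC⟩ := (h1.sub (h2.mul hr h3)) (n + 1) le_rfl _ hproj
  refine ⟨C, fun s u t => ?_⟩
  have hst := liftDefect_mem hX s t
  have hsu := liftDefect_mem hX s u
  have hut := liftDefect_mem hX u t
  have e : evalExt (liftDefect X s t) x - evalExt (liftDefect X s u) x -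
      evalExt (liftDefect X u t) x =
      evalExt (incrLift X s t - incrLift X s u * incrLift X u t)
        (GradedAlgebra.proj 𝒜 (n + 1) x) := by
    rw [incrLift_mul_incrLift hX, evalExt_of_top hst, evalExt_of_top hsu, evalExt_of_top hut]
    simp only [← evalAt_apply, map_sub, map_add]
    ring
  rw [e, Real.rpow_mul_natCast (by positivity)]
  exact hC (s, u, t)

/-- The corrections of degree `n + 1` that turn the lift of the path into a Hölder path. -/
theorem exists_correction (hγ0 : 0 < γ) (hγ1 : γ * (n + 1 : ℕ) < 1)
    (hX : ∀ t, IsTruncChar (X t))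
    (h : Dominated (fun p : unitInterval × unitInterval => Ring.inverse (X p.1) * X p.2)
      (fun p => |(p.2 : ℝ) - p.1| ^ γ)) :
    ∃ P : unitInterval → TruncDual 𝒜 (n + 1),
    (∀ t, P t ∈ degFiltration 𝒜 (n + 1) (n + 1)) ∧ (∀ t, IsTruncInf (P t)) ∧
    ∀ k ≤ n + 1, ∀ x ∈ 𝒜 k, IsDyadicPrimitive (γ * (n + 1 : ℕ))
      (fun s t => evalExt (liftDefect X s t) x) (fun t => evalExt (P t) x) := by
  have hθ : 0 < γ * (n + 1 : ℕ) := by positivity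
  choose p hp using fun x : H =>
    exists_isDyadicPrimitive hθ hγ1 (nearlyAdditive_liftDefect hX hγ0.le h x)
  -- The primitives are chosen separately for each x; their uniqueness transfers every linear
  -- relation from `liftDefect` to them.
  have hlin : ∀ (x y z : H) (c d : ℝ), (∀ s t, evalExt (liftDefect X s t) z =
      c * evalExt (liftDefect X s t) x + d * evalExt (liftDefect X s t) y) →
      ∀ t, p z t = c * p x t + d * p y t := by
    intro x y z c d hz t
    have h1 := (IsDyadicPrimitive.zero_zero.add_smul c (hp x)).add_smul d (hp y)
    have h2 : (fun s t => 0 + c * evalExt (liftDefect X s t) x +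
        d * evalExt (liftDefect X s t) y) = fun s t => evalExt (liftDefect X s t) z := by
      funext s t; rw [hz, zero_add]
    rw [h2] at h1
    have h3 := congrFun ((hp z).unique hθ h1) t
    rwa [zero_add] at h3
  let P : unitInterval → TruncDual 𝒜 (n + 1) := fun t => WithConv.toConv
    ({ toFun := fun x => p x t
       map_add' := fun x y => by
        rw [hlin x y (x + y) 1 1 (fun s t => by rw [map_add]; ring)]; ring
       map_smul' := fun c x => by
        rw [hlin x x (c • x) c 0 (fun s t => by rw [map_smul, smul_eq_mul]; ring),
          RingHom.id_apply, smul_eq_mul]; ring } ∘ₗ (trunc 𝒜 (n + 1)).subtype)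
  have hPe : ∀ t, ∀ k ≤ n + 1, ∀ x ∈ 𝒜 k, evalExt (P t) x = p x t := by
    intro t k hk x hx
    rw [evalExt, LinearMap.comp_apply, truncProj_of_le hk hx]
    rfl
  refine ⟨P, fun t => ?_, fun t => ?_, fun k hk x hx => ?_⟩
  · intro j hj x hx
    rw [hPe t j hj.le x hx, hlin x x x 0 0 fun s t => by
      rw [liftDefect_mem hX s t j hj x hx]; ring]
    ring
  · intro i j hij x hx y hy
    rw [hPe t _ hij _ (SetLike.mul_mem_graded hx hy), hPe t i (by omega) x hx,
      hPe t j (by omega) y hy, hlin x y (x * y) (Coalgebra.counit (R := ℝ) y)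
        (Coalgebra.counit (R := ℝ) x) fun s t => by
          rw [isTruncInf_liftDefect hX s t i j hij x hx y hy]; ring]
    ring
  · have e : (fun t => evalExt (P t) x) = p x := funext fun t => hPe t k hk x hx
    rw [e]
    exact hp x

/-- This serves uniqueness: in any admissible extension, subtracting `incrLift` from an increment
leaves P_t - P_s - A_{st}, and in top degree both terms have order γ(n+1). -/
theorem isDyadicPrimitive_of_extension (hX : ∀ t, IsTruncChar (X t))
    (h : Dominated (fun p : unitInterval × unitInterval => Ring.inverse (X p.1) * X p.2)
      (fun p => |(p.2 : ℝ) - p.1| ^ γ))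
    {P : unitInterval → TruncDual 𝒜 (n + 1)}
    (hP : ∀ t, P t ∈ degFiltration 𝒜 (n + 1) (n + 1)) (h0 : P 0 = 0)
    (hd : Dominated (fun p : unitInterval × unitInterval =>
      Ring.inverse (pathLift X p.1 + P p.1) * (pathLift X p.2 + P p.2))
      (fun p => |(p.2 : ℝ) - p.1| ^ γ))
    (hz : ∀ m k : ℕ, k < 2 ^ m →
      Ring.inverse (pathLift X (dyadic m k) + P (dyadic m k)) *
        (pathLift X (dyadic m (k + 1)) + P (dyadic m (k + 1))) =
          truncExp (dyadicLog X m k + dyadicZ X m k)) {x : H} (hx : x ∈ 𝒜 (n + 1)) :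
    IsDyadicPrimitive (γ * (n + 1 : ℕ))
      (fun s t => evalExt (liftDefect X s t) x) (fun t => evalExt (P t) x) := by
  have hr : ∀ p : unitInterval × unitInterval, 0 ≤ |(p.2 : ℝ) - p.1| ^ γ := fun p => by positivity
  refine ⟨by rw [h0, ← evalAt_apply, map_zero], ?_, fun m k hk => ?_⟩
  · obtain ⟨C, -, hC⟩ := (hd.sub (dominated_incrLift hr h)) (n + 1) le_rfl x hx
    refine ⟨C, fun s t => ?_⟩
    have e := hC (s, t)
    simp only [inverse_mul_pathLift_add hX hP, add_sub_cancel_left] at e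
    rw [Real.rpow_mul_natCast (abs_nonneg _)]
    simpa only [← evalAt_apply, map_sub] using e
  · have e := hz m k hk
    rw [inverse_mul_pathLift_add hX hP, truncExp_dyadicLog_add_dyadicZ hX, add_right_inj] at e
    rw [← evalExt_dyadicZ hX, ← e]
    simp only [← evalAt_apply, map_sub]

end Analysis

end Extension

theorem pathLift_of_eq_one {H : Type*} [Ring H] [HopfAlgebra ℝ H]
    {𝒜 : ℕ → Submodule ℝ H} [GradedAlgebra 𝒜] [RoughExt.LocallyFiniteGradedConnected 𝒜] {n : ℕ}
    {X : unitInterval → RoughExt.TruncDual 𝒜 n} {t : unitInterval} (ht : X t = 1) :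
    pathLift X t = 1 := by
  have h1 : truncLog (1 : TruncDual 𝒜 n) = 0 := by
    refine Finset.sum_eq_zero fun k hk => ?_
    rw [sub_self, zero_pow (by have := (Finset.mem_Icc.mp hk).1; omega), smul_zero]
  have h2 : extendZero (n + 1) (0 : TruncDual 𝒜 n) = 0 := rfl
  rw [pathLift, ht, h1, h2, truncExp_eq, expSum_zero]

end RoughExt

/-! ### The extension theorem -/

theorem mainTheorem3 {H : Type*} [Ring H] [HopfAlgebra ℝ H]
    (𝒜 : ℕ → Submodule ℝ H) [GradedAlgebra 𝒜] [RoughExt.LocallyFiniteGradedConnected 𝒜]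
    (γ : ℝ) (hγ0 : 0 < γ) (hγ1 : γ < 1) (hγ : ∀ m : ℕ, γ⁻¹ ≠ (m : ℝ))
    (n : ℕ) (hn : 1 ≤ n) (hnN : n + 1 ≤ ⌊γ⁻¹⌋₊)
    {ι κ : Type*} [Fintype ι] [Fintype κ]
    (b : Module.Basis ι ℝ (RoughExt.trunc 𝒜 n))
    (b' : Module.Basis κ ℝ (RoughExt.trunc 𝒜 (n + 1)))
    (X : unitInterval → RoughExt.TruncDual 𝒜 n)
    (hX : RoughExt.IsHolderPath b γ X) :
    ∃! Y : unitInterval → RoughExt.TruncDual 𝒜 (n + 1),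
      RoughExt.IsHolderPath b' γ Y ∧
      (∀ t : unitInterval, RoughExt.restrict (Y t) = X t) ∧
      ∀ m k : ℕ, k < 2 ^ m →
        Ring.inverse (Y (RoughExt.dyadic m k)) * Y (RoughExt.dyadic m (k + 1)) =
          RoughExt.truncExp (RoughExt.dyadicLog X m k + RoughExt.dyadicZ X m k) := by
  open RoughExt in
  have hXc : ∀ t, IsTruncChar (X t) := fun t => mem_charGroup_iff.mp (hX.mem_charGroup t)
  have h := (holder_iff_dominated b hXc).mp hX.holder
  have hθ1 : γ * (n + 1 : ℕ) < 1 := by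
    have h1 : ((n + 1 : ℕ) : ℝ) ≤ γ⁻¹ :=
      (Nat.cast_le.mpr hnN).trans (Nat.floor_le (inv_nonneg.mpr hγ0.le))
    -- Non-integrality of γ⁻¹ makes n + 1 ≤ γ⁻¹ strict.
    have h2 := mul_lt_mul_of_pos_left (lt_of_le_of_ne h1 (hγ (n + 1)).symm) hγ0
    rwa [mul_inv_cancel₀ hγ0.ne'] at h2
  have hθ0 : 0 < γ * (n + 1 : ℕ) := by positivity
  have hr : ∀ p : unitInterval × unitInterval, 0 ≤ |(p.2 : ℝ) - p.1| ^ γ := fun p => by positivity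
  have hL0 : pathLift X 0 = 1 := pathLift_of_eq_one hX.zero
  obtain ⟨P, hPtop, hPinf, hP⟩ := exists_correction hγ0 hθ1 hXc h
  have hP0 : P 0 = 0 := truncDual_ext fun k hk x hx => by
    rw [(hP k hk x hx).zero, ← evalAt_apply, map_zero]
  have hYc : ∀ t, IsTruncChar (pathLift X t + P t) := fun t => by
    have hL := isTruncChar_pathLift hXc t
    -- The sum equals L_t ⋆ (1 + P_t), a product of characters.
    rw [← of_top_mul (hPtop t) hL.map_one]
    nth_rewrite 1 [← mul_one (pathLift X t)]
    rw [← mul_add]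
    exact hL.mul (isTruncChar_one_add (hPtop t) (hPinf t))
  refine ⟨fun t => pathLift X t + P t, ⟨⟨fun t => mem_charGroup_iff.mpr (hYc t), ?_, ?_⟩, ?_, ?_⟩,
    ?_⟩
  · rw [hL0, hP0, add_zero]
  · refine (holder_iff_dominated b' hYc).mpr ?_
    simp only [inverse_mul_pathLift_add hXc hPtop]
    refine (dominated_incrLift hr h).add (Dominated.of_top (fun p => ?_) (fun x hx => ?_) hr)
    · exact sub_mem (sub_mem (hPtop _) (hPtop _)) (liftDefect_mem hXc _ _)
    · obtain ⟨C, hC⟩ := (hP (n + 1) le_rfl x hx).holder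
      refine ⟨C, fun p => ?_⟩
      have e := hC p.1 p.2
      rw [Real.rpow_mul_natCast (abs_nonneg _)] at e
      simpa only [← evalAt_apply, map_sub] using e
  · intro t
    have e := restrict_sub (pathLift X t + P t) (P t)
    rw [add_sub_cancel_right, restrict_pathLift hXc, restrict_eq_zero_iff.mpr (hPtop t),
      sub_zero] at e
    exact e.symm
  · intro m k hk
    rw [inverse_mul_pathLift_add hXc hPtop, truncExp_dyadicLog_add_dyadicZ hXc, add_right_inj]
    refine truncDual_ext fun j hj x hx => ?_
    rw [evalExt_dyadicZ hXc, ← (hP j hj x hx).dyadic_eq m k hk]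
    simp only [← evalAt_apply, map_sub]
  · rintro Y ⟨hY, hYX, hYz⟩
    have hYc' : ∀ t, IsTruncChar (Y t) := fun t => mem_charGroup_iff.mp (hY.mem_charGroup t)
    -- A competing extension differs from `pathLift` in top degree only, and this difference is a
    -- primitive with the same dyadic corrections as `P`.
    have hQtop : ∀ t, Y t - pathLift X t ∈ degFiltration 𝒜 (n + 1) (n + 1) := fun t => by
      rw [← restrict_eq_zero_iff, restrict_sub, hYX, restrict_pathLift hXc, sub_self]
    have hQ : ∀ x ∈ 𝒜 (n + 1), IsDyadicPrimitive (γ * (n + 1 : ℕ))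
        (fun s t => evalExt (liftDefect X s t) x) (fun t => evalExt (Y t - pathLift X t) x) := by
      intro x hx
      refine isDyadicPrimitive_of_extension (P := fun t => Y t - pathLift X t) hXc h hQtop ?_ ?_ ?_
        hx
      · rw [hL0, hY.zero, sub_self]
      · simpa only [add_sub_cancel] using (holder_iff_dominated b' hYc').mp hY.holder
      · simpa only [add_sub_cancel] using hYz
    funext t
    rw [← sub_eq_iff_eq_add']
    refine truncDual_ext fun k hk x hx => ?_
    rcases hk.lt_or_eq with hlt | rfl
    · rw [hQtop t k hlt x hx, hPtop t k hlt x hx]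
    · exact congrFun ((hQ x hx).unique hθ0 (hP (n + 1) le_rfl x hx)) t
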